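/- **Model.** Let $G=(V,E)$ be a finite, simple, undirected, connected graph with $n=|V|$, $m=|E|$ and maximum degree $\Delta$. At each node $v$ the incident edges carry distinct labels (ports) $0,\dots,\delta_v-1$, where $\delta_v$ is the degree of $v$; the two labels of an edge are unrelated. A set $A$ of $k\le n$ agents with distinct positive identifiers is placed on the nodes; nodes are anonymous and have no memory. Each agent $a$ has a read-only variable $a.\mathrm{pin}$: it is the label, at the node just reached, of the edge traversed by $a$ in the previous step, and $-1$ if $a$ did not move (or in step $0$). In each synchronous step, the agents located at the same node $v$ update their variables, including $a.\mathrm{pout}\in\{-1,0,\dots,\delta_v-1\}$, as a deterministic function of their own states and $\delta_v$ only; then each agent with $a.\mathrm{pout}\ne-1$ moves via port $a.\mathrm{pout}$, and the others stay. No agent knows $n,m,k$ or $\Delta$. A configuration (states and locations of all agents) is *legitimate* if all agents are at different nodes and no agent ever changes its location in the execution starting from it. **Algorithm.** Each agent has the variables $\mathrm{mode}\in\{\text{leader},\text{zombie},\text{settled}\}$, $\mathrm{slot}\in\{0,1,2,3\}$, $\mathrm{level}$, $\mathrm{leader}$, $\mathrm{last}$, $\mathrm{inport}$, with the initial values leader,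 $0$, $0$, $a.\mathrm{id}$, $0$, $-1$. Agent $a$ is stronger than $b$ if $(a.\mathrm{level},a.\mathrm{leader})$ is lexicographically larger than $(b.\mathrm{level},b.\mathrm{leader})$. In each step, the set $A(v)$ of the agents at a node $v$ acts as follows, in this order; $a_v$ denotes the settled agent at $v$. 1. Let $x$ be the leader among the strongest agents of $A(v)$ if there is one, and $x=a_v$ otherwise. Set $a.\mathrm{pout}\gets-1$ for all $a\in A(v)$. All leaders in $A(v)\setminus\{x\}$ become zombies. If $x$ is a leader and $x.\mathrm{pin}\ne-1$, set $x.\mathrm{inport}\gets x.\mathrm{pin}$. 2. If $|A(v)|\ge2$ and $x$ is a leader: increase $x.\mathrm{level}$ by one if some zombie at $v$ has level $x.\mathrm{level}$. Then do the first applicable of the following. (a) If there is no settled agent at $v$, an arbitrary zombie at $v$ becomes settled (so it is now $a_v$) and $(a_v.\mathrm{level},a_v.\mathrm{leader},a_v.\mathrm{last})\gets(x.\mathrm{level},x.\mathrm{leader},x.\mathrm{inport})$. (b) If $(a_v.\mathrm{level},a_v.\mathrm{leader})\neq(x.\mathrm{level},x.\mathrm{id})$, make the same assignment to $a_v$. (c)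 If $x.\mathrm{inport}\ne a_v.\mathrm{last}$, set $a.\mathrm{pout}\gets x.\mathrm{inport}$ for all $a\in A(v)\setminus\{a_v\}$. (d) If $x.\mathrm{slot}=0$, set $a.\mathrm{pout}\gets(x.\mathrm{inport}+1)\bmod\delta_v$ for all $a\in A(v)\setminus\{a_v\}$, and $a_v.\mathrm{last}\gets x.\mathrm{pout}$. 3. If $|A(v)|\ge2$ and $x=a_v$: let $h$ be the maximum level of the zombies at $v$. If ($h<a_v.\mathrm{level}$ and $a_v.\mathrm{slot}\in\{2,3\}$) or ($h=a_v.\mathrm{level}$ and $a_v.\mathrm{slot}=2$), set $a.\mathrm{pout}\gets a_v.\mathrm{last}$ for all $a\in A(v)\setminus\{a_v\}$. 4. Set $a.\mathrm{slot}\gets(a.\mathrm{slot}+1)\bmod4$ for all $a\in A(v)$. **Theorem.** Let $m'=\min\bigl(m,\,k\Delta/2,\,\binom k2\bigr)$, and let $\ell$ be the number of nodes that initially hold at least one agent. (i) There is an absolute constant $c$ such that for every such graph, port labelling, set of $k\le n$ agents, choice of identifiers and initial placement, with all agents in the initial state, and for every deterministic rule for the arbitrary choice in 2(a), the execution of the algorithm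 reaches a legitimate configuration within $c\,m'\,(1+\log_2\ell)$ steps (for $k=0$, where $m'=0$, this means within $0$ steps). (ii) For every polynomial $p$ there is a constant $c_p$ such that, if moreover all identifiers are at most $p(k)$, then at all times each agent uses at most $c_p\,(1+\log_2(k+\Delta))$ bits to store the values of all its variables (including $\mathrm{id}$, $\mathrm{pin}$ and $\mathrm{pout}$) in binary. -/

import Mathlib

namespace Dispersion

/-! ## The model: synchronous mobile agents on port-labelled graphs -/

/-- A local port labelling of a graph: at every node `v`, the edges incident to `v` carry the
distinct labels `0, …, δ_v - 1`; `port v u` is the label at `v` of the edge `{v, u}`.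
Nothing relates the two labels of an edge. -/
structure PortLabelling {V : Type*} [Fintype V] (G : SimpleGraph V) [DecidableRel G.Adj] where
  port : (v : V) → G.neighborSet v ≃ Fin (G.degree v)

/-- What an agent carries: its read-only identifier, its read-only incoming port `pin`
(`-1` if the agent did not move in the previous step), its outgoing port `pout`
(`-1` if it stays), and the remaining variables `mem` of the algorithm. -/
@[ext] structure AgentState (M : Type*) where
  id : ℕ
  pin : ℤ
  pout : ℤ
  mem : M

/-- A deterministic algorithm for mobile agents. The initial memory may refer to the agent's own
identifier only. In every step, the new memory and the new `pout` of an agent located at a node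
are determined by the degree of that node, by the set of the states of all agents located there
(identifiers are distinct, so this set determines the state of each of them), and by the agent's
own state. In particular an algorithm has no access to node identities, to memory stored at
nodes, or to global parameters. -/
structure Algorithm (M : Type*) where
  init : ℕ → M
  rule : (δ : ℕ) → Finset (AgentState M) → AgentState M → M × ℤ

/-- A configuration gives the state and the location of each agent. -/
abbrev Config (M A V : Type*) := A → AgentState M × V

section Model

variable {M A V : Type*} [Fintype A] [Fintype V] {G : SimpleGraph V} [DecidableRel G.Adj]

/-- The node reached from `v` via port `q`, with the label at that node of the traversed edge;
for `q = -1` (or any `q` that is not a port of `v`) the agent stays and its next `pin` is `-1`. -/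
def travel (P : PortLabelling G) (v : V) (q : ℤ) : V × ℤ :=
  if h : 0 ≤ q ∧ q.toNat < G.degree v then
    let u := (P.port v).symm ⟨q.toNat, h.2⟩
    (u.1, ((P.port u.1 ⟨v, SimpleGraph.Adj.symm u.2⟩ : ℕ) : ℤ))
  else (v, -1)

open Classical in
/-- The states of the agents located at `v`. -/
noncomputable def localView (C : Config M A V) (v : V) : Finset (AgentState M) :=
  (Finset.univ.filter fun a => (C a).2 = v).image fun a => (C a).1

/-- One synchronous step: all agents first compute, then move. -/
noncomputable def Algorithm.next (alg : Algorithm M) (P : PortLabelling G)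
    (C : Config M A V) : Config M A V := fun a =>
  let s := (C a).1
  let v := (C a).2
  let out := alg.rule (G.degree v) (localView C v) s
  let dest := travel P v out.2
  ({ id := s.id, pin := dest.2, pout := out.2, mem := out.1 }, dest.1)

/-- The configuration at time `t` of the execution starting from `C`. -/
noncomputable def Algorithm.exec (alg : Algorithm M) (P : PortLabelling G)
    (C : Config M A V) (t : ℕ) : Config M A V :=
  (alg.next P)^[t] C

/-- The configuration in which all agents are in the initial state, for given identifiers and
a given placement. -/
def Algorithm.initial (alg : Algorithm M) (ident : A → ℕ) (place : A → V) : Config M A V :=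
  fun a => ({ id := ident a, pin := -1, pout := -1, mem := alg.init (ident a) }, place a)

/-- A configuration is legitimate if all agents are located at different nodes and no agent
changes its location in the execution starting from it. -/
def Algorithm.Legitimate (alg : Algorithm M) (P : PortLabelling G) (C : Config M A V) : Prop :=
  (Function.Injective fun a => (C a).2) ∧ ∀ t a, (alg.exec P C t a).2 = (C a).2

/-- The number `ℓ` of nodes at which at least one agent is placed. -/
noncomputable def occupied (place : A → V) : ℕ := (Set.range place).ncard

end Model

/-- `m' = min(m, kΔ/2, k(k-1)/2)`. -/
noncomputable def mPrime {V : Type*} [Fintype V] (G : SimpleGraph V) [DecidableRel G.Adj]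
    (k : ℕ) : ℝ :=
  min (G.edgeSet.ncard : ℝ) (min ((k : ℝ) * G.maxDegree / 2) (k.choose 2 : ℝ))

/-! ## The algorithm -/

inductive Mode where
  | leader
  | zombie
  | settled
  deriving DecidableEq

/-- The variables of the algorithm (besides `id`, `pin` and `pout`). -/
@[ext] structure Mem where
  mode : Mode
  slot : Fin 4
  level : ℕ
  leaderId : ℕ
  last : ℤ
  inport : ℤ

abbrev Agent := AgentState Mem

/-- `a` is stronger than `b`. -/
def Stronger (a b : Agent) : Prop :=
  b.mem.level < a.mem.level ∨ (b.mem.level = a.mem.level ∧ b.mem.leaderId < a.mem.leaderId)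

/-- The zombies among the agents in `S`. -/
def zombies (S : Finset Agent) : Finset Agent := S.filter fun a => a.mem.mode = Mode.zombie

open Classical in
/-- The set of strongest agents in `S`. -/
noncomputable def strongest (S : Finset Agent) : Finset Agent :=
  S.filter fun a => ∀ b ∈ S, ¬ Stronger b a

open Classical in
/-- The settled agent `a_v` in `S`, if it exists. -/
noncomputable def settledAgent (S : Finset Agent) : Option Agent :=
  if h : ∃ s ∈ S, s.mem.mode = Mode.settled then some h.choose else none

open Classical in
/-- The agent `a_max`: the leader among the strongest agents if there is one, and otherwise
the settled agent. -/
noncomputable def aMax (S : Finset Agent) : Option Agent :=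
  if h : ∃ l ∈ strongest S, l.mem.mode = Mode.leader then some h.choose else settledAgent S

/-- The settled agent `s` is a minion of the leader `l`. -/
def IsMinion (s l : Agent) : Prop := s.mem.level = l.mem.level ∧ s.mem.leaderId = l.id

instance (s l : Agent) : Decidable (IsMinion s l) := by unfold IsMinion; infer_instance

/-- Initialization of `pout`; every leader other than `m = a_max` becomes a zombie; `m` records
its incoming port if it is a leader that has just moved. -/
def killAndRecord (m a : Agent) : Agent :=
  { a with
    pout := -1
    mem := { a.mem with
      mode := if a.mem.mode = Mode.leader ∧ a.id ≠ m.id then Mode.zombie else a.mem.mode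
      inport := if a.id = m.id ∧ a.mem.mode = Mode.leader ∧ a.pin ≠ -1 then a.pin
        else a.mem.inport } }

open Classical in
/-- The leader `m` increases its level if some zombie in `S` has the same level. -/
noncomputable def raiseLevel (S : Finset Agent) (m a : Agent) : Agent :=
  if a.id = m.id ∧ ∃ z ∈ zombies S, z.mem.level = m.mem.level then
    { a with mem := { a.mem with level := a.mem.level + 1 } }
  else a

/-- `a` becomes a minion of `m` whose pointer is the incoming port of `m`. -/
def makeMinion (m a : Agent) : Agent :=
  { a with
    mem := { a.mem with
      level := m.mem.level, leaderId := m.mem.leaderId, last := m.mem.inport } }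

/-- A rule for choosing the zombie that becomes settled: it may depend on everything that the
agents at the node know (the degree `δ`, their states `S₀` at the beginning of the step and their
current states `S`), and it picks a zombie of `S` whenever there is one. -/
structure ZombieChoice where
  pick : (δ : ℕ) → (S₀ S : Finset Agent) → Agent
  pick_mem : ∀ δ S₀ S, (zombies S).Nonempty → pick δ S₀ S ∈ zombies S

/-- The actions of the agents in `S` when `a_max` is the leader `m` and `S` has at least two
elements, after `m` has updated its level: the new state of `a`. Here `S₀` holds the states at
the beginning of the step. -/
noncomputable def leaderAction (ch : ZombieChoice) (δ : ℕ) (S₀ S : Finset Agent)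
    (m a : Agent) : Agent :=
  match settledAgent S with
  | none =>
    if a.id = (ch.pick δ S₀ S).id then
      makeMinion m { a with mem := { a.mem with mode := Mode.settled } }
    else a
  | some s =>
    if ¬ IsMinion s m then
      if a.id = s.id then makeMinion m a else a
    else if m.mem.inport ≠ s.mem.last then
      -- backtrack
      if a.id = s.id then a else { a with pout := m.mem.inport }
    else if m.mem.slot = 0 then
      -- explore the next port
      if a.id = s.id then { a with mem := { a.mem with last := (m.mem.inport + 1) % (δ : ℤ) } }
      else { a with pout := (m.mem.inport + 1) % (δ : ℤ) }
    else a

/-- The actions of the agents in `S` when `a_max` is the settled agent `s` and `S` has at least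
two elements: the zombies chase along the pointer of `s`, in the timeslots `2` and `3` if all of
them are weak, and in the timeslot `2` only if some of them is strong. -/
def chaseAction (S : Finset Agent) (s a : Agent) : Agent :=
  let top := (zombies S).sup fun z => z.mem.level
  if (top < s.mem.level ∧ (s.mem.slot = 2 ∨ s.mem.slot = 3)) ∨
      (top = s.mem.level ∧ s.mem.slot = 2) then
    if a.id = s.id then a else { a with pout := s.mem.last }
  else a

open Classical in
/-- The state of agent `a` after the actions of the agents `S` located at a node of degree `δ`,
except for the update of `slot`. (In an execution `a_max` always exists.) -/
noncomputable def localAction (ch : ZombieChoice) (δ : ℕ) (S : Finset Agent) (a : Agent) :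
    Agent :=
  match aMax S with
  | none => { a with pout := -1 }
  | some m =>
    let S₁ := S.image (killAndRecord m)
    let m₁ := killAndRecord m m
    let a₁ := killAndRecord m a
    if 2 ≤ S.card then
      if m₁.mem.mode = Mode.leader then
        leaderAction ch δ S (S₁.image (raiseLevel S₁ m₁)) (raiseLevel S₁ m₁ m₁)
          (raiseLevel S₁ m₁ a₁)
      else chaseAction S₁ m₁ a₁
    else a₁

/-- The proposed dispersion algorithm. -/
noncomputable def algorithm (ch : ZombieChoice) : Algorithm Mem where
  init ident :=
    { mode := Mode.leader, slot := 0, level := 0, leaderId := ident, last := 0, inport := -1 }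
  rule δ S a :=
    let b := localAction ch δ S a
    ({ b.mem with slot := b.mem.slot + 1 }, b.pout)

/-- The number of bits of the binary representation of an integer, including its sign. -/
def intBits (z : ℤ) : ℕ := 1 + Nat.size z.natAbs

/-- The number of bits used by an agent to store the values of all its variables
(two bits each for `mode` and `slot`). -/
def memoryBits (a : Agent) : ℕ :=
  Nat.size a.id + intBits a.pin + intBits a.pout + 2 + 2 + Nat.size a.mem.level +
    Nat.size a.mem.leaderId + intBits a.mem.last + intBits a.mem.inport

end Dispersion

/-! Four consecutive slots form a cycle. In slot `0` a leader standing on its own up-to-date minion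
explores one more port. In slot `1` it goes back if it has met one of its minions whose pointer
differs from the incoming port. In the slots `2` and `3` zombies without a dominating leader follow
pointers: twice if all of them are below the level of the label, once if the highest of them has
exactly this level.

Levels stay small. The agents that are at a node and unsettled after its actions travel on as one
group; give the group the weight `2 ^ l`, where `l` is its highest level. A leader raises its level
only on meeting an unsettled agent of the same level. This agent belongs to another group, since a
leader has strictly the highest level in its own group. So a raise from `l` to `l + 1` merges two
groups of weight at least `2 ^ l` each, and the total weight never grows (`Good.sum_weight_le`). It
starts below twice the number of occupied nodes, which bounds all levels (`two_pow_lvl_le`).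

Crowded nodes force levels up. `Reached j` says that every node with two agents has an agent of
level at least `j`. Once `j` exceeds all possible levels, no two agents share a node, and then
nobody moves any more. It remains to pass from `Reached j` to `Reached (j + 1)` in a number of
cycles linear in `portBound`, that is, in `m'`. This takes three stages.

In the first stage the `Weak` nodes die out, where a group of levels below `j` sits on a label of
level `j`. Such a group makes two pointer steps per cycle, while the ends of the pointer paths
(leaders and strong zombies) recede by at most one (`Cycle.weak_next`). In the second stage, a
leader that violates `Status j` in two consecutive cycles keeps its level `j` and explores a port.
Its ports since its last raise form a depth-first traversal inside the set of occupied nodes, so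
there are at most `portBound` of them. The traversal cannot run out of ports, because a complete one
would need a settled agent on each node besides the leader, hence more agents than nodes
(`Ghost.incomplete`). In the third stage, every leader that acts on company rises above `j`, so the
path ends no longer recede, and the zombies at `Stuck` nodes reach a sink at one step per cycle
(`Cycle.stuck_next`).

All this rests on invariants about pointers: from each label, the pointers lead through labels at
least as strong to a stronger label, a leader, or a zombie at least as strong (`Calm.reach`,
`Semi.reach`). Paths are transferred from slot to slot with a length budget, once for a generic pair
of strength classes. The instance `above` gives the invariants, the instance `atLevel` the timing.

For the memory bound, ports are bounded by the maximum degree, identifiers by the polynomial, and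
levels are logarithmic in the number of agents. -/

namespace Dispersion

set_option linter.unusedSectionVars false

/-! ### Strengths, dominating leaders and the basic invariants -/

section Accessors

variable {A V : Type*}

/-- The node of an agent. -/
def loc (C : Config Mem A V) (a : A) : V := (C a).2

/-- The mode of an agent. -/
def mode (C : Config Mem A V) (a : A) : Mode := (C a).1.mem.mode

/-- The strength of an agent: its level and its leader, in lexicographic order. -/
def str (C : Config Mem A V) (a : A) : ℕ ×ₗ ℕ := toLex ((C a).1.mem.level, (C a).1.mem.leaderId)

/-- The level of an agent. -/
def lvl (C : Config Mem A V) (a : A) : ℕ := (ofLex (str C a)).1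

/-- The pointer of an agent. -/
def lst (C : Config Mem A V) (a : A) : ℤ := (C a).1.mem.last

/-- The incoming port that a leader uses in the next step. -/
def ein (C : Config Mem A V) (a : A) : ℤ :=
  if (C a).1.pin ≠ -1 then (C a).1.pin else (C a).1.mem.inport

/-- The strength of a leader after raising its level. -/
def bump (p : ℕ ×ₗ ℕ) : ℕ ×ₗ ℕ := toLex ((ofLex p).1 + 1, (ofLex p).2)

theorem lt_bump (p : ℕ ×ₗ ℕ) : p < bump p := by
  rw [Prod.Lex.lt_iff]; left; simp [bump]

theorem level_le_of_le {p q : ℕ ×ₗ ℕ} (h : p ≤ q) : (ofLex p).1 ≤ (ofLex q).1 := by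
  rw [Prod.Lex.le_iff] at h; omega

theorem stronger_iff (C : Config Mem A V) (a b : A) :
    Stronger (C a).1 (C b).1 ↔ str C b < str C a := by
  rw [Prod.Lex.lt_iff]; simp [Stronger, str]

/-- The leader `x` is a strongest agent at `v`. -/
def Dom (C : Config Mem A V) (v : V) (x : A) : Prop :=
  loc C x = v ∧ mode C x = Mode.leader ∧ ∀ b, loc C b = v → str C b ≤ str C x

/-- The invariants that hold in all configurations: agents keep their identifiers, a node has at
most one settled agent, an agent that is not settled is its own leader, and all agents agree on
the slot. -/
structure Base (ident : A → ℕ) (sl : Fin 4) (C : Config Mem A V) : Prop where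
  id_eq : ∀ a, (C a).1.id = ident a
  settled_unique : ∀ a b, mode C a = Mode.settled → mode C b = Mode.settled → loc C a = loc C b →
    a = b
  lid_eq : ∀ a, mode C a ≠ Mode.settled → (C a).1.mem.leaderId = ident a
  slot_eq : ∀ a, (C a).1.mem.slot = sl

/-- An unsettled agent stores its own identifier in `leaderId`, so its strength determines it. -/
theorem Base.str_ne {ident : A → ℕ} (hid : Function.Injective ident) {sl : Fin 4}
    {C : Config Mem A V} (hB : Base ident sl C) {a b : A} (ha : mode C a ≠ Mode.settled)
    (hb : mode C b ≠ Mode.settled) (h : str C a = str C b) : a = b := by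
  apply hid
  rw [← hB.lid_eq a ha, ← hB.lid_eq b hb]
  exact congrArg (fun p : ℕ ×ₗ ℕ => (ofLex p).2) h

theorem Dom.unique {C : Config Mem A V} {ident : A → ℕ} (hid : Function.Injective ident)
    {sl : Fin 4} (hB : Base ident sl C) {v : V} {x y : A} (hx : Dom C v x) (hy : Dom C v y) :
    x = y := by
  apply hB.str_ne hid (by rw [hx.2.1]; decide) (by rw [hy.2.1]; decide)
  exact le_antisymm (hy.2.2 x hx.1) (hx.2.2 y hy.1)

end Accessors

/-! ### From the program to a description of one step at one node -/

section Spec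

variable {A V : Type*} [Fintype V] {G : SimpleGraph V} [DecidableRel G.Adj]

/-- The effect of one step on a node `v` with at least two agents at which the leader `x` is a
strongest agent; `s` is the settled agent at `v` after the step, and the other agents leave via
port `q`. -/
structure DomStep (P : PortLabelling G) (sl : Fin 4) (C C' : Config Mem A V) (v : V) (x s : A)
    (q : ℤ) : Prop where
  loc_s : loc C s = v
  ne : s ≠ x
  mode_s : mode C' s = Mode.settled
  loc_s' : loc C' s = v
  str_s : str C' s = str C' x
  move : ∀ a, loc C a = v → a ≠ s → loc C' a = (travel P v q).1
  ein_x : ein C' x = if (travel P v q).2 = -1 then ein C x else (travel P v q).2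
  zombie : ∀ a, loc C a = v → a ≠ s → a ≠ x → mode C' a = Mode.zombie ∧ str C' a = str C a
  mode_x : mode C' x = Mode.leader
  uniq : ∀ a, loc C a = v → mode C a = Mode.settled → a = s
  raise : (str C' x = bump (str C x) ∧
      ∃ z, loc C z = v ∧ z ≠ x ∧ mode C z ≠ Mode.settled ∧ lvl C z = lvl C x) ∨
    (str C' x = str C x ∧
      ∀ z, loc C z = v → z ≠ x → mode C z ≠ Mode.settled → lvl C z ≠ lvl C x)
  out : (q = -1 ∧ lst C' s = ein C x ∧ (mode C s = Mode.settled → str C s ≠ str C' x)) ∨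
    (mode C s = Mode.settled ∧ str C s = str C' x ∧
      ((lst C s ≠ ein C x ∧ q = ein C x ∧ lst C' s = lst C s) ∨
       (lst C s = ein C x ∧ sl = 0 ∧ q = (ein C x + 1) % (G.degree v : ℤ) ∧ lst C' s = q) ∨
       (lst C s = ein C x ∧ sl ≠ 0 ∧ q = -1 ∧ lst C' s = lst C s)))

/-- The effect of one step on a node `v` with settled agent `s` at which no leader is a strongest
agent; the other agents leave via port `q`. -/
structure SetStep (P : PortLabelling G) (sl : Fin 4) (C C' : Config Mem A V) (v : V) (s : A)
    (q : ℤ) : Prop where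
  loc_s : loc C s = v
  mode_s : mode C s = Mode.settled
  mode_s' : mode C' s = Mode.settled
  loc_s' : loc C' s = v
  str_s : str C' s = str C s
  lst_s : lst C' s = lst C s
  move : ∀ a, loc C a = v → a ≠ s →
    loc C' a = (travel P v q).1 ∧ mode C' a = Mode.zombie ∧ str C' a = str C a
  q_cases : q = -1 ∨ q = lst C s
  stay : sl ≠ 2 → sl ≠ 3 → q = -1
  chase_two : sl = 2 → (∀ a, loc C a = v → lvl C a ≤ lvl C s) →
    (∃ a, loc C a = v ∧ a ≠ s) → q = lst C s
  chase_three : sl = 3 → (∀ a, loc C a = v → a ≠ s → lvl C a < lvl C s) →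
    (∃ a, loc C a = v ∧ a ≠ s) → q = lst C s
  stay_three : sl = 3 → (∃ a, loc C a = v ∧ a ≠ s ∧ lvl C s ≤ lvl C a) → q = -1

theorem travel_neg_one (P : PortLabelling G) (v : V) : travel P v (-1) = (v, -1) := by
  simp [travel]

variable [Fintype A]

theorem mem_localView {C : Config Mem A V} {v : V} {s : Agent} :
    s ∈ localView C v ↔ ∃ a, loc C a = v ∧ (C a).1 = s := by
  simp [localView, loc]

theorem two_le_card_localView {C : Config Mem A V} {ident : A → ℕ}
    (hid : Function.Injective ident) {sl : Fin 4} (hB : Base ident sl C) {v : V} {a b : A}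
    (ha : loc C a = v) (hb : loc C b = v) (hab : a ≠ b) : 2 ≤ (localView C v).card := by
  have : 1 < (localView C v).card := by
    rw [Finset.one_lt_card]
    refine ⟨(C a).1, mem_localView.2 ⟨a, ha, rfl⟩, (C b).1, mem_localView.2 ⟨b, hb, rfl⟩, ?_⟩
    intro h
    apply hab; apply hid
    rw [← hB.id_eq a, ← hB.id_eq b, h]
  omega

theorem card_localView_le_one {C : Config Mem A V} {v : V} {a : A}
    (h : ∀ b, loc C b = v → b = a) : ¬ 2 ≤ (localView C v).card := by
  have : (localView C v).card ≤ 1 := by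
    rw [Finset.card_le_one]
    intro s hs t ht
    obtain ⟨c, hc, rfl⟩ := mem_localView.1 hs
    obtain ⟨d, hd, rfl⟩ := mem_localView.1 ht
    rw [h c hc, h d hd]
  omega

theorem settledAgent_eq_some {S : Finset Agent} {s : Agent} (hs : s ∈ S)
    (hm : s.mem.mode = Mode.settled) (hu : ∀ t ∈ S, t.mem.mode = Mode.settled → t = s) :
    settledAgent S = some s := by
  have h : ∃ s ∈ S, s.mem.mode = Mode.settled := ⟨s, hs, hm⟩
  rw [settledAgent, dif_pos h]
  exact congrArg some (hu _ h.choose_spec.1 h.choose_spec.2)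

theorem settledAgent_eq_none {S : Finset Agent} (h : ∀ t ∈ S, t.mem.mode ≠ Mode.settled) :
    settledAgent S = none := by
  rw [settledAgent, dif_neg]
  rintro ⟨s, hs, hm⟩
  exact h s hs hm

theorem strongest_leader_iff {C : Config Mem A V} {v : V} {l : Agent} :
    (l ∈ strongest (localView C v) ∧ l.mem.mode = Mode.leader) ↔
      ∃ x, Dom C v x ∧ (C x).1 = l := by
  simp only [strongest, Finset.mem_filter, mem_localView]
  constructor
  · rintro ⟨⟨⟨x, hx, rfl⟩, h⟩, hm⟩
    refine ⟨x, ⟨hx, hm, fun b hb => ?_⟩, rfl⟩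
    have := h _ ⟨b, hb, rfl⟩
    rw [stronger_iff] at this
    exact not_lt.1 this
  · rintro ⟨x, ⟨hx, hm, h⟩, rfl⟩
    refine ⟨⟨⟨x, hx, rfl⟩, ?_⟩, hm⟩
    rintro _ ⟨b, hb, rfl⟩
    rw [stronger_iff]
    exact not_lt.2 (h b hb)

theorem aMax_of_dom {C : Config Mem A V} {ident : A → ℕ} (hid : Function.Injective ident)
    {sl : Fin 4} (hB : Base ident sl C) {v : V} {x : A} (hx : Dom C v x) :
    aMax (localView C v) = some (C x).1 := by
  have h : ∃ l ∈ strongest (localView C v), l.mem.mode = Mode.leader :=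
    ⟨(C x).1, strongest_leader_iff.2 ⟨x, hx, rfl⟩⟩
  rw [aMax, dif_pos h]
  obtain ⟨y, hy, hyl⟩ := strongest_leader_iff.1 h.choose_spec
  rw [← hyl, hx.unique hid hB hy]

theorem aMax_of_not_dom {C : Config Mem A V} {v : V} (hx : ¬ ∃ x, Dom C v x) :
    aMax (localView C v) = settledAgent (localView C v) := by
  rw [aMax, dif_neg]
  rintro ⟨l, hl⟩
  obtain ⟨y, hy, -⟩ := strongest_leader_iff.1 hl
  exact hx ⟨y, hy⟩

theorem settledAgent_localView {C : Config Mem A V} {ident : A → ℕ}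
    {sl : Fin 4} (hB : Base ident sl C) {s : A} (hs : mode C s = Mode.settled) :
    settledAgent (localView C (loc C s)) = some (C s).1 := by
  apply settledAgent_eq_some (mem_localView.2 ⟨s, rfl, rfl⟩) hs
  intro t ht hm
  obtain ⟨b, hb, rfl⟩ := mem_localView.1 ht
  rw [hB.settled_unique b s hm hs hb]

variable (ch : ZombieChoice) (P : PortLabelling G)

theorem next_eq (C : Config Mem A V) (a : A) :
    (algorithm ch).next P C a =
      let b := localAction ch (G.degree (loc C a)) (localView C (loc C a)) (C a).1
      let dest := travel P (loc C a) b.pout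
      ({ id := (C a).1.id, pin := dest.2, pout := b.pout,
         mem := { b.mem with slot := b.mem.slot + 1 } }, dest.1) := rfl

theorem next_fields {C : Config Mem A V} {a : A} {v : V} (hv : loc C a = v) {b : Agent}
    (hb : localAction ch (G.degree v) (localView C v) (C a).1 = b) :
    loc ((algorithm ch).next P C) a = (travel P v b.pout).1 ∧
    mode ((algorithm ch).next P C) a = b.mem.mode ∧
    str ((algorithm ch).next P C) a = toLex (b.mem.level, b.mem.leaderId) ∧
    lst ((algorithm ch).next P C) a = b.mem.last ∧
    ein ((algorithm ch).next P C) a =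
      if (travel P v b.pout).2 = -1 then b.mem.inport else (travel P v b.pout).2 := by
  subst hv hb
  refine ⟨rfl, rfl, rfl, rfl, ?_⟩
  have h : ∀ z i : ℤ, (if z ≠ -1 then z else i) = if z = -1 then i else z := fun z i => by
    split_ifs <;> simp_all
  exact h _ _

/-- A lone agent skips all actions. Copying `pin` to `inport` does not change `ein`, which
anticipates exactly this copy; only leaders make it. -/
theorem step_alone {C : Config Mem A V} {ident : A → ℕ} (hid : Function.Injective ident)
    {sl : Fin 4} (hB : Base ident sl C) {a : A} (h : ∀ b, loc C b = loc C a → b = a) :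
    loc ((algorithm ch).next P C) a = loc C a ∧ mode ((algorithm ch).next P C) a = mode C a ∧
      str ((algorithm ch).next P C) a = str C a ∧ lst ((algorithm ch).next P C) a = lst C a ∧
      (mode C a = Mode.leader → ein ((algorithm ch).next P C) a = ein C a) := by
  have hc := card_localView_le_one h
  by_cases hd : ∃ x, Dom C (loc C a) x
  · obtain ⟨x, hx⟩ := hd
    obtain rfl := h x hx.1
    have hb : localAction ch (G.degree (loc C x)) (localView C (loc C x)) (C x).1 =
        killAndRecord (C x).1 (C x).1 := by
      simp only [localAction, aMax_of_dom hid hB hx, if_neg hc]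
    obtain ⟨h1, h2, h3, h4, h5⟩ := next_fields ch P rfl hb
    rw [h1, h2, h3, h4, h5]
    have hm := hx.2.1
    simp only [mode] at hm
    simp [killAndRecord, travel_neg_one, mode, str, lst, ein, hm]
  · have hns : mode C a ≠ Mode.leader := by
      intro hm
      exact hd ⟨a, rfl, hm, fun b hb => by rw [h b hb]⟩
    by_cases hs : mode C a = Mode.settled
    · have hb : localAction ch (G.degree (loc C a)) (localView C (loc C a)) (C a).1 =
          killAndRecord (C a).1 (C a).1 := by
        simp only [localAction, aMax_of_not_dom hd, settledAgent_localView hB hs, if_neg hc]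
      obtain ⟨h1, h2, h3, h4, h5⟩ := next_fields ch P rfl hb
      rw [h1, h2, h3, h4, h5]
      simp only [mode] at hs
      simp [killAndRecord, travel_neg_one, mode, str, lst, hs]
    · have hn : settledAgent (localView C (loc C a)) = none := by
        apply settledAgent_eq_none
        intro t ht
        obtain ⟨b, hb, rfl⟩ := mem_localView.1 ht
        rw [h b hb]; exact hs
      have hb : localAction ch (G.degree (loc C a)) (localView C (loc C a)) (C a).1 =
          { (C a).1 with pout := -1 } := by
        simp only [localAction, aMax_of_not_dom hd, hn]
      obtain ⟨h1, h2, h3, h4, h5⟩ := next_fields ch P rfl hb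
      rw [h1, h2, h3, h4, h5]
      simp [travel_neg_one, mode, str, lst] at *
      exact fun h => absurd h hns

/-- Without a dominating leader `a_max` is the settled agent, so every other agent, leader or not,
becomes a zombie, and the chase depends on the highest level among all of them. -/
theorem step_settled {C : Config Mem A V} {ident : A → ℕ} (hid : Function.Injective ident)
    {sl : Fin 4} (hB : Base ident sl C) {v : V} {s : A} (hv : loc C s = v)
    (hs : mode C s = Mode.settled) (hd : ¬ ∃ x, Dom C v x) :
    ∃ q, SetStep P sl C ((algorithm ch).next P C) v s q := by
  classical
  have hne : ∀ a, loc C a = v → a ≠ s → (C a).1.id ≠ (C s).1.id := by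
    intro a _ has h
    rw [hB.id_eq, hB.id_eq] at h
    exact has (hid h)
  have hmax : aMax (localView C v) = some (C s).1 := by
    rw [aMax_of_not_dom hd, ← hv, settledAgent_localView hB hs]
  have hms : (C s).1.mem.mode = Mode.settled := hs
  have hkill : ∀ a, loc C a = v → a ≠ s → killAndRecord (C s).1 (C a).1 =
      { (C a).1 with pout := -1, mem := { (C a).1.mem with mode := Mode.zombie } } := by
    intro a ha has
    have h1 := hne a ha has
    have h2 : (C a).1.mem.mode ≠ Mode.settled := fun h =>
      has (hB.settled_unique a s h hs (ha.trans hv.symm))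
    rcases hm : (C a).1.mem.mode with _ | _ | _
    · simp [killAndRecord, h1, hm]
    · simp [killAndRecord, h1, hm]
    · exact absurd hm h2
  have hkills : killAndRecord (C s).1 (C s).1 = { (C s).1 with pout := -1 } := by
    simp [killAndRecord, hms]
    rw [← hms]
  by_cases hc : 2 ≤ (localView C v).card
  · set S₁ := (localView C v).image (killAndRecord (C s).1) with hS₁
    have hact : ∀ a, localAction ch (G.degree v) (localView C v) (C a).1 =
        chaseAction S₁ (killAndRecord (C s).1 (C s).1) (killAndRecord (C s).1 (C a).1) := by
      intro a
      simp only [localAction, hmax, if_pos hc]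
      rw [if_neg]
      simp [hkills, hms]
    have hz : ∀ z, z ∈ zombies S₁ ↔
        ∃ a, loc C a = v ∧ a ≠ s ∧ killAndRecord (C s).1 (C a).1 = z := by
      intro z
      simp only [zombies, hS₁, Finset.mem_filter, Finset.mem_image, mem_localView]
      constructor
      · rintro ⟨⟨_, ⟨a, ha, rfl⟩, rfl⟩, hm⟩
        refine ⟨a, ha, ?_, rfl⟩
        rintro rfl
        rw [hkills] at hm
        simp [hms] at hm
      · rintro ⟨a, ha, has, rfl⟩
        exact ⟨⟨_, ⟨a, ha, rfl⟩, rfl⟩, by rw [hkill a ha has]⟩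
    set top := (zombies S₁).sup fun z => z.mem.level with htop
    have htop_le : ∀ n, top ≤ n ↔ ∀ a, loc C a = v → a ≠ s → lvl C a ≤ n := by
      intro n
      rw [htop, Finset.sup_le_iff]
      constructor
      · intro h a ha has
        have := h _ ((hz _).2 ⟨a, ha, has, rfl⟩)
        rw [hkill a ha has] at this
        exact this
      · rintro h z hzz
        obtain ⟨a, ha, has, rfl⟩ := (hz _).1 hzz
        rw [hkill a ha has]
        exact h a ha has
    -- Another agent is needed here: the supremum over no zombies is `0`, which need not be less
    -- than `n`.
    have htop_lt : (∃ a, loc C a = v ∧ a ≠ s) → ∀ n, (∀ a, loc C a = v → a ≠ s → lvl C a < n) →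
        top < n := by
      rintro ⟨a, ha, has⟩ n h
      have h0 := h a ha has
      have : top ≤ n - 1 := (htop_le _).2 fun b hb hbs => by have := h b hb hbs; omega
      omega
    set cond : Prop := (top < lvl C s ∧ (sl = 2 ∨ sl = 3)) ∨ (top = lvl C s ∧ sl = 2) with hcond
    have hchase : ∀ a, loc C a = v → a ≠ s →
        chaseAction S₁ (killAndRecord (C s).1 (C s).1) (killAndRecord (C s).1 (C a).1) =
        { (C a).1 with
          pout := if cond then lst C s else -1
          mem := { (C a).1.mem with mode := Mode.zombie } } := by
      intro a ha has
      have h1 := hne a ha has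
      have hsl := hB.slot_eq s
      simp only [chaseAction, hkill a ha has, hkills, hsl, ← htop]
      by_cases hcc : cond
      · rw [if_pos (c := cond) hcc]
        exact (if_pos hcc).trans (if_neg h1)
      · rw [if_neg (c := cond) hcc]
        exact if_neg hcc
    have hchase_s : chaseAction S₁ (killAndRecord (C s).1 (C s).1)
        (killAndRecord (C s).1 (C s).1) = { (C s).1 with pout := -1 } := by
      simp only [chaseAction, hkills]
      split_ifs <;> rfl
    obtain ⟨s1, s2, s3, s4, -⟩ := next_fields ch P hv ((hact s).trans hchase_s)
    refine ⟨if cond then lst C s else -1, ⟨hv, hs, ?_, ?_, ?_, ?_, ?_, ?_, ?_, ?_, ?_, ?_⟩⟩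
    · rw [s2]; exact hs
    · rw [s1]; simp [travel_neg_one]
    · rw [s3]; rfl
    · rw [s4]; rfl
    · intro a ha has
      obtain ⟨a1, a2, a3, -, -⟩ := next_fields ch P ha ((hact a).trans (hchase a ha has))
      exact ⟨a1, a2, a3⟩
    · split_ifs <;> simp
    · intro h2 h3
      rw [if_neg]
      simp [hcond, h2, h3]
    · intro h2 hle hex
      rw [if_pos]
      have : top ≤ lvl C s := (htop_le _).2 fun a ha _ => hle a ha
      rw [hcond]
      rcases this.lt_or_eq with h | h
      · exact Or.inl ⟨h, Or.inl h2⟩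
      · exact Or.inr ⟨h, h2⟩
    · intro h3 hlt hex
      rw [if_pos]
      exact Or.inl ⟨htop_lt hex _ hlt, Or.inr h3⟩
    · rintro h3 ⟨a, ha, has, hle⟩
      rw [if_neg]
      have := (htop_le top).1 le_rfl a ha has
      rw [hcond]
      rintro (⟨h, -⟩ | ⟨-, h⟩)
      · omega
      · rw [h3] at h; exact absurd h (by decide)
  · have halone : ∀ a, loc C a = v → a = s := by
      intro a ha
      by_contra has
      exact hc (two_le_card_localView hid hB ha hv has)
    obtain ⟨h1, h2, h3, h4, -⟩ := step_alone ch P hid hB (a := s)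
      (fun b hb => halone b (hb.trans hv))
    have hno : ¬ ∃ a, loc C a = v ∧ a ≠ s := by
      rintro ⟨a, ha, has⟩
      exact has (halone a ha)
    refine ⟨-1, ⟨hv, hs, h2.trans hs, h1.trans hv, h3, h4, ?_, Or.inl rfl, fun _ _ => rfl,
      fun _ _ h => absurd h hno, fun _ _ h => absurd h hno, fun _ _ => rfl⟩⟩
    intro a ha has
    exact absurd (halone a ha) has

/-- Three situations produce the field `out`: the settled agent is already a minion of `x` at its
new level, it is not, or there is none and a zombie is appointed. In the last two, a fresh label is
written and nobody leaves. -/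
theorem step_dom {C : Config Mem A V} {ident : A → ℕ} (hid : Function.Injective ident)
    {sl : Fin 4} (hB : Base ident sl C) {v : V} {x b : A} (hx : Dom C v x) (hb : loc C b = v)
    (hbx : b ≠ x) : ∃ s q, DomStep P sl C ((algorithm ch).next P C) v x s q := by
  classical
  have hv := hx.1
  have hm : (C x).1.mem.mode = Mode.leader := hx.2.1
  have hc := two_le_card_localView hid hB hb hv hbx
  have hne : ∀ a a', a ≠ a' → (C a).1.id ≠ (C a').1.id := by
    intro a a' has h
    rw [hB.id_eq, hB.id_eq] at h
    exact has (hid h)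
  set m := (C x).1 with hmdef
  set S₁ := (localView C v).image (killAndRecord m) with hS₁
  set m₁ := killAndRecord m m with hm₁
  have hm₁' : m₁ = { m with pout := -1, mem := { m.mem with inport := ein C x } } := by
    simp only [hm₁, killAndRecord, hm, ein]
    simp [hmdef]
  -- `F a` is the state of `a` after killing, recording and raising; `leaderAction` starts from
  -- these states.
  set F : A → Agent := fun a => raiseLevel S₁ m₁ (killAndRecord m (C a).1) with hF
  set S₂ := S₁.image (raiseLevel S₁ m₁) with hS₂
  have hS₂mem : ∀ z, z ∈ S₂ ↔ ∃ a, loc C a = v ∧ F a = z := by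
    intro z
    simp only [hS₂, hS₁, Finset.mem_image, mem_localView, hF]
    constructor
    · rintro ⟨_, ⟨_, ⟨a, ha, rfl⟩, rfl⟩, rfl⟩; exact ⟨a, ha, rfl⟩
    · rintro ⟨a, ha, rfl⟩; exact ⟨_, ⟨_, ⟨a, ha, rfl⟩, rfl⟩, rfl⟩
  have hm₁mode : m₁.mem.mode = Mode.leader := by rw [hm₁']; exact hm
  have hact : ∀ a, localAction ch (G.degree v) (localView C v) (C a).1 =
      leaderAction ch (G.degree v) (localView C v) S₂ (F x) (F a) := by
    intro a
    simp only [localAction, aMax_of_dom hid hB hx, if_pos hc]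
    rw [if_pos hm₁mode]
  have hFne : ∀ a, a ≠ x → F a = { (C a).1 with
      pout := -1
      mem := { (C a).1.mem with
        mode := if (C a).1.mem.mode = Mode.settled then Mode.settled else Mode.zombie } } := by
    intro a hax
    have h1 := hne a x hax
    have h2 : (killAndRecord m (C a).1).id ≠ m₁.id := by rw [hm₁']; exact h1
    simp only [hF, raiseLevel]
    rw [if_neg (fun h => h2 h.1)]
    rcases hma : (C a).1.mem.mode with _ | _ | _ <;>
      simp [killAndRecord, h1, hma, hmdef]
  set up : Prop := ∃ z, loc C z = v ∧ z ≠ x ∧ mode C z ≠ Mode.settled ∧ lvl C z = lvl C x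
    with hup
  have hraise : (∃ z ∈ zombies S₁, z.mem.level = m₁.mem.level) ↔ up := by
    simp only [zombies, hS₁, Finset.mem_filter, Finset.mem_image, mem_localView, hup]
    constructor
    · rintro ⟨_, ⟨⟨_, ⟨a, ha, rfl⟩, rfl⟩, hz⟩, hl⟩
      refine ⟨a, ha, ?_, ?_, ?_⟩
      · rintro rfl
        rw [show killAndRecord m (C a).1 = m₁ from rfl, hm₁mode] at hz
        exact absurd hz (by decide)
      · intro h
        simp only [mode] at h
        simp [killAndRecord, h] at hz
      · rw [hm₁'] at hl; exact hl
    · rintro ⟨a, ha, hax, hms, hl⟩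
      refine ⟨killAndRecord m (C a).1, ⟨⟨_, ⟨a, ha, rfl⟩, rfl⟩, ?_⟩, by rw [hm₁']; exact hl⟩
      have h1 := hne a x hax
      simp only [mode] at hms
      rcases hma : (C a).1.mem.mode with _ | _ | _
      · simp [killAndRecord, h1, hma, hmdef]
      · simp [killAndRecord, hma]
      · exact absurd hma hms
  set y : ℕ × ℕ := if up then (m.mem.level + 1, m.mem.leaderId)
    else (m.mem.level, m.mem.leaderId) with hy
  have hFx : F x = { m with
      pout := -1, mem := { m.mem with inport := ein C x, level := y.1 } } := by
    simp only [hF, raiseLevel]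
    rw [show killAndRecord m (C x).1 = m₁ from rfl]
    by_cases hu : up
    · rw [if_pos ⟨rfl, hraise.2 hu⟩, hm₁', hy, if_pos hu]
    · rw [if_neg (fun h => hu (hraise.1 h.2)), hm₁', hy, if_neg hu]
  have hy2 : y.2 = m.mem.leaderId := by rw [hy]; split_ifs <;> rfl
  have hyid : m.id = y.2 := by
    rw [hy2, hmdef, hB.id_eq, hB.lid_eq]; rw [hx.2.1]; decide
  have hyup : (toLex y = bump (str C x) ∧ up) ∨ (toLex y = str C x ∧
      ∀ z, loc C z = v → z ≠ x → mode C z ≠ Mode.settled → lvl C z ≠ lvl C x) := by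
    by_cases hu : up
    · left; rw [hy, if_pos hu]; exact ⟨rfl, hu⟩
    · right; rw [hy, if_neg hu]
      exact ⟨rfl, fun z h1 h2 h3 h4 => hu ⟨z, h1, h2, h3, h4⟩⟩
  have hFmode : ∀ a, loc C a = v → ((F a).mem.mode = Mode.settled ↔ mode C a = Mode.settled) := by
    intro a _
    by_cases hax : a = x
    · rw [hax, hFx, hx.2.1]; simp [hm]
    · rw [hFne a hax]; simp only [mode]; split_ifs with h <;> simp [h]
  -- The agents other than `x` that are not settled.
  have hout : ∀ a, loc C a = v → a ≠ x → mode C a ≠ Mode.settled → ∀ q : ℤ,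
      localAction ch (G.degree v) (localView C v) (C a).1 = { F a with pout := q } →
      loc ((algorithm ch).next P C) a = (travel P v q).1 ∧
      mode ((algorithm ch).next P C) a = Mode.zombie ∧
      str ((algorithm ch).next P C) a = str C a := by
    intro a ha hax hms q h
    obtain ⟨h1, h2, h3, -, -⟩ := next_fields ch P ha h
    rw [h1, h2, h3, hFne a hax]
    simp only [mode] at hms
    simp [hms, str]
  have houtx : ∀ q : ℤ,
      localAction ch (G.degree v) (localView C v) (C x).1 = { F x with pout := q } →
      loc ((algorithm ch).next P C) x = (travel P v q).1 ∧
      mode ((algorithm ch).next P C) x = Mode.leader ∧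
      str ((algorithm ch).next P C) x = toLex y ∧
      ein ((algorithm ch).next P C) x =
        if (travel P v q).2 = -1 then ein C x else (travel P v q).2 := by
    intro q h
    obtain ⟨h1, h2, h3, -, h5⟩ := next_fields ch P hv h
    rw [h1, h2, h3, h5, hFx]
    exact ⟨rfl, hm, by rw [← hy2], rfl⟩
  by_cases hset : ∃ s, loc C s = v ∧ mode C s = Mode.settled
  · obtain ⟨s, hsv, hs⟩ := hset
    have hsx : s ≠ x := by rintro rfl; rw [hx.2.1] at hs; exact absurd hs (by decide)
    have huniq : ∀ a, loc C a = v → mode C a = Mode.settled → a = s := fun a ha hma =>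
      hB.settled_unique a s hma hs (ha.trans hsv.symm)
    have hsA : settledAgent S₂ = some (F s) := by
      apply settledAgent_eq_some ((hS₂mem _).2 ⟨s, hsv, rfl⟩) ((hFmode s hsv).2 hs)
      intro t ht htm
      obtain ⟨a, ha, rfl⟩ := (hS₂mem _).1 ht
      rw [huniq a ha ((hFmode a ha).1 htm)]
    have hms : (C s).1.mem.mode = Mode.settled := hs
    have hFs : F s = { (C s).1 with pout := -1 } := by
      rw [hFne s hsx]; simp [hms]; rw [← hms]
    have hFid : ∀ a, a ≠ s → (F a).id ≠ (F s).id := by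
      intro a has
      rw [hFs]
      by_cases hax : a = x
      · rw [hax, hFx]; exact hne x s hsx.symm
      · rw [hFne a hax]; exact hne a s has
    have hmin : IsMinion (F s) (F x) ↔ str C s = toLex y := by
      rw [hFs, hFx]
      simp only [IsMinion, str, hyid]
      constructor
      · rintro ⟨h1, h2⟩; rw [h1, h2]
      · intro h; exact ⟨congrArg (fun p : ℕ ×ₗ ℕ => (ofLex p).1) h,
          congrArg (fun p : ℕ ×ₗ ℕ => (ofLex p).2) h⟩
    have hFsl : (F s).mem.last = lst C s := by rw [hFs]; rfl
    have hFxi : (F x).mem.inport = ein C x := by rw [hFx]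
    have hFxs : (F x).mem.slot = sl := by rw [hFx]; exact hB.slot_eq x
    by_cases hmi : IsMinion (F s) (F x)
    · have hrest : ∀ (q : ℤ) (l : ℤ),
          (∀ a, loc C a = v → a ≠ s →
            leaderAction ch (G.degree v) (localView C v) S₂ (F x) (F a) =
              { F a with pout := q }) →
          (leaderAction ch (G.degree v) (localView C v) S₂ (F x) (F s) =
              { F s with mem := { (F s).mem with last := l } }) →
          ((lst C s ≠ ein C x ∧ q = ein C x ∧ l = lst C s) ∨
            (lst C s = ein C x ∧ sl = 0 ∧ q = (ein C x + 1) % (G.degree v : ℤ) ∧ l = q) ∨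
            (lst C s = ein C x ∧ sl ≠ 0 ∧ q = -1 ∧ l = lst C s)) →
          DomStep P sl C ((algorithm ch).next P C) v x s q := by
        intro q l h1 h2 h3
        obtain ⟨s1, s2, s3, s4, -⟩ := next_fields ch P hsv ((hact s).trans h2)
        obtain ⟨x1, x2, x3, x4⟩ := houtx q ((hact x).trans (h1 x hv hsx.symm))
        have hstr : str ((algorithm ch).next P C) s = str C s := by rw [s3, hFs]; rfl
        have hl : lst ((algorithm ch).next P C) s = l := s4
        refine ⟨hsv, hsx, ?_, ?_, ?_, ?_, x4, ?_, x2, huniq, ?_, Or.inr ⟨hs, ?_, ?_⟩⟩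
        · rw [s2, hFs]; exact hs
        · rw [s1, hFs]; simp [travel_neg_one]
        · rw [hstr, x3]; exact hmin.1 hmi
        · intro a ha has
          by_cases hax : a = x
          · rw [hax]; exact x1
          · exact (hout a ha hax (fun h => has (huniq a ha h)) q
              ((hact a).trans (h1 a ha has))).1
        · intro a ha has hax
          exact (hout a ha hax (fun h => has (huniq a ha h)) q
              ((hact a).trans (h1 a ha has))).2
        · rw [x3]; exact hyup
        · rw [x3]; exact hmin.1 hmi
        · rw [hl]; exact h3
      by_cases hin : (F x).mem.inport ≠ (F s).mem.last
      · refine ⟨s, ein C x, hrest (ein C x) (lst C s) ?_ ?_ ?_⟩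
        · intro a ha has
          simp only [leaderAction, hsA]
          rw [if_neg (not_not.2 hmi), if_pos hin, if_neg (hFid a has), hFxi]
        · simp only [leaderAction, hsA]
          rw [if_neg (not_not.2 hmi), if_pos hin, if_pos trivial, ← hFsl]
        · left
          rw [hFxi, hFsl] at hin
          exact ⟨hin.symm, rfl, rfl⟩
      · have hin' : lst C s = ein C x := by
          rw [hFxi, hFsl] at hin; exact (not_not.1 hin).symm
        by_cases h0 : sl = 0
        · refine ⟨s, (ein C x + 1) % (G.degree v : ℤ),
            hrest _ ((ein C x + 1) % (G.degree v : ℤ)) ?_ ?_ ?_⟩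
          · intro a ha has
            simp only [leaderAction, hsA]
            rw [if_neg (not_not.2 hmi), if_neg hin, if_pos (hFxs.trans h0), if_neg (hFid a has),
              hFxi]
          · simp only [leaderAction, hsA]
            rw [if_neg (not_not.2 hmi), if_neg hin, if_pos (hFxs.trans h0), if_pos trivial, hFxi]
          · exact Or.inr (Or.inl ⟨hin', h0, rfl, rfl⟩)
        · have h0' : ¬ (F x).mem.slot = 0 := by rw [hFxs]; exact h0
          refine ⟨s, -1, hrest _ (lst C s) ?_ ?_ ?_⟩
          · intro a ha has
            simp only [leaderAction, hsA]
            rw [if_neg (not_not.2 hmi), if_neg hin, if_neg h0']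
            by_cases hax : a = x
            · rw [hax, hFx]
            · rw [hFne a hax]
          · simp only [leaderAction, hsA]
            rw [if_neg (not_not.2 hmi), if_neg hin, if_neg h0', ← hFsl]
          · exact Or.inr (Or.inr ⟨hin', h0, rfl, rfl⟩)
    · have hrest : ∀ a, loc C a = v → a ≠ s →
          leaderAction ch (G.degree v) (localView C v) S₂ (F x) (F a) =
            { F a with pout := -1 } := by
        intro a ha has
        simp only [leaderAction, hsA]
        rw [if_pos hmi, if_neg (hFid a has)]
        by_cases hax : a = x
        · rw [hax, hFx]
        · rw [hFne a hax]
      have hss : leaderAction ch (G.degree v) (localView C v) S₂ (F x) (F s) =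
          makeMinion (F x) (F s) := by
        simp only [leaderAction, hsA]
        rw [if_pos hmi, if_pos trivial]
      obtain ⟨s1, s2, s3, s4, -⟩ := next_fields ch P hsv ((hact s).trans hss)
      obtain ⟨x1, x2, x3, x4⟩ := houtx (-1) ((hact x).trans (hrest x hv hsx.symm))
      refine ⟨s, -1, hsv, hsx, ?_, ?_, ?_, ?_, x4, ?_, x2, huniq, ?_, Or.inl ⟨rfl, ?_, ?_⟩⟩
      · rw [s2, hFs]; exact hs
      · rw [s1, hFs]; simp [makeMinion, travel_neg_one]
      · rw [s3, x3]; simp only [makeMinion, hFx]; rw [← hy2]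
      · intro a ha has
        by_cases hax : a = x
        · rw [hax]; exact x1
        · exact (hout a ha hax (fun h => has (huniq a ha h)) _
            ((hact a).trans (hrest a ha has))).1
      · intro a ha has hax
        exact (hout a ha hax (fun h => has (huniq a ha h)) _
            ((hact a).trans (hrest a ha has))).2
      · rw [x3]; exact hyup
      · rw [s4]; exact hFxi
      · intro _; rw [x3]; exact fun h => hmi (hmin.2 h)
  · push Not at hset
    have hsA : settledAgent S₂ = none := by
      apply settledAgent_eq_none
      intro t ht
      obtain ⟨a, ha, rfl⟩ := (hS₂mem _).1 ht
      exact fun h => hset a ha ((hFmode a ha).1 h)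
    have hzmode : ∀ a, loc C a = v → a ≠ x → (F a).mem.mode = Mode.zombie := by
      intro a ha hax
      have := hset a ha
      simp only [mode] at this
      rw [hFne a hax]; simp [this]
    have hzne : (zombies S₂).Nonempty :=
      ⟨F b, by simp only [zombies, Finset.mem_filter]
               exact ⟨(hS₂mem _).2 ⟨b, hb, rfl⟩, hzmode b hb hbx⟩⟩
    have hpick := ch.pick_mem (G.degree v) (localView C v) S₂ hzne
    simp only [zombies, Finset.mem_filter] at hpick
    obtain ⟨hp1, hp2⟩ := hpick
    obtain ⟨s, hsv, hsF⟩ := (hS₂mem _).1 hp1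
    have hsx : s ≠ x := by
      rintro rfl
      rw [← hsF, hFx] at hp2
      simp [hm] at hp2
    have hFid : ∀ a, a ≠ s → (F a).id ≠ (ch.pick (G.degree v) (localView C v) S₂).id := by
      intro a has
      rw [← hsF]
      rw [hFne s hsx]
      by_cases hax : a = x
      · rw [hax, hFx]; exact hne x s hsx.symm
      · rw [hFne a hax]; exact hne a s has
    have hrest : ∀ a, loc C a = v → a ≠ s →
        leaderAction ch (G.degree v) (localView C v) S₂ (F x) (F a) =
          { F a with pout := -1 } := by
      intro a ha has
      simp only [leaderAction, hsA]
      rw [if_neg (hFid a has)]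
      by_cases hax : a = x
      · rw [hax, hFx]
      · rw [hFne a hax]
    have hss : leaderAction ch (G.degree v) (localView C v) S₂ (F x) (F s) =
        makeMinion (F x) { F s with mem := { (F s).mem with mode := Mode.settled } } := by
      simp only [leaderAction, hsA]
      rw [if_pos (by rw [hsF])]
    obtain ⟨s1, s2, s3, s4, -⟩ := next_fields ch P hsv ((hact s).trans hss)
    obtain ⟨x1, x2, x3, x4⟩ := houtx (-1) ((hact x).trans (hrest x hv hsx.symm))
    refine ⟨s, -1, hsv, hsx, s2, ?_, ?_, ?_, x4, ?_, x2, fun a ha h => absurd h (hset a ha), ?_,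
      Or.inl ⟨rfl, ?_, fun h => absurd h (hset s hsv)⟩⟩
    · rw [s1, hFne s hsx]; simp [makeMinion, travel_neg_one]
    · rw [s3, x3]; simp only [makeMinion, hFx]; rw [← hy2]
    · intro a ha has
      by_cases hax : a = x
      · rw [hax]; exact x1
      · exact (hout a ha hax (hset a ha) _ ((hact a).trans (hrest a ha has))).1
    · intro a ha has hax
      exact (hout a ha hax (hset a ha) _ ((hact a).trans (hrest a ha has))).2
    · rw [x3]; exact hyup
    · rw [s4]; simp only [makeMinion, hFx]

end Spec

/-! ### Moving along an edge and back -/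

section Travel

variable {V : Type*} [Fintype V] {G : SimpleGraph V} [DecidableRel G.Adj] (P : PortLabelling G)

/-- `q` is a port of `v`. -/
def IsPort (G : SimpleGraph V) [DecidableRel G.Adj] (v : V) (q : ℤ) : Prop :=
  0 ≤ q ∧ q < (G.degree v : ℤ)

theorem travel_of_not_isPort {v : V} {q : ℤ} (h : ¬ IsPort G v q) : travel P v q = (v, -1) := by
  rw [travel, dif_neg]
  rintro ⟨h1, h2⟩
  exact h ⟨h1, by omega⟩

theorem travel_port {v u : V} (h : G.Adj v u) :
    travel P v ((P.port v ⟨u, h⟩ : ℕ) : ℤ) = (u, ((P.port u ⟨v, h.symm⟩ : ℕ) : ℤ)) := by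
  have hu : ∀ hq, (P.port v).symm ⟨(((P.port v ⟨u, h⟩ : ℕ) : ℤ)).toNat, hq⟩ = ⟨u, h⟩ := by
    intro hq
    rw [Equiv.symm_apply_eq]
    ext
    simp
  have key : ∀ x : G.neighborSet v, x = ⟨u, h⟩ →
      (x.1, ((P.port x.1 ⟨v, SimpleGraph.Adj.symm x.2⟩ : ℕ) : ℤ)) =
        (u, ((P.port u ⟨v, h.symm⟩ : ℕ) : ℤ)) := by
    rintro _ rfl; rfl
  rw [travel, dif_pos ⟨by positivity, by simp⟩]
  exact key _ (hu _)

theorem exists_port_eq {v : V} {q : ℤ} (h : IsPort G v q) :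
    ∃ u, ∃ hu : G.Adj v u, q = ((P.port v ⟨u, hu⟩ : ℕ) : ℤ) := by
  have hq : q.toNat < G.degree v := by have := h.2; have := h.1; omega
  refine ⟨((P.port v).symm ⟨q.toNat, hq⟩).1, ((P.port v).symm ⟨q.toNat, hq⟩).2, ?_⟩
  rw [Subtype.coe_eta, Equiv.apply_symm_apply]
  simp [h.1]

theorem isPort_port {v u : V} (h : G.Adj v u) : IsPort G v ((P.port v ⟨u, h⟩ : ℕ) : ℤ) :=
  ⟨by positivity, by exact_mod_cast (P.port _ _).2⟩

theorem travel_spec {v : V} {q : ℤ} (h : IsPort G v q) :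
    G.Adj v (travel P v q).1 ∧ IsPort G (travel P v q).1 (travel P v q).2 ∧
      travel P (travel P v q).1 (travel P v q).2 = (v, q) := by
  obtain ⟨u, hu, rfl⟩ := exists_port_eq P h
  rw [travel_port]
  exact ⟨hu, isPort_port P hu.symm, travel_port P hu.symm⟩

theorem travel_back {v u : V} {q p : ℤ} (h : IsPort G v q) (ht : travel P v q = (u, p)) :
    G.Adj v u ∧ IsPort G u p ∧ travel P u p = (v, q) := by
  have := travel_spec P h
  rw [ht] at this
  exact this

theorem travel_injective {v : V} {q q' : ℤ} (h : IsPort G v q) (h' : IsPort G v q')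
    (he : (travel P v q).1 = (travel P v q').1) : q = q' := by
  obtain ⟨u, hu, rfl⟩ := exists_port_eq P h
  obtain ⟨u', hu', rfl⟩ := exists_port_eq P h'
  rw [travel_port, travel_port] at he
  dsimp only at he
  subst he
  rfl

theorem exists_travel_eq {v u : V} (h : G.Adj v u) :
    ∃ q, IsPort G v q ∧ (travel P v q).1 = u :=
  ⟨_, isPort_port P h, by rw [travel_port]⟩

end Travel

/-! ### Depth-first traversal with cyclic pointers, as a purely combinatorial process -/

section Traversal

variable {V : Type*} [Fintype V] {G : SimpleGraph V} [DecidableRel G.Adj]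

/-- The state of a depth-first traversal: the visited nodes `R`, the current node `w`, the root
`r`, the port `e v` through which `v` was entered first, the number `c v` of ports of `v` that have
been explored from `v`, and the time `τ v` at which `v` was entered first. -/
structure Traversal (V : Type*) where
  R : Finset V
  w : V
  r : V
  e : V → ℤ
  c : V → ℕ
  τ : V → ℕ

/-- The last explored port of `v`. -/
def Traversal.last (G : SimpleGraph V) [DecidableRel G.Adj] (g : Traversal V) (v : V) : ℤ :=
  if g.c v = 0 then g.e v else (g.e v + g.c v) % (G.degree v : ℤ)

/-- The number of explored ports. -/
def Traversal.total (g : Traversal V) : ℕ := ∑ v ∈ g.R, g.c v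

/-- The invariants of a depth-first traversal. -/
structure Traversal.Valid (P : PortLabelling G) (g : Traversal V) : Prop where
  w_mem : g.w ∈ g.R
  r_mem : g.r ∈ g.R
  port : ∀ v ∈ g.R, v ≠ g.r → IsPort G v (g.e v)
  parent_mem : ∀ v ∈ g.R, v ≠ g.r → (travel P v (g.e v)).1 ∈ g.R
  time_lt : ∀ v ∈ g.R, v ≠ g.r → g.τ (travel P v (g.e v)).1 < g.τ v
  c_le : ∀ v ∈ g.R, g.c v ≤ G.degree v
  explored : ∀ v ∈ g.R, ∀ i, 1 ≤ i → i ≤ g.c v →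
    (travel P v ((g.e v + i) % (G.degree v : ℤ))).1 ∈ g.R
  tree : ∀ v ∈ g.R, v ≠ g.r → ∃ i, 1 ≤ i ∧ i ≤ g.c (travel P v (g.e v)).1 ∧
    (travel P v (g.e v)).2 =
      (g.e (travel P v (g.e v)).1 + i) % (G.degree (travel P v (g.e v)).1 : ℤ)
  incomplete : ∀ v ∈ g.R, v ≠ g.r → g.c v < G.degree v →
    g.last G (travel P v (g.e v)).1 = (travel P v (g.e v)).2
  child : ∀ v ∈ g.R, v ≠ g.r → (travel P v (g.e v)).1 = g.w →
    g.last G g.w = (travel P v (g.e v)).2 → g.c v = G.degree v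
  current : g.w ≠ g.r → g.c g.w < G.degree g.w

namespace Traversal

variable {P : PortLabelling G} {g : Traversal V}

/-- A traversal that has just begun. -/
def start (v : V) (i : ℤ) : Traversal V :=
  { R := {v}, w := v, r := v, e := fun _ => i, c := fun _ => 0, τ := fun _ => 0 }

theorem start_valid (P : PortLabelling G) (v : V) (i : ℤ) : (start v i).Valid P := by
  constructor <;> simp [start]
  intro j h1 h2; omega

theorem start_last (v : V) (i : ℤ) : (start v i).last G v = i := by
  simp [last, start]

/-- An unfinished node is the one its parent points to (`incomplete`), whereas the child the current
node points to is finished (`child`). -/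
theorem Valid.child_complete (h : g.Valid P) {v : V} (hv : v ∈ g.R) (hr : v ≠ g.r)
    (hp : (travel P v (g.e v)).1 = g.w) : g.c v = G.degree v := by
  by_contra hc
  have hlt := lt_of_le_of_ne (h.c_le v hv) hc
  have := h.incomplete v hv hr hlt
  rw [hp] at this
  exact hc (h.child v hv hr hp this)

/-- Pointers run cyclically from the entry value. For `c = 0` the pointer is the unreduced entry
value, which at the root may be `-1` instead of a port; the next port is given by the same formula.
-/
theorem last_add_one (g : Traversal V) (v : V) :
    (g.last G v + 1) % (G.degree v : ℤ) = (g.e v + (g.c v + 1 : ℕ)) % (G.degree v : ℤ) := by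
  rw [last]
  split_ifs with h
  · simp [h]
  · rw [Int.emod_add_emod]; congr 1; push_cast; ring

theorem emod_eq_self_of_isPort {v : V} {q : ℤ} (h : IsPort G v q) :
    (q + G.degree v) % (G.degree v : ℤ) = q := by
  rw [Int.add_emod_right]
  exact Int.emod_eq_of_lt h.1 h.2

theorem isPort_emod {v : V} (hd : 0 < G.degree v) (q : ℤ) :
    IsPort G v (q % (G.degree v : ℤ)) :=
  ⟨Int.emod_nonneg _ (by omega), Int.emod_lt_of_pos _ (by omega)⟩

/-- The indices `1, …, d` run once through the residues. When `e` is a port, the index `d` is the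
entry port itself, so a node other than the root explores its entry port last. -/
theorem add_emod_inj {d i j : ℕ} {e : ℤ} (hi : 1 ≤ i) (hid : i ≤ d) (hj : 1 ≤ j) (hjd : j ≤ d)
    (h : (e + i) % (d : ℤ) = (e + j) % (d : ℤ)) : i = j := by
  have h1 : (d : ℤ) ∣ (i : ℤ) - j := by
    have := Int.emod_eq_emod_iff_emod_sub_eq_zero.1 h
    rw [← Int.dvd_iff_emod_eq_zero] at this
    rwa [add_sub_add_left_eq_sub] at this
  obtain ⟨k, hk⟩ := h1
  have : k = 0 := by
    by_contra hk0
    rcases lt_or_gt_of_ne hk0 with h | h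
    · nlinarith
    · nlinarith
  subst this
  omega


open Classical in
/-- The current node has explored one more port; the traversal continues at `u`. -/
noncomputable def advance (g : Traversal V) (u : V) : Traversal V :=
  { g with w := u, c := Function.update g.c g.w (g.c g.w + 1) }

open Classical in
/-- The current node has explored one more port, which leads to the new node `u`, entered through
the port `p`. -/
noncomputable def discover (g : Traversal V) (u : V) (p : ℤ) : Traversal V :=
  { R := insert u g.R
    w := u
    r := g.r
    e := Function.update g.e u p
    c := Function.update (Function.update g.c g.w (g.c g.w + 1)) u 0
    τ := Function.update g.τ u (1 + g.R.sup g.τ) }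

theorem c_advance_self (u : V) : (g.advance u).c g.w = g.c g.w + 1 := by simp [advance]

theorem c_advance_of_ne {u v : V} (h : v ≠ g.w) : (g.advance u).c v = g.c v := by
  simp [advance, h]

theorem last_advance_self (u : V) :
    (g.advance u).last G g.w = (g.last G g.w + 1) % (G.degree g.w : ℤ) := by
  rw [last_add_one, last, c_advance_self]
  simp [advance]

theorem last_advance_of_ne {u v : V} (h : v ≠ g.w) : (g.advance u).last G v = g.last G v := by
  rw [last, last, c_advance_of_ne h]; rfl

theorem total_advance (hw : g.w ∈ g.R) (u : V) : (g.advance u).total = g.total + 1 := by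
  classical
  rw [total, total, show (g.advance u).R = g.R from rfl, ← Finset.add_sum_erase _ _ hw,
    ← Finset.add_sum_erase (a := g.w) g.R g.c hw, c_advance_self,
    Finset.sum_congr rfl fun v hv => c_advance_of_ne (Finset.ne_of_mem_erase hv)]
  omega

/-- The parts of `Valid` that do not refer to the current node survive an advance. -/
theorem Valid.advance (h : g.Valid P) (hc : g.c g.w < G.degree g.w) {u : V} (hu : u ∈ g.R)
    (hq : (travel P g.w ((g.last G g.w + 1) % (G.degree g.w : ℤ))).1 ∈ g.R)
    (hchild : ∀ v ∈ g.R, v ≠ g.r → (travel P v (g.e v)).1 = u →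
      (g.advance u).last G u = (travel P v (g.e v)).2 → (g.advance u).c v = G.degree v)
    (hcur : u ≠ g.r → (g.advance u).c u < G.degree u) : (g.advance u).Valid P := by
  have hmono : ∀ v, g.c v ≤ (g.advance u).c v := by
    intro v
    by_cases hv : v = g.w
    · rw [hv, c_advance_self]; omega
    · rw [c_advance_of_ne hv]
  refine ⟨hu, h.r_mem, h.port, h.parent_mem, h.time_lt, ?_, ?_, ?_, ?_, hchild, hcur⟩
  · intro v hv
    by_cases hvw : v = g.w
    · rw [hvw, c_advance_self]; omega
    · rw [c_advance_of_ne hvw]; exact h.c_le v hv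
  · intro v hv i h1 hi
    by_cases hvw : v = g.w
    · subst hvw
      rw [c_advance_self] at hi
      rcases Nat.lt_or_ge i (g.c g.w + 1) with h2 | h2
      · exact h.explored _ hv i h1 (by omega)
      · have : i = g.c g.w + 1 := by omega
        subst this
        rw [last_add_one] at hq
        exact hq
    · rw [c_advance_of_ne hvw] at hi
      exact h.explored v hv i h1 hi
  · intro v hv hr
    obtain ⟨i, h1, h2, h3⟩ := h.tree v hv hr
    exact ⟨i, h1, h2.trans (hmono _), h3⟩
  · intro v hv hr hlt
    have hlt' : g.c v < G.degree v := (hmono v).trans_lt hlt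
    -- The unfinished `v` is not a child of the current node, so the pointer of its parent is not
    -- the one that advances.
    have hpw : (travel P v (g.e v)).1 ≠ g.w := fun hp =>
      absurd (h.child_complete hv hr hp) hlt'.ne
    show (g.advance u).last G (travel P v (g.e v)).1 = _
    rw [last_advance_of_ne hpw]
    exact h.incomplete v hv hr hlt'

/-- The explored port leads to a visited node from which the traversal backtracks. -/
theorem Valid.backtrack (h : g.Valid P) (hc : g.c g.w < G.degree g.w) {u : V} {p : ℤ}
    (ht : travel P g.w ((g.last G g.w + 1) % (G.degree g.w : ℤ)) = (u, p)) (hu : u ∈ g.R)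
    (hp : g.last G u ≠ p) : (g.advance g.w).Valid P := by
  refine h.advance hc h.w_mem (by rw [ht]; exact hu) ?_ ?_
  · intro v hv hr hvw _
    have hne : v ≠ g.w := by
      rintro rfl
      have := (travel_spec P (h.port _ hv hr)).1
      rw [hvw] at this
      exact this.ne rfl
    rw [c_advance_of_ne hne]
    exact h.child_complete hv hr hvw
  · intro hr
    rw [c_advance_self]
    -- If no port were left, the port just explored would be the entry port and `u` the parent; but
    -- the parent of an unfinished node points to it, contrary to `hp`.
    by_contra hcc
    have hcd : g.c g.w + 1 = G.degree g.w := by omega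
    have hq := last_add_one (G := G) g g.w
    have hport := h.port _ h.w_mem hr
    rw [hcd, emod_eq_self_of_isPort hport] at hq
    rw [hq] at ht
    have := h.incomplete _ h.w_mem hr hc
    rw [ht] at this
    exact hp this

/-- The explored port leads to a visited node whose pointer points back. -/
theorem Valid.return (h : g.Valid P) (hc : g.c g.w < G.degree g.w) {u : V} {p : ℤ}
    (ht : travel P g.w ((g.last G g.w + 1) % (G.degree g.w : ℤ)) = (u, p)) (hu : u ∈ g.R)
    (hp : g.last G u = p) : (g.advance u).Valid P := by
  have hport : IsPort G g.w ((g.last G g.w + 1) % (G.degree g.w : ℤ)) := isPort_emod (by omega) _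
  obtain ⟨hadj, hpp, hback⟩ := travel_back P hport ht
  have huw : u ≠ g.w := hadj.ne'
  refine h.advance hc hu (by rw [ht]; exact hu) ?_ ?_
  · intro v hv hr hvu hl
    rw [last_advance_of_ne huw, hp] at hl
    -- The child `v` that `u` points to is the node just left: its entry edge is the edge just
    -- traversed. So the port explored last is the entry port, with index equal to the degree.
    have hb := (travel_spec P (h.port v hv hr)).2.2
    rw [hvu, ← hl, hback, Prod.mk.injEq] at hb
    obtain ⟨rfl, hb⟩ := hb
    rw [c_advance_self]
    rw [last_add_one] at hb
    exact add_emod_inj (by omega) (by omega) (by omega) le_rfl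
      (hb.trans (emod_eq_self_of_isPort (h.port _ hv hr)).symm)
  · intro hr
    rw [c_advance_of_ne huw]
    -- A finished `u` would point to its parent, so the parent would be `g.w`. By `tree`, the port
    -- of `g.w` towards `u` has an index at most `g.c g.w`, but the one just explored has the next
    -- index.
    by_contra hcu
    have hcu : g.c u = G.degree u := le_antisymm (h.c_le u hu) (not_lt.1 hcu)
    have hpu := h.port u hu hr
    have hdu : 0 < G.degree u := by have := hpu.1; have := hpu.2; omega
    have hl : g.last G u = g.e u := by
      rw [last, if_neg (by omega), hcu, emod_eq_self_of_isPort hpu]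
    have hpe : g.e u = p := by rw [← hl, hp]
    obtain ⟨i, h1, h2, h3⟩ := h.tree u hu hr
    rw [hpe, hback] at h2 h3
    dsimp only at h2 h3
    rw [last_add_one] at h3
    have := add_emod_inj (by omega) (by omega) h1 (by omega) h3
    omega

/-- The explored port leads to a node that has not been visited before. -/
theorem Valid.discover (h : g.Valid P) (hc : g.c g.w < G.degree g.w) {u : V} {p : ℤ}
    (ht : travel P g.w ((g.last G g.w + 1) % (G.degree g.w : ℤ)) = (u, p)) (hu : u ∉ g.R) :
    (g.discover u p).Valid P ∧ (g.discover u p).total = g.total + 1 ∧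
      (g.discover u p).last G u = p ∧
      (g.discover u p).last G g.w = (g.last G g.w + 1) % (G.degree g.w : ℤ) ∧
      ∀ v ∈ g.R, v ≠ g.w → (g.discover u p).last G v = g.last G v := by
  classical
  have hport : IsPort G g.w ((g.last G g.w + 1) % (G.degree g.w : ℤ)) := isPort_emod (by omega) _
  obtain ⟨hadj, hpp, hback⟩ := travel_back P hport ht
  have huw : u ≠ g.w := hadj.ne'
  have hne : ∀ v ∈ g.R, v ≠ u := fun v hv hvu => hu (hvu ▸ hv)
  have hcu : (g.discover u p).c u = 0 := by simp [Traversal.discover]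
  have heu : (g.discover u p).e u = p := by simp [Traversal.discover]
  have hcw : (g.discover u p).c g.w = g.c g.w + 1 := by simp [Traversal.discover, huw.symm]
  have hcv : ∀ v ∈ g.R, v ≠ g.w → (g.discover u p).c v = g.c v := fun v hv hvw => by
    simp [Traversal.discover, hne v hv, hvw]
  have hev : ∀ v ∈ g.R, (g.discover u p).e v = g.e v := fun v hv => by
    simp [Traversal.discover, hne v hv]
  have hτv : ∀ v ∈ g.R, (g.discover u p).τ v = g.τ v := fun v hv => by
    simp [Traversal.discover, hne v hv]
  have hτu : (g.discover u p).τ u = 1 + g.R.sup g.τ := by simp [Traversal.discover]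
  have hmem : ∀ v, v ∈ (g.discover u p).R ↔ v = u ∨ v ∈ g.R := fun v => by
    simp [Traversal.discover]
  have hmono : ∀ v ∈ g.R, g.c v ≤ (g.discover u p).c v := by
    intro v hv
    by_cases hvw : v = g.w
    · rw [hvw, hcw]; omega
    · rw [hcv v hv hvw]
  have hlw : (g.discover u p).last G g.w = (g.last G g.w + 1) % (G.degree g.w : ℤ) := by
    rw [last_add_one, last, hcw, if_neg (by omega), hev _ h.w_mem]
  have hlv : ∀ v ∈ g.R, v ≠ g.w → (g.discover u p).last G v = g.last G v := fun v hv hvw => by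
    rw [last, last, hcv v hv hvw, hev v hv]
  have hru : g.r ≠ u := hne _ h.r_mem
  refine ⟨⟨?_, ?_, ?_, ?_, ?_, ?_, ?_, ?_, ?_, ?_, ?_⟩, ?_, ?_, hlw, hlv⟩
  · exact (hmem u).2 (Or.inl rfl)
  · exact (hmem _).2 (Or.inr h.r_mem)
  · intro v hv hr
    rcases (hmem v).1 hv with rfl | hv
    · rw [heu]; exact hpp
    · rw [hev v hv]; exact h.port v hv hr
  · intro v hv hr
    rcases (hmem v).1 hv with rfl | hv
    · rw [heu, hback]; exact (hmem _).2 (Or.inr h.w_mem)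
    · rw [hev v hv]; exact (hmem _).2 (Or.inr (h.parent_mem v hv hr))
  · intro v hv hr
    rcases (hmem v).1 hv with rfl | hv
    · rw [heu, hback, hτu, hτv _ h.w_mem]
      have := Finset.le_sup (f := g.τ) h.w_mem
      omega
    · rw [hev v hv, hτv v hv, hτv _ (h.parent_mem v hv hr)]; exact h.time_lt v hv hr
  · intro v hv
    rcases (hmem v).1 hv with rfl | hv
    · rw [hcu]; omega
    · by_cases hvw : v = g.w
      · rw [hvw, hcw]; omega
      · rw [hcv v hv hvw]; exact h.c_le v hv
  · intro v hv i h1 hi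
    rcases (hmem v).1 hv with rfl | hv
    · rw [hcu] at hi; omega
    · rw [hev v hv, hmem]
      by_cases hvw : v = g.w
      · subst hvw
        rw [hcw] at hi
        rcases Nat.lt_or_ge i (g.c g.w + 1) with h2 | h2
        · exact Or.inr (h.explored _ hv i h1 (by omega))
        · have : i = g.c g.w + 1 := by omega
          subst this
          rw [last_add_one] at ht
          rw [ht]
          exact Or.inl rfl
      · rw [hcv v hv hvw] at hi
        exact Or.inr (h.explored v hv i h1 hi)
  · intro v hv hr
    rcases (hmem v).1 hv with rfl | hv
    · rw [heu, hback]
      dsimp only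
      rw [hcw, hev _ h.w_mem]
      exact ⟨g.c g.w + 1, by omega, le_rfl, last_add_one _ _⟩
    · obtain ⟨i, h1, h2, h3⟩ := h.tree v hv hr
      have hpm := h.parent_mem v hv hr
      rw [hev v hv, hev _ hpm]
      exact ⟨i, h1, h2.trans (hmono _ hpm), h3⟩
  · intro v hv hr hlt
    rcases (hmem v).1 hv with rfl | hv
    · rw [heu, hback]; exact hlw
    · have hlt' : g.c v < G.degree v := (hmono v hv).trans_lt hlt
      have hpw : (travel P v (g.e v)).1 ≠ g.w := fun hp =>
        absurd (h.child_complete hv hr hp) hlt'.ne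
      rw [hev v hv, hlv _ (h.parent_mem v hv hr) hpw]
      exact h.incomplete v hv hr hlt'
  · intro v hv hr hvu
    -- No visited node has the new node as its parent.
    exfalso
    have hvu : (travel P v ((g.discover u p).e v)).1 = u := hvu
    rcases (hmem v).1 hv with rfl | hv
    · rw [heu, hback] at hvu
      exact huw hvu.symm
    · rw [hev v hv] at hvu
      exact hu (hvu ▸ h.parent_mem v hv hr)
  · intro _
    show (g.discover u p).c u < G.degree u
    rw [hcu]
    have := hpp.1; have := hpp.2; omega
  · have h1 := total_advance h.w_mem g.w
    rw [← h1, total, total]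
    have : (g.discover u p).R = insert u g.R := by ext v; simp [hmem]
    rw [this, Finset.sum_insert hu, hcu, zero_add]
    refine Finset.sum_congr rfl fun v hv => ?_
    by_cases hvw : v = g.w
    · rw [hvw, hcw, c_advance_self]
    · rw [hcv v hv hvw, c_advance_of_ne hvw]
  · rw [last, hcu, if_pos rfl, heu]

/-- When the traversal is at a node all of whose ports have been explored, then all nodes have been
visited. -/
theorem Valid.mem_of_complete (h : g.Valid P) (hG : G.Connected)
    (hc : g.c g.w = G.degree g.w) (v : V) : v ∈ g.R := by
  have hwr : g.w = g.r := by
    by_contra hwr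
    exact absurd hc (h.current hwr).ne
  -- Induction on the discovery time. A finished parent other than the root points to its own
  -- parent; were `v` unfinished, it would also point to `v`. Then `v` would be its own grandparent,
  -- against the order of times.
  have hall : ∀ n, ∀ v ∈ g.R, g.τ v = n → g.c v = G.degree v := by
    intro n
    induction n using Nat.strong_induction_on with
    | _ n ih =>
      intro v hv hn
      by_cases hr : v = g.r
      · rw [hr, ← hwr, hc]
      by_contra hcv
      have hlt := lt_of_le_of_ne (h.c_le v hv) hcv
      have hinc := h.incomplete v hv hr hlt
      have hpm := h.parent_mem v hv hr
      have htl := h.time_lt v hv hr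
      by_cases hpr : (travel P v (g.e v)).1 = g.r
      · exact hcv (h.child_complete hv hr (hpr.trans hwr.symm))
      · have hpc := ih _ (hn ▸ htl) _ hpm rfl
        have hpp := h.port _ hpm hpr
        rw [last, hpc, if_neg (by have := hpp.1; have := hpp.2; omega),
          emod_eq_self_of_isPort hpp] at hinc
        have htl' := h.time_lt _ hpm hpr
        rw [hinc, (travel_spec P (h.port v hv hr)).2.2] at htl'
        exact absurd htl (not_lt.2 htl'.le)
  have hclosed : ∀ v ∈ g.R, ∀ u, G.Adj v u → u ∈ g.R := by
    intro v hv u hvu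
    obtain ⟨q, hq, rfl⟩ := exists_travel_eq P hvu
    have hcv := hall _ v hv rfl
    have hd : (0 : ℤ) < G.degree v := by have := hq.1; have := hq.2; omega
    -- The index in `1, …, degree` at which the cyclic order from `g.e v` arrives at `q`.
    set i := ((q - g.e v - 1) % (G.degree v : ℤ)).toNat + 1 with hi
    have h0 := Int.emod_nonneg (q - g.e v - 1) hd.ne'
    have h1 := Int.emod_lt_of_pos (q - g.e v - 1) hd
    have hi2 : (i : ℤ) = (q - g.e v - 1) % (G.degree v : ℤ) + 1 := by
      rw [hi]; push_cast; rw [Int.toNat_of_nonneg h0]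
    have hexp := h.explored v hv i (by omega) (by omega)
    have : (g.e v + i) % (G.degree v : ℤ) = q := by
      rw [hi2, show g.e v + ((q - g.e v - 1) % (G.degree v : ℤ) + 1) =
        (g.e v + 1) + (q - g.e v - 1) % (G.degree v : ℤ) by ring, Int.add_emod_emod,
        show g.e v + 1 + (q - g.e v - 1) = q by ring]
      exact Int.emod_eq_of_lt hq.1 hq.2
    rwa [this] at hexp
  obtain ⟨walk⟩ := hG.preconnected g.w v
  have : ∀ (a b : V) (_ : G.Walk a b), a ∈ g.R → b ∈ g.R := by
    intro a b W
    induction W with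
    | nil => exact id
    | cons hadj _ ih => exact fun ha => ih (hclosed _ ha _ hadj)
  exact this _ _ walk h.w_mem

/-- The explored ports of `v` lead to distinct visited nodes different from `v`. -/
theorem Valid.c_add_one_le_card (h : g.Valid P) {v : V} (hv : v ∈ g.R) :
    g.c v + 1 ≤ g.R.card := by
  classical
  have hinj : Set.InjOn (fun i : ℕ => (travel P v ((g.e v + i) % (G.degree v : ℤ))).1)
      (Finset.Icc 1 (g.c v) : Set ℕ) := by
    intro i hi j hj hij
    simp only [Finset.coe_Icc, Set.mem_Icc] at hi hj
    have hcd := h.c_le v hv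
    have hd : 0 < G.degree v := by omega
    exact add_emod_inj hi.1 (by omega) hj.1 (by omega)
      (travel_injective P (isPort_emod hd _) (isPort_emod hd _) hij)
  have : (Finset.Icc 1 (g.c v)).card ≤ (g.R.erase v).card := by
    refine Finset.card_le_card_of_injOn _ ?_ hinj
    intro i hi
    simp only [Finset.coe_Icc, Set.mem_Icc] at hi
    have hd : 0 < G.degree v := by have := h.c_le v hv; omega
    simp only [Finset.coe_erase, Set.mem_sdiff, Finset.mem_coe, Set.mem_singleton_iff]
    exact ⟨h.explored v hv i hi.1 hi.2, (travel_spec P (isPort_emod hd _)).1.ne'⟩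
  rw [Nat.card_Icc, Finset.card_erase_of_mem hv] at this
  have := Finset.card_pos.2 ⟨v, hv⟩
  omega

/-- Sum over the visited nodes the three bounds on `c v`: the degree of `v`, the maximum degree, and
`k - 1`. -/
theorem Valid.total_le (h : g.Valid P) {k : ℕ} (hk : g.R.card ≤ k) :
    g.total ≤ min (2 * G.edgeSet.ncard) (min (k * G.maxDegree) (k * (k - 1))) := by
  classical
  refine le_min ?_ (le_min ?_ ?_)
  · have h1 : g.total ≤ ∑ v, G.degree v :=
      (Finset.sum_le_sum fun v hv => h.c_le v hv).trans
        (Finset.sum_le_sum_of_subset (Finset.subset_univ _))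
    rw [G.sum_degrees_eq_twice_card_edges] at h1
    rwa [← SimpleGraph.coe_edgeFinset, Set.ncard_coe_finset]
  · have h1 : g.total ≤ ∑ v ∈ g.R, G.maxDegree :=
      Finset.sum_le_sum fun v hv => (h.c_le v hv).trans (G.degree_le_maxDegree v)
    rw [Finset.sum_const, smul_eq_mul] at h1
    exact h1.trans (Nat.mul_le_mul_right _ hk)
  · have h1 : g.total ≤ ∑ v ∈ g.R, (k - 1) :=
      Finset.sum_le_sum fun v hv => by have := h.c_add_one_le_card hv; omega
    rw [Finset.sum_const, smul_eq_mul] at h1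
    exact h1.trans (Nat.mul_le_mul_right _ hk)

end Traversal
end Traversal

/-! ### Invariants that hold in every slot -/

section Invariants

variable {A V : Type*} [Fintype V] {G : SimpleGraph V} [DecidableRel G.Adj]
  {P : PortLabelling G} {ident : A → ℕ} {sl : Fin 4} {C C' : Config Mem A V}

/-- The relation between the configurations before and after a step. -/
structure Step (P : PortLabelling G) (sl : Fin 4) (C C' : Config Mem A V) : Prop where
  id_eq : ∀ a, (C' a).1.id = (C a).1.id
  slot_eq : ∀ a, (C' a).1.mem.slot = (C a).1.mem.slot + 1
  alone : ∀ a, (∀ b, loc C b = loc C a → b = a) →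
    loc C' a = loc C a ∧ mode C' a = mode C a ∧ str C' a = str C a ∧ lst C' a = lst C a ∧
      (mode C a = Mode.leader → ein C' a = ein C a)
  settled : ∀ v s, loc C s = v → mode C s = Mode.settled → (¬ ∃ x, Dom C v x) →
    ∃ q, SetStep P sl C C' v s q
  dom : ∀ v x b, Dom C v x → loc C b = v → b ≠ x → ∃ s q, DomStep P sl C C' v x s q

theorem localAction_slot (ch : ZombieChoice) (δ : ℕ) (S : Finset Agent) (a : Agent) :
    (localAction ch δ S a).mem.slot = a.mem.slot := by
  have h1 : ∀ (S : Finset Agent) m b, (raiseLevel S m b).mem.slot = b.mem.slot := by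
    intro S m b; unfold raiseLevel; split_ifs <;> rfl
  have h2 : ∀ S₀ S m b, (leaderAction ch δ S₀ S m b).mem.slot = b.mem.slot := by
    intro S₀ S m b; unfold leaderAction
    split <;> split_ifs <;> rfl
  have h3 : ∀ S m b, (chaseAction S m b).mem.slot = b.mem.slot := by
    intro S m b; simp only [chaseAction]; split_ifs <;> rfl
  unfold localAction
  split
  · rfl
  · dsimp only
    split_ifs
    · rw [h2, h1]; rfl
    · rw [h3]; rfl
    · rfl

theorem step_next [Fintype A] (ch : ZombieChoice) (P : PortLabelling G)
    (hid : Function.Injective ident) (hB : Base ident sl C) :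
    Step P sl C ((algorithm ch).next P C) where
  id_eq _ := rfl
  slot_eq a := by
    rw [next_eq]
    dsimp only
    rw [localAction_slot]
  alone _ h := step_alone ch P hid hB h
  settled _ _ h1 h2 h3 := step_settled ch P hid hB h1 h2 h3
  dom _ _ _ h1 h2 h3 := step_dom ch P hid hB h1 h2 h3

/-- The invariants of all configurations of an execution. -/
structure Good (ident : A → ℕ) (sl : Fin 4) (C : Config Mem A V) : Prop
    extends Base ident sl C where
  zombie_lt : ∀ z, mode C z = Mode.zombie →
    ∃ b, loc C b = loc C z ∧ mode C b ≠ Mode.zombie ∧ str C z < str C b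
  label_le : ∀ s a, mode C s = Mode.settled → mode C a ≠ Mode.settled →
    (ofLex (str C s)).2 = ident a → str C s ≤ str C a

/-- The effect of one step on a node that holds an agent. -/
inductive NodeStep (P : PortLabelling G) (sl : Fin 4) (C C' : Config Mem A V) (v : V) : Prop
  | alone (x : A) (hx : Dom C v x) (h : ∀ b, loc C b = v → b = x) (hloc : loc C' x = v)
      (hmode : mode C' x = Mode.leader) (hstr : str C' x = str C x) (hein : ein C' x = ein C x)
  | dom (x s : A) (q : ℤ) (hx : Dom C v x) (h : DomStep P sl C C' v x s q)
  | settled (s : A) (q : ℤ) (hx : ¬ ∃ x, Dom C v x) (h : SetStep P sl C C' v s q)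
      (hlt : ∀ c, loc C c = v → c ≠ s → str C c < str C s)

theorem Good.exists_top [Finite A] (hG : Good ident sl C) (a : A) :
    ∃ b, loc C b = loc C a ∧ mode C b ≠ Mode.zombie ∧
      ∀ c, loc C c = loc C a → str C c ≤ str C b := by
  classical
  have := Fintype.ofFinite A
  obtain ⟨b, hb, hmax⟩ := Finset.exists_max_image
    (Finset.univ.filter fun c => loc C c = loc C a) (str C) ⟨a, by simp⟩
  simp only [Finset.mem_filter, Finset.mem_univ, true_and] at hb hmax
  refine ⟨b, hb, ?_, hmax⟩
  intro hz
  obtain ⟨c, hc, -, hlt⟩ := hG.zombie_lt b hz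
  exact absurd (hmax c (hc.trans hb)) (not_le.2 hlt)

/-- A strongest agent at the node is not a zombie. If it is not a leader, it is the settled agent,
and strictly the strongest: a leader tied with it would dominate, and a zombie tied with it would
have a stronger companion. -/
theorem Good.node_step [Finite A] (hG : Good ident sl C) (hS : Step P sl C C') {v : V} {a : A}
    (ha : loc C a = v) : NodeStep P sl C C' v := by
  subst ha
  by_cases hd : ∃ x, Dom C (loc C a) x
  · obtain ⟨x, hx⟩ := hd
    by_cases hb : ∃ b, loc C b = loc C a ∧ b ≠ x
    · obtain ⟨b, hb, hbx⟩ := hb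
      obtain ⟨s, q, h⟩ := hS.dom _ x b hx hb hbx
      exact .dom x s q hx h
    · push Not at hb
      obtain ⟨h1, h2, h3, -, h5⟩ := hS.alone x fun b hb' => hb b (hb'.trans hx.1)
      exact .alone x hx hb (h1.trans hx.1) (h2.trans hx.2.1) h3 (h5 hx.2.1)
  · obtain ⟨s, hs, hsm, hmax⟩ := hG.exists_top a
    have hss : mode C s = Mode.settled := by
      rcases hm : mode C s with _ | _ | _
      · exact absurd ⟨s, hs, hm, fun c hc => hmax c hc⟩ hd
      · exact absurd hm hsm
      · rfl
    obtain ⟨q, h⟩ := hS.settled _ s hs hss hd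
    refine .settled s q hd h ?_
    intro c hc hcs
    refine lt_of_le_of_ne (hmax c hc) fun heq => ?_
    rcases hm : mode C c with _ | _ | _
    · exact hd ⟨c, hc, hm, fun b hb => heq ▸ hmax b hb⟩
    · obtain ⟨b, hb, -, hlt⟩ := hG.zombie_lt c hm
      exact absurd (hmax b (hb.trans hc)) (not_le.2 (heq ▸ hlt))
    · exact hcs (hG.settled_unique c s hm hss (hc.trans hs.symm))

theorem DomStep.str_le {v : V} {x s : A} {q : ℤ} (h : DomStep P sl C C' v x s q) :
    str C x ≤ str C' x := by
  rcases h.raise with ⟨h, -⟩ | ⟨h, -⟩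
  · rw [h]; exact (lt_bump _).le
  · rw [h]

theorem DomStep.ident_eq {v : V} {x s : A} {q : ℤ} (h : DomStep P sl C C' v x s q) :
    (ofLex (str C' x)).2 = (ofLex (str C x)).2 := by
  rcases h.raise with ⟨h, -⟩ | ⟨h, -⟩ <;> rw [h]
  rfl

theorem DomStep.x_loc {v : V} {x s : A} {q : ℤ} (h : DomStep P sl C C' v x s q)
    (hx : Dom C v x) : loc C' x = (travel P v q).1 :=
  h.move x hx.1 h.ne.symm

theorem mode_ne_settled_of_leader {x : A} (h : mode C x = Mode.leader) :
    mode C x ≠ Mode.settled := by rw [h]; decide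

/-- Settled agents remain settled, and their labels do not decrease. -/
theorem Good.settled_next [Finite A] (hG : Good ident sl C) (hS : Step P sl C C') {s : A}
    (hs : mode C s = Mode.settled) :
    mode C' s = Mode.settled ∧ loc C' s = loc C s ∧ str C s ≤ str C' s := by
  rcases hG.node_step hS (a := s) rfl with ⟨x, hx, h, -⟩ | ⟨x, t, q, hx, h⟩ | ⟨t, q, hx, h, -⟩
  · have := h s rfl
    subst this
    exact absurd hs (mode_ne_settled_of_leader hx.2.1)
  · obtain rfl := h.uniq s rfl hs
    exact ⟨h.mode_s, h.loc_s', by rw [h.str_s]; exact (hx.2.2 s rfl).trans h.str_le⟩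
  · obtain rfl := hG.settled_unique s t hs h.mode_s h.loc_s.symm
    exact ⟨h.mode_s', h.loc_s', h.str_s.ge⟩

theorem Good.settled_of_next [Finite A] (hG : Good ident sl C) (hS : Step P sl C C') {s : A}
    (hs : mode C' s = Mode.settled) : loc C' s = loc C s := by
  rcases hG.node_step hS (a := s) rfl with
    ⟨x, hx, h, h1, h2, -⟩ | ⟨x, t, q, hx, h⟩ | ⟨t, q, hx, h, -⟩
  · have := h s rfl
    subst this
    exact h1
  · by_cases hst : s = t
    · rw [hst]; exact h.loc_s'.trans (hst ▸ rfl)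
    · by_cases hsx : s = x
      · rw [hsx, h.mode_x] at hs; cases hs
      · rw [(h.zombie s rfl hst hsx).1] at hs; cases hs
  · by_cases hst : s = t
    · rw [hst]; exact h.loc_s'.trans (hst ▸ rfl)
    · rw [(h.move s rfl hst).2.1] at hs; cases hs

/-- A leader after a step dominated its node before. -/
theorem Good.dom_of_next [Finite A] (hG : Good ident sl C) (hS : Step P sl C C') {x : A}
    (hx' : mode C' x = Mode.leader) : Dom C (loc C x) x := by
  rcases hG.node_step hS (a := x) rfl with
    ⟨y, hy, h, -⟩ | ⟨y, t, q, hy, h⟩ | ⟨t, q, hy, h, -⟩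
  · have := h x rfl
    subst this
    exact hy
  · by_cases hxt : x = t
    · rw [hxt, h.mode_s] at hx'; cases hx'
    · by_cases hxy : x = y
      · subst hxy; exact hy
      · rw [(h.zombie x rfl hxt hxy).1] at hx'; cases hx'
  · by_cases hst : x = t
    · rw [hst, h.mode_s'] at hx'; cases hx'
    · rw [(h.move x rfl hst).2.1] at hx'; cases hx'

theorem Good.unsettled_of_next [Finite A] (hG : Good ident sl C) (hS : Step P sl C C') {a : A}
    (ha : mode C' a ≠ Mode.settled) : mode C a ≠ Mode.settled := fun h =>
  ha (hG.settled_next hS h).1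

theorem Good.str_le_next [Finite A] (hG : Good ident sl C) (hS : Step P sl C C') {a : A}
    (ha : mode C' a ≠ Mode.settled) :
    str C a ≤ str C' a ∧ (ofLex (str C' a)).2 = (ofLex (str C a)).2 := by
  rcases hG.node_step hS (a := a) rfl with
    ⟨y, hy, h, -, -, h3, -⟩ | ⟨y, t, q, hy, h⟩ | ⟨t, q, hy, h, -⟩
  · rw [h a rfl, h3]; exact ⟨le_rfl, rfl⟩
  · by_cases hat : a = t
    · rw [hat] at ha; exact absurd h.mode_s ha
    · by_cases hay : a = y
      · rw [hay]; exact ⟨h.str_le, h.ident_eq⟩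
      · rw [(h.zombie a rfl hat hay).2]; exact ⟨le_rfl, rfl⟩
  · by_cases hat : a = t
    · rw [hat, h.str_s]; exact ⟨le_rfl, rfl⟩
    · rw [(h.move a rfl hat).2.2]; exact ⟨le_rfl, rfl⟩

/-- At a node with at least two agents there is a settled agent afterwards, which is at least as
strong as all of them. -/
theorem Good.exists_settled_next [Finite A] (hG : Good ident sl C) (hS : Step P sl C C') {a b : A}
    (hab : a ≠ b) (h : loc C a = loc C b) :
    ∃ s, mode C' s = Mode.settled ∧ loc C s = loc C a ∧ loc C' s = loc C a ∧
      ∀ c, loc C c = loc C a → str C c ≤ str C' s := by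
  rcases hG.node_step hS (a := a) rfl with
    ⟨y, hy, h1, -⟩ | ⟨y, t, q, hy, h1⟩ | ⟨t, q, hy, h1, h2⟩
  · exact absurd ((h1 a rfl).trans (h1 b h.symm).symm) hab
  · exact ⟨t, h1.mode_s, h1.loc_s, h1.loc_s', fun c hc => by
      rw [h1.str_s]; exact (hy.2.2 c hc).trans h1.str_le⟩
  · refine ⟨t, h1.mode_s', h1.loc_s, h1.loc_s', fun c hc => ?_⟩
    rw [h1.str_s]
    by_cases hct : c = t
    · rw [hct]
    · exact (h2 c hc hct).le

/-- A node with an agent that is not a zombie keeps such an agent. -/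
theorem Good.keep [Finite A] (hG : Good ident sl C) (hS : Step P sl C C') {b : A}
    (hb : mode C b ≠ Mode.zombie) :
    ∃ b', loc C' b' = loc C b ∧ mode C' b' ≠ Mode.zombie ∧ str C b ≤ str C' b' := by
  by_cases h : ∃ c, c ≠ b ∧ loc C b = loc C c
  · obtain ⟨c, hc, hl⟩ := h
    obtain ⟨s, h1, -, h2, h3⟩ := hG.exists_settled_next hS hc.symm hl
    exact ⟨s, h2, by rw [h1]; decide, h3 b rfl⟩
  · push Not at h
    obtain ⟨h1, h2, h3, -⟩ := hS.alone b fun c hc => by_contra fun hcb => h c hcb hc.symm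
    exact ⟨b, h1, h2 ▸ hb, h3.ge⟩

/-- The only fact about pointers needed is `hchase`: zombies that move without a leader must land
beside a non-zombie that is stronger than they are. -/
theorem Good.next [Finite A] (hid : Function.Injective ident) (hG : Good ident sl C)
    (hS : Step P sl C C')
    (hchase : sl = 2 ∨ sl = 3 → ∀ v s, loc C s = v → mode C s = Mode.settled →
      (¬ ∃ x, Dom C v x) → ∃ b, loc C b = (travel P v (lst C s)).1 ∧ mode C b ≠ Mode.zombie ∧
        str C s ≤ str C b) : Good ident (sl + 1) C' where
  id_eq a := (hS.id_eq a).trans (hG.id_eq a)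
  slot_eq a := by rw [hS.slot_eq, hG.slot_eq]
  lid_eq a ha := (hG.str_le_next hS ha).2.trans (hG.lid_eq a (hG.unsettled_of_next hS ha))
  settled_unique a b ha hb hab := by
    have ha' := hG.settled_of_next hS ha
    have hb' := hG.settled_of_next hS hb
    have hba : loc C b = loc C a := by rw [← ha', ← hb', hab]
    rcases hG.node_step hS (a := a) rfl with
      ⟨y, hy, h1, -⟩ | ⟨y, t, q, hy, h1⟩ | ⟨t, q, hy, h1, h2⟩
    · exact (h1 a rfl).trans (h1 b hba).symm
    · have key : ∀ c, loc C c = loc C a → mode C' c = Mode.settled → c = t := by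
        intro c hc hcm
        by_contra hct
        by_cases hcy : c = y
        · rw [hcy, h1.mode_x] at hcm; cases hcm
        · rw [(h1.zombie c hc hct hcy).1] at hcm; cases hcm
      rw [key a rfl ha, key b hba hb]
    · have key : ∀ c, loc C c = loc C a → mode C' c = Mode.settled → c = t := by
        intro c hc hcm
        by_contra hct
        rw [(h1.move c hc hct).2.1] at hcm; cases hcm
      rw [key a rfl ha, key b hba hb]
  zombie_lt z hz := by
    rcases hG.node_step hS (a := z) rfl with
      ⟨y, hy, h1, -, h2, -⟩ | ⟨y, t, q, hy, h1⟩ | ⟨t, q, hy, h1, h2⟩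
    · rw [h1 z rfl, h2] at hz; cases hz
    · have hzt : z ≠ t := by rintro rfl; rw [h1.mode_s] at hz; cases hz
      have hzy : z ≠ y := by rintro rfl; rw [h1.mode_x] at hz; cases hz
      refine ⟨y, ?_, by rw [h1.mode_x]; decide, ?_⟩
      · rw [h1.move y hy.1 h1.ne.symm, h1.move z rfl hzt]
      · rw [(h1.zombie z rfl hzt hzy).2]
        refine lt_of_lt_of_le (lt_of_le_of_ne (hy.2.2 z rfl) fun heq => hzy ?_) h1.str_le
        exact hG.str_ne hid (fun h => hzt (h1.uniq z rfl h)) (mode_ne_settled_of_leader hy.2.1) heq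
    · have hzt : z ≠ t := by rintro rfl; rw [h1.mode_s'] at hz; cases hz
      obtain ⟨hl, -, hstr⟩ := h1.move z rfl hzt
      have hlt := h2 z rfl hzt
      rcases h1.q_cases with rfl | hq
      · rw [travel_neg_one] at hl
        exact ⟨t, h1.loc_s'.trans hl.symm, by rw [h1.mode_s']; decide, by
          rw [hstr, h1.str_s]; exact hlt⟩
      · by_cases h23 : sl = 2 ∨ sl = 3
        · obtain ⟨b, hb1, hb2, hb3⟩ := hchase h23 _ t h1.loc_s h1.mode_s hy
          obtain ⟨b', hb1', hb2', hb3'⟩ := hG.keep hS hb2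
          refine ⟨b', ?_, hb2', ?_⟩
          · rw [hb1', hb1, hl, hq]
          · rw [hstr]; exact hlt.trans_le (hb3.trans hb3')
        · push Not at h23
          rw [h1.stay h23.1 h23.2, travel_neg_one] at hl
          exact ⟨t, h1.loc_s'.trans hl.symm, by rw [h1.mode_s']; decide, by
            rw [hstr, h1.str_s]; exact hlt⟩
  -- A new label copies its leader's strength; an old one stays, while the strengths of unsettled
  -- agents do not decrease.
  label_le s a hs ha hsa := by
    rcases hG.node_step hS (a := s) rfl with
      ⟨y, hy, h1, -, h2, -⟩ | ⟨y, t, q, hy, h1⟩ | ⟨t, q, hy, h1, h2⟩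
    · rw [h1 s rfl, h2] at hs; cases hs
    · have hst : s = t := by
        by_contra hst
        by_cases hsy : s = y
        · rw [hsy, h1.mode_x] at hs; cases hs
        · rw [(h1.zombie s rfl hst hsy).1] at hs; cases hs
      subst hst
      rw [h1.str_s] at hsa ⊢
      rw [h1.ident_eq] at hsa
      have hy' := hG.lid_eq y (mode_ne_settled_of_leader hy.2.1)
      have : y = a := hid (hy'.symm.trans hsa)
      rw [this]
    · have hst : s = t := by
        by_contra hst
        rw [(h1.move s rfl hst).2.1] at hs; cases hs
      subst hst
      rw [h1.str_s] at hsa ⊢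
      exact (hG.label_le s a h1.mode_s (hG.unsettled_of_next hS ha) hsa).trans
        (hG.str_le_next hS ha).1

end Invariants

/-! ### Pointer paths and the invariants of the individual slots -/

section Paths

variable {A V : Type*} [Fintype V] {G : SimpleGraph V} [DecidableRel G.Adj]
  {P : PortLabelling G} {ident : A → ℕ} {sl : Fin 4} {C C' : Config Mem A V}

/-- The pointers lead from `v` in at most `b` steps to a node that satisfies `T`; `T` may depend on
the number of steps that remain. -/
inductive Path (P : PortLabelling G) (C : Config Mem A V) (mid : ℕ ×ₗ ℕ → Prop)
    (T : V → ℕ → Prop) : V → ℕ → Prop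
  | term {v b} (h : T v b) : Path P C mid T v b
  | step {s b} (hs : mode C s = Mode.settled) (hm : mid (str C s))
      (h : Path P C mid T (travel P (loc C s) (lst C s)).1 b) : Path P C mid T (loc C s) (b + 1)

/-- Follow the old path as long as labels and pointers are unchanged; at the first changed label the
left alternative of `h2` must supply a new path. -/
theorem Path.map {mid : ℕ ×ₗ ℕ → Prop} {T T' : V → ℕ → Prop}
    (h1 : ∀ v b, T v b → Path P C' mid T' v b)
    (h2 : ∀ s, mode C s = Mode.settled → mid (str C s) →
      (∀ b, Path P C' mid T' (loc C s) (b + 1)) ∨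
      (mode C' s = Mode.settled ∧ loc C' s = loc C s ∧ str C' s = str C s ∧ lst C' s = lst C s))
    {v : V} {b : ℕ} (h : Path P C mid T v b) : Path P C' mid T' v b := by
  induction h with
  | term h => exact h1 _ _ h
  | @step s b hs hm _ ih =>
    rcases h2 s hs hm with h | ⟨h1, h2, h3, h4⟩
    · exact h b
    · rw [← h2, ← h4] at ih
      rw [← h2]
      exact .step h1 (h3 ▸ hm) ih

theorem Path.add {mid : ℕ ×ₗ ℕ → Prop} {T T' : V → ℕ → Prop} {n : ℕ}
    (h1 : ∀ v b, T v b → T' v (b + n)) {v : V} {b : ℕ} (h : Path P C mid T v b) :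
    Path P C mid T' v (b + n) := by
  induction h with
  | term h => exact .term (h1 _ _ h)
  | @step s b hs hm _ ih =>
    rw [Nat.add_right_comm]
    exact .step hs hm ih

/-- Two nested classes of strengths that are closed upwards. -/
structure StrengthClass where
  hi : ℕ ×ₗ ℕ → Prop
  mid : ℕ ×ₗ ℕ → Prop
  hi_mono : ∀ {p q}, p ≤ q → hi p → hi q
  mid_mono : ∀ {p q}, p ≤ q → mid p → mid q
  hi_bump : ∀ {p}, mid p → hi (bump p)
  level_eq : ∀ {p q}, p < q → mid p → ¬ hi q → (ofLex p).1 = (ofLex q).1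

/-- The class of the strengths above `p`. -/
def above (p : ℕ ×ₗ ℕ) : StrengthClass where
  hi q := p < q
  mid q := p ≤ q
  hi_mono h1 h2 := h2.trans_le h1
  mid_mono h1 h2 := h2.trans h1
  hi_bump h := h.trans_lt (lt_bump _)
  level_eq h1 h2 h3 := absurd (h2.trans_lt h1) h3

/-- The class of the strengths of level at least `j`. -/
def atLevel (j : ℕ) : StrengthClass where
  hi q := j + 1 ≤ (ofLex q).1
  mid q := j ≤ (ofLex q).1
  hi_mono h1 h2 := h2.trans (level_le_of_le h1)
  mid_mono h1 h2 := h2.trans (level_le_of_le h1)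
  hi_bump h := Nat.succ_le_succ h
  level_eq h1 h2 h3 := by have := level_le_of_le h1.le; omega

/-- The ends of the paths: nodes with a label in `hi`, the homes of leaders and the nodes of
zombies in `mid`. The zombies cost `cs` steps and the leaders `cl` steps. -/
def Term (K : StrengthClass) (C : Config Mem A V) (home : V → A → Prop) (cs cl : ℕ) (v : V)
    (b : ℕ) : Prop :=
  (∃ a, loc C a = v ∧ mode C a ≠ Mode.zombie ∧ K.hi (str C a)) ∨
  (∃ x, home v x ∧ mode C x = Mode.leader ∧ K.mid (str C x) ∧ cl ≤ b) ∨
  (∃ z, loc C z = v ∧ mode C z = Mode.zombie ∧ K.mid (str C z) ∧ cs ≤ b)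

theorem Term.add {K : StrengthClass} {home : V → A → Prop} {cs cl cs' cl' n : ℕ}
    (h1 : cs' ≤ cs + n) (h2 : cl' ≤ cl + n) {v : V} {b : ℕ} (h : Term K C home cs cl v b) :
    Term K C home cs' cl' v (b + n) := by
  rcases h with h | ⟨x, h, h', h'', h3⟩ | ⟨z, h, h', h'', h3⟩
  · exact Or.inl h
  · exact Or.inr (Or.inl ⟨x, h, h', h'', by omega⟩)
  · exact Or.inr (Or.inr ⟨z, h, h', h'', by omega⟩)

theorem Path.relax {K : StrengthClass} {home : V → A → Prop} {v : V} {b : ℕ}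
    (h : Path P C K.mid (Term K C home 1 1) v b) : Path P C K.mid (Term K C home 0 1) v b :=
  Path.add (T' := Term K C home 0 1) (n := 0)
    (fun _ _ h => Term.add (n := 0) (by omega) (by omega) h) h

/-- Ends that may recede hold one step in reserve. One more unit of length refills all reserves;
`Cycle.weak_next` pays it once per cycle. -/
theorem Path.shift {K : StrengthClass} {home : V → A → Prop} {cs cl : ℕ} {v : V} {b : ℕ}
    (h : Path P C K.mid (Term K C home cs cl) v b) :
    Path P C K.mid (Term K C home 1 1) v (b + 1) :=
  Path.add (T' := Term K C home 1 1) (n := 1)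
    (fun _ _ h => Term.add (n := 1) (by omega) (by omega) h) h

/-- `x` is at `v`. -/
def AtNode (C : Config Mem A V) (v : V) (x : A) : Prop := loc C x = v

/-- The node `v` from which the leader `x` has just moved via the pointer of its minion, or the
node of `x` if `x` has not moved. -/
def Home (P : PortLabelling G) (C : Config Mem A V) (v : V) (x : A) : Prop :=
  (loc C x = v ∧ ∀ s, mode C s = Mode.settled → loc C s = v →
    str C s = str C x ∧ lst C s = ein C x) ∨
  (loc C x ≠ v ∧ ∃ s, mode C s = Mode.settled ∧ loc C s = v ∧ str C s = str C x ∧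
    travel P v (lst C s) = (loc C x, ein C x) ∧ travel P (loc C x) (ein C x) = (v, lst C s))

/-- The invariants in the slots `2`, `3` and `0`. -/
structure Calm (P : PortLabelling G) (ident : A → ℕ) (sl : Fin 4) (C : Config Mem A V) : Prop
    extends Good ident sl C where
  dom_of_leader : ∀ x, mode C x = Mode.leader → ∃ y, Dom C (loc C x) y
  label : ∀ v x s, Dom C v x → mode C s = Mode.settled → loc C s = v →
    str C s = str C x ∧ lst C s = ein C x
  reach : ∀ s, mode C s = Mode.settled → ∃ b, Path P C (above (str C s)).mid
    (Term (above (str C s)) C (AtNode C) 1 1) (loc C s) b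

/-- The invariants in the slot `1`. -/
structure Semi (P : PortLabelling G) (ident : A → ℕ) (C : Config Mem A V) : Prop
    extends Good ident 1 C where
  home : ∀ x, mode C x = Mode.leader → ∃ v, Home P C v x
  reach : ∀ s, mode C s = Mode.settled → ∃ b, Path P C (above (str C s)).mid
    (Term (above (str C s)) C (Home P C) 1 1) (loc C s) b

/-- If the leader did not end up in `hi`, then `level_eq` would give it the level of `z`. An equal
level before the step forces a raise, and a raise out of `mid` enters `hi`. -/
theorem DomStep.hi_of_mid (hid : Function.Injective ident) (hG : Good ident sl C)
    {v : V} {x s : A} {q : ℤ} (hx : Dom C v x) (h : DomStep P sl C C' v x s q)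
    (K : StrengthClass) {z : A} (hz : loc C z = v) (hzx : z ≠ x) (hzs : mode C z ≠ Mode.settled)
    (hm : K.mid (str C z)) : K.hi (str C' x) := by
  by_contra hhi
  have hlt : str C z < str C x := lt_of_le_of_ne (hx.2.2 z hz) fun heq =>
    hzx (hG.str_ne hid hzs (mode_ne_settled_of_leader hx.2.1) heq)
  have hlev := K.level_eq (hlt.trans_le h.str_le) hm hhi
  rcases h.raise with ⟨h1, -⟩ | ⟨h1, h2⟩
  · rw [h1] at hhi
    exact hhi (K.hi_bump (K.mid_mono hlt.le hm))
  · rw [h1] at hlev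
    exact h2 z hz hzx hzs hlev

/-- By `label_le` no label exceeds the strength of its own leader, so finding the new label already
present excludes a raise in this step. -/
theorem DomStep.str_eq_of_minion (hG : Good ident sl C)
    {v : V} {x s : A} {q : ℤ} (hx : Dom C v x) (h : DomStep P sl C C' v x s q)
    (hs : mode C s = Mode.settled) (hsx : str C s = str C' x) : str C' x = str C x := by
  refine le_antisymm ?_ h.str_le
  rw [← hsx]
  have hx' := mode_ne_settled_of_leader hx.2.1
  refine hG.label_le s x hs hx' ?_
  rw [hsx, h.ident_eq]
  exact hG.lid_eq x hx'

/-- After slot `0` the pointers change only where a leader passes a new label. -/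
theorem Good.lst_next [Finite A] (hG : Good ident sl C) (hS : Step P sl C C') (hsl : sl ≠ 0)
    {s : A} (hs : mode C s = Mode.settled) (h : str C' s = str C s) : lst C' s = lst C s := by
  rcases hG.node_step hS (a := s) rfl with ⟨x, hx, h1, -⟩ | ⟨x, t, q, hx, h1⟩ | ⟨t, q, hx, h1, -⟩
  · rw [h1 s rfl] at hs
    exact absurd hs (mode_ne_settled_of_leader hx.2.1)
  · obtain rfl := h1.uniq s rfl hs
    rcases h1.out with ⟨-, -, h2⟩ | ⟨-, -, ⟨-, -, h2⟩ | ⟨-, h2, -⟩ | ⟨-, -, -, h2⟩⟩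
    · exact absurd (h.symm.trans h1.str_s) (h2 hs)
    · exact h2
    · exact absurd h2 hsl
    · exact h2
  · obtain rfl := hG.settled_unique s t hs h1.mode_s h1.loc_s.symm
    exact h1.lst_s

/-- By `Calm.label`, the minion under a dominating leader points to the incoming port. Hence
backtracking is impossible and only the exploration in slot `0` moves the leader. -/
theorem Calm.domStep_cases (hC : Calm P ident sl C) {v : V} {x s : A}
    {q : ℤ} (hx : Dom C v x) (h : DomStep P sl C C' v x s q) :
    (q = -1 ∧ lst C' s = ein C x) ∨
    (sl = 0 ∧ mode C s = Mode.settled ∧ str C s = str C x ∧ str C' x = str C x ∧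
      lst C s = ein C x ∧ q = (ein C x + 1) % (G.degree v : ℤ) ∧ lst C' s = q) := by
  rcases h.out with ⟨h1, h2, -⟩ | ⟨h1, h2, ⟨h3, -⟩ | ⟨h3, h4, h5, h6⟩ | ⟨h3, -, h5, h6⟩⟩
  · exact Or.inl ⟨h1, h2⟩
  · exact absurd (hC.label v x s hx h1 h.loc_s).2 h3
  · exact Or.inr ⟨h4, h1, h2.trans (h.str_eq_of_minion hC.toGood hx h1 h2),
      h.str_eq_of_minion hC.toGood hx h1 h2, h3, h5, h6⟩
  · exact Or.inl ⟨h5, h6.trans h3⟩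

/-- The pointer at a node without leader leads to an agent that is at least as strong. -/
theorem Calm.target (hC : Calm P ident sl C) {v : V} {s : A} (hv : loc C s = v)
    (hs : mode C s = Mode.settled) (hd : ¬ ∃ x, Dom C v x) :
    ∃ b, loc C b = (travel P v (lst C s)).1 ∧ mode C b ≠ Mode.zombie ∧ str C s ≤ str C b := by
  subst hv
  have hno : ∀ x, loc C x = loc C s → mode C x ≠ Mode.leader := by
    intro x hx hm
    obtain ⟨y, hy⟩ := hC.dom_of_leader x hm
    exact hd ⟨y, hx ▸ hy⟩
  have honly : ∀ a, loc C a = loc C s → mode C a ≠ Mode.zombie → a = s := by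
    intro a ha haz
    rcases hm : mode C a with _ | _ | _
    · exact absurd hm (hno a ha)
    · exact absurd hm haz
    · exact hC.settled_unique a s hm hs ha
  have hzl : ∀ z, loc C z = loc C s → mode C z = Mode.zombie → str C z < str C s := by
    intro z hz hm
    obtain ⟨b, h1, h2, h3⟩ := hC.zombie_lt z hm
    rwa [honly b (h1.trans hz) h2] at h3
  obtain ⟨b, hp⟩ := hC.reach s hs
  -- The path cannot end at the node of `s`: there is no leader, `s` is the only non-zombie and not
  -- stronger than itself, and the zombies are weaker. So the path begins with the pointer of `s`.
  have key : ∀ v' b', Path P C (above (str C s)).mid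
      (Term (above (str C s)) C (AtNode C) 1 1) v' b' → v' = loc C s →
      ∃ b'', Path P C (above (str C s)).mid
      (Term (above (str C s)) C (AtNode C) 1 1) (travel P v' (lst C s)).1 b'' := by
    intro v' b' h hv'
    cases h with
    | term h =>
      exfalso
      rcases h with ⟨a, h1, h2, h3⟩ | ⟨x, h1, h2, -⟩ | ⟨z, h1, h2, h3, -⟩
      · rw [honly a (h1.trans hv') h2] at h3
        exact lt_irrefl _ h3
      · exact hno x (Eq.trans h1 hv') h2
      · exact absurd (hzl z (h1.trans hv') h2) (not_lt.2 h3)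
    | @step t b h1 h2 h3 =>
      obtain rfl := hC.settled_unique t s h1 hs hv'
      exact ⟨b, h3⟩
  obtain ⟨b', hp'⟩ := key _ _ hp rfl
  generalize (travel P (loc C s) (lst C s)).1 = u at hp'
  cases hp' with
  | term h =>
    rcases h with ⟨a, h1, h2, h3⟩ | ⟨x, h1, h2, h3, -⟩ | ⟨z, h1, h2, h3, -⟩
    · exact ⟨a, h1, h2, le_of_lt h3⟩
    · exact ⟨x, h1, by rw [h2]; decide, h3⟩
    · obtain ⟨b, h4, h5, h6⟩ := hC.zombie_lt z h2
      exact ⟨b, h4.trans h1, h5, le_trans h3 h6.le⟩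
  | @step t b h1 h2 h3 => exact ⟨t, rfl, by rw [h1]; decide, h2⟩

theorem Calm.good_next [Finite A] (hid : Function.Injective ident) (hC : Calm P ident sl C)
    (hS : Step P sl C C') : Good ident (sl + 1) C' :=
  hC.toGood.next hid hS fun _ _ _ h1 h2 h3 => hC.target h1 h2 h3

/-! ### Slots `2` and `3`: zombies follow pointers while leaders rest -/

section Chase

variable [Finite A]

/-- In the slots `2` and `3` the leaders do not move. -/
theorem Calm.leader_stays (hid : Function.Injective ident) (hC : Calm P ident sl C)
    (hS : Step P sl C C') (hsl : sl ≠ 0) {v : V} {x : A} (hx : Dom C v x) : loc C' x = v ∧ mode C' x = Mode.leader ∧ str C x ≤ str C' x ∧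
      ein C' x = ein C x := by
  rcases hC.toGood.node_step hS hx.1 with
    ⟨y, hy, h1, h2, h3, h4, h5⟩ | ⟨y, t, q, hy, h1⟩ | ⟨t, q, hy, h1, -⟩
  · rw [h1 x hx.1]
    exact ⟨h2, h3, h4.ge, h5⟩
  · obtain rfl := hx.unique hid hC.toBase hy
    rcases hC.domStep_cases hx h1 with ⟨hq, -⟩ | ⟨h, -⟩
    · have h2 := h1.x_loc hx
      have h3 := h1.ein_x
      rw [hq, travel_neg_one] at h2 h3
      exact ⟨h2, h1.mode_x, h1.str_le, h3⟩
    · exact absurd h hsl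
  · exact absurd ⟨x, hx⟩ hy

/-- The transfer of a path in the slots `2` and `3`. -/
theorem Calm.path_chase (hid : Function.Injective ident) (hC : Calm P ident sl C)
    (hS : Step P sl C C') {cs : ℕ} (hsl : (sl = 2 ∧ cs = 1) ∨ sl = 3 ∧ cs = 0) (K : StrengthClass)
    {v : V} {b : ℕ} (h : Path P C K.mid (Term K C (AtNode C) cs 1) v b) :
    Path P C' K.mid (Term K C' (AtNode C') 0 1) v b := by
  have hsl0 : sl ≠ 0 := by rcases hsl with ⟨h, -⟩ | ⟨h, -⟩ <;> rw [h] <;> decide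
  refine h.map ?_ ?_
  · rintro v b (⟨a, rfl, h2, h3⟩ | ⟨x, rfl, h2, h3, h4⟩ | ⟨z, h1, h2, h3, h4⟩)
    · obtain ⟨a', h4, h5, h6⟩ := hC.toGood.keep hS h2
      exact .term (Or.inl ⟨a', h4, h5, K.hi_mono h6 h3⟩)
    · obtain ⟨y, hy⟩ := hC.dom_of_leader x h2
      obtain ⟨h5, h6, h7, -⟩ := hC.leader_stays hid hS hsl0 hy
      exact .term (Or.inr (Or.inl ⟨y, h5, h6, K.mid_mono ((hy.2.2 x rfl).trans h7) h3, h4⟩))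
    · rcases hC.toGood.node_step hS h1 with
        ⟨y, hy, h5, -⟩ | ⟨y, t, q, hy, h5⟩ | ⟨t, q, hy, h5, h6⟩
      · rw [h5 z h1, hy.2.1] at h2; cases h2
      · have := h5.hi_of_mid hid hC.toGood hy K h1 (by rintro rfl; rw [hy.2.1] at h2; cases h2)
          (by rw [h2]; decide) h3
        exact .term (Or.inl ⟨t, h5.loc_s', by rw [h5.mode_s]; decide, by rwa [h5.str_s]⟩)
      · have hzt : z ≠ t := by rintro rfl; rw [h5.mode_s] at h2; cases h2
        have hlt := h6 z h1 hzt
        by_cases hhi : K.hi (str C t)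
        · exact .term (Or.inl ⟨t, h5.loc_s', by rw [h5.mode_s']; decide, by rwa [h5.str_s]⟩)
        have hlev := K.level_eq hlt h3 hhi
        obtain ⟨m1, m2, m3⟩ := h5.move z h1 hzt
        rcases hsl with ⟨hsl, rfl⟩ | ⟨hsl, rfl⟩
        -- In slot `2` the zombie at the end moves one pointer further; its reserve `cs = 1` pays
        -- for the longer path.
        · have hq := h5.chase_two hsl (fun a ha => by
            by_cases hat : a = t
            · rw [hat]
            · exact level_le_of_le (h6 a ha hat).le) ⟨z, h1, hzt⟩
          obtain ⟨b, rfl⟩ : ∃ b', b = b' + 1 := ⟨b - 1, by omega⟩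
          rw [hq, ← h5.lst_s] at m1
          have hstep := Path.step (P := P) (C := C') (mid := K.mid)
            (T := Term K C' (AtNode C') 0 1) (b := b) h5.mode_s'
            (by rw [h5.str_s]; exact K.mid_mono hlt.le h3) (.term (Or.inr (Or.inr ⟨z, by
              rw [h5.loc_s']; exact m1, m2, m3 ▸ h3, by omega⟩)))
          rwa [h5.loc_s'] at hstep
        -- In slot `3` a zombie of the level of the label makes its group stay, so no reserve is
        -- needed.
        · have hq := h5.stay_three hsl ⟨z, h1, hzt, hlev.ge⟩
          rw [hq, travel_neg_one] at m1
          exact .term (Or.inr (Or.inr ⟨z, m1, m2, m3 ▸ h3, h4⟩))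
  · intro s hs hm
    rcases hC.toGood.node_step hS (a := s) rfl with
      ⟨y, hy, h5, -⟩ | ⟨y, t, q, hy, h5⟩ | ⟨t, q, hy, h5, h6⟩
    · rw [h5 s rfl, hy.2.1] at hs; cases hs
    · left
      intro b
      obtain ⟨h7, h8, h9, -⟩ := hC.leader_stays hid hS hsl0 hy
      exact .term (Or.inr (Or.inl ⟨y, h7, h8, K.mid_mono ((hy.2.2 s rfl).trans h9) hm,
        by omega⟩))
    · right
      obtain rfl := hC.settled_unique s t hs h5.mode_s h5.loc_s.symm
      exact ⟨h5.mode_s', h5.loc_s', h5.str_s, h5.lst_s⟩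

theorem Calm.next (hid : Function.Injective ident) (hC : Calm P ident sl C)
    (hS : Step P sl C C') (hsl : sl = 2 ∨ sl = 3) : Calm P ident (sl + 1) C' := by
  have hsl0 : sl ≠ 0 := by rcases hsl with h | h <;> rw [h] <;> decide
  have hG' := hC.good_next hid hS
  have hdom : ∀ x, mode C' x = Mode.leader → Dom C (loc C x) x ∧ Dom C' (loc C x) x := by
    intro x hx
    have hxd := hC.toGood.dom_of_next hS hx
    obtain ⟨h1, h2, h3, -⟩ := hC.leader_stays hid hS hsl0 hxd
    refine ⟨hxd, h1, h2, fun b hb => ?_⟩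
    rcases hC.toGood.node_step hS (a := b) rfl with
      ⟨y, hy, h4, h5, -, h6, -⟩ | ⟨y, t, q, hy, h4⟩ | ⟨t, q, hy, h4, h6⟩
    · have := h4 b rfl
      subst this
      rw [h6]
      exact (hxd.2.2 b (h5.symm.trans hb)).trans h3
    · rcases hC.domStep_cases hy h4 with ⟨hq, -⟩ | ⟨h, -⟩
      · have hbx : loc C b = loc C x := by
          by_cases hbt : b = t
          · rw [← hb, hbt, h4.loc_s', h4.loc_s]
          · rw [← hb, h4.move b rfl hbt, hq, travel_neg_one]
        rw [hbx] at hy h4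
        obtain rfl := hxd.unique hid hC.toBase hy
        by_cases hbt : b = t
        · rw [hbt, h4.str_s]
        by_cases hbx' : b = x
        · rw [hbx']
        rw [(h4.zombie b hbx hbt hbx').2]
        exact (hxd.2.2 b hbx).trans h3
      · exact absurd h hsl0
    · have hbx : loc C b ≠ loc C x := fun h => hy (h ▸ ⟨x, hxd⟩)
      by_cases hbt : b = t
      · rw [hbt, h4.loc_s'] at hb
        exact absurd hb hbx
      obtain ⟨h7, -, h8⟩ := h4.move b rfl hbt
      rcases h4.q_cases with hq | hq
      · rw [hq, travel_neg_one] at h7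
        exact absurd (h7.symm.trans hb) hbx
      -- A zombie arriving at the node of `x` was weaker than the label it left. The pointer of this
      -- label leads to an agent `c` that is at least as strong as the label and is itself dominated
      -- by `x`.
      · obtain ⟨c, hc1, hc2, hc3⟩ := hC.target h4.loc_s h4.mode_s hy
        rw [h8]
        refine (h6 b rfl hbt).le.trans (hc3.trans ((hxd.2.2 c ?_).trans h3))
        rw [hc1, ← hq, ← h7, hb]
  refine { hG' with dom_of_leader := ?_, label := ?_, reach := ?_ }
  · intro x hx
    obtain ⟨h1, h2⟩ := hdom x hx
    exact ⟨x, h2.1.symm ▸ h2⟩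
  · intro v x s hx hs hsv
    obtain ⟨h1, h2⟩ := hdom x hx.2.1
    have hv : loc C x = v := h2.1.symm.trans hx.1
    rw [hv] at h1
    have hs1 := hC.toGood.settled_of_next hS hs
    have hein := (hC.leader_stays hid hS hsl0 h1).2.2.2
    rcases hC.toGood.node_step hS (a := x) hv with
      ⟨y, hy, h4, h5, -, h6, -⟩ | ⟨y, t, q, hy, h4⟩ | ⟨t, q, hy, h4, h6⟩
    · rw [h4 s (hs1.symm.trans hsv), ← h4 x hv, hx.2.1] at hs; cases hs
    · obtain rfl := h1.unique hid hC.toBase hy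
      obtain rfl := hG'.settled_unique s t hs h4.mode_s (hsv.trans h4.loc_s'.symm)
      refine ⟨h4.str_s, ?_⟩
      rcases hC.domStep_cases h1 h4 with ⟨-, h⟩ | ⟨h, -⟩
      · rw [h, hein]
      · exact absurd h hsl0
    · exact absurd ⟨x, h1⟩ hy
  · intro s hs
    have hs1 := hC.toGood.settled_of_next hS hs
    rw [hs1]
    rcases hC.toGood.node_step hS (a := s) rfl with
      ⟨y, hy, h4, h5, h7, h6, -⟩ | ⟨y, t, q, hy, h4⟩ | ⟨t, q, hy, h4, h6⟩
    · rw [h4 s rfl, h7] at hs; cases hs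
    · have hst : s = t := hG'.settled_unique s t hs h4.mode_s (hs1.trans h4.loc_s'.symm)
      subst hst
      obtain ⟨h7, h8, -⟩ := hC.leader_stays hid hS hsl0 hy
      exact ⟨1, .term (Or.inr (Or.inl ⟨y, h7, h8, h4.str_s.le, le_rfl⟩))⟩
    · have hst : s = t := hG'.settled_unique s t hs h4.mode_s' (hs1.trans h4.loc_s'.symm)
      subst hst
      obtain ⟨b, hb⟩ := hC.reach s h4.mode_s
      rw [h4.str_s]
      refine ⟨b + 1, Path.shift (cs := 0) (cl := 1) (K := above (str C s)) ?_⟩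
      rcases hsl with hsl | hsl
      · exact hC.path_chase hid hS (cs := 1) (Or.inl ⟨hsl, rfl⟩) _ hb
      · exact hC.path_chase hid hS (cs := 0) (Or.inr ⟨hsl, rfl⟩) _
          (Path.relax (K := above (str C s)) hb)

end Chase
end Paths

/-! ### Slots `0` and `1`: leaders explore and backtrack -/

section Moves

variable {A V : Type*} [Fintype V] {G : SimpleGraph V} [DecidableRel G.Adj] [Finite A]
  {P : PortLabelling G} {ident : A → ℕ} {sl : Fin 4} {C C' : Config Mem A V}

/-- In slot `0` a leader either stays, or it leaves its node via the new pointer of its minion. -/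
theorem Calm.dom_next (hid : Function.Injective ident) (hdeg : ∀ v, 0 < G.degree v)
    (hC : Calm P ident 0 C) (hS : Step P 0 C C') {v : V} {x : A} (hx : Dom C v x) :
    mode C' x = Mode.leader ∧ str C x ≤ str C' x ∧
    ((loc C' x = v ∧ ein C' x = ein C x ∧ (∀ a, loc C a = v → loc C' a = v) ∧
        ∀ s, mode C' s = Mode.settled → loc C' s = v →
          str C' s = str C' x ∧ lst C' s = ein C' x) ∨
      (str C' x = str C x ∧ loc C' x ≠ v ∧ ∃ s, mode C s = Mode.settled ∧ loc C s = v ∧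
        lst C s = ein C x ∧ mode C' s = Mode.settled ∧ loc C' s = v ∧ str C' s = str C' x ∧
        lst C' s = (ein C x + 1) % (G.degree v : ℤ) ∧
        travel P v (lst C' s) = (loc C' x, ein C' x) ∧
        travel P (loc C' x) (ein C' x) = (v, lst C' s) ∧
        ∀ a, loc C a = v → a ≠ s → loc C' a = loc C' x)) := by
  have hG' := hC.good_next hid hS
  rcases hC.toGood.node_step hS hx.1 with
    ⟨y, hy, h1, h2, h3, h4, h5⟩ | ⟨y, t, q, hy, h1⟩ | ⟨t, q, hy, h1, -⟩
  · obtain rfl := h1 x hx.1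
    refine ⟨h3, h4.ge, Or.inl ⟨h2, h5, fun a ha => by rw [h1 a ha, h2], fun s hs hsv => ?_⟩⟩
    rw [h1 s ((hC.toGood.settled_of_next hS hs).symm.trans hsv), h3] at hs
    cases hs
  · obtain rfl := hx.unique hid hC.toBase hy
    have hl := h1.x_loc hx
    have he := h1.ein_x
    refine ⟨h1.mode_x, h1.str_le, ?_⟩
    rcases hC.domStep_cases hx h1 with ⟨hq, hlst⟩ | ⟨-, h2, h3, h4, h5, h6, h7⟩
    · rw [hq, travel_neg_one] at hl he
      refine Or.inl ⟨hl, he, fun a ha => ?_, fun s hs hsv => ?_⟩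
      · by_cases hat : a = t
        · rw [hat, h1.loc_s']
        · rw [h1.move a ha hat, hq, travel_neg_one]
      · obtain rfl := hG'.settled_unique s t hs h1.mode_s (hsv.trans h1.loc_s'.symm)
        exact ⟨h1.str_s, hlst.trans he.symm⟩
    · have hp : IsPort G v q := by rw [h6]; exact Traversal.isPort_emod (hdeg v) _
      obtain ⟨t1, t2, t3⟩ := travel_spec P hp
      rw [if_neg (by have := t2.1; omega)] at he
      have ht : travel P v q = (loc C' x, ein C' x) := by rw [hl, he]
      refine Or.inr ⟨h4, ?_, t, h2, h1.loc_s, h5, h1.mode_s, h1.loc_s', h1.str_s, ?_, ?_, ?_, ?_⟩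
      · rw [hl]; exact t1.ne'
      · rw [h7, h6]
      · rw [h7, ht]
      · rw [h7, hl, he, t3]
      · intro a ha hat
        rw [h1.move a ha hat, hl]
  · exact absurd ⟨x, hx⟩ hy

theorem Calm.home_next (hid : Function.Injective ident) (hdeg : ∀ v, 0 < G.degree v)
    (hC : Calm P ident 0 C) (hS : Step P 0 C C') {v : V} {x : A} (hx : Dom C v x) :
    Home P C' v x := by
  obtain ⟨-, -, ⟨h1, -, -, h2⟩ | ⟨-, h1, s, -, -, -, h3, h4, h5, -, h6, h7, -⟩⟩ :=
    hC.dom_next hid hdeg hS hx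
  · exact Or.inl ⟨h1, h2⟩
  · exact Or.inr ⟨h1, s, h3, h4, h5, h6, h7⟩

/-- The transfer of a path in slot `0`. -/
theorem Calm.path_forward (hid : Function.Injective ident) (hdeg : ∀ v, 0 < G.degree v)
    (hC : Calm P ident 0 C) (hS : Step P 0 C C') (K : StrengthClass)
    {v : V} {b : ℕ} (h : Path P C K.mid (Term K C (AtNode C) 0 1) v b) :
    Path P C' K.mid (Term K C' (Home P C') 0 1) v b := by
  refine h.map ?_ ?_
  · rintro v b (⟨a, rfl, h2, h3⟩ | ⟨x, rfl, h2, h3, h4⟩ | ⟨z, h1, h2, h3, h4⟩)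
    · obtain ⟨a', h4, h5, h6⟩ := hC.toGood.keep hS h2
      exact .term (Or.inl ⟨a', h4, h5, K.hi_mono h6 h3⟩)
    · obtain ⟨y, hy⟩ := hC.dom_of_leader x h2
      obtain ⟨h6, h7, -⟩ := hC.dom_next hid hdeg hS hy
      exact .term (Or.inr (Or.inl ⟨y, hC.home_next hid hdeg hS hy, h6,
        K.mid_mono ((hy.2.2 x rfl).trans h7) h3, h4⟩))
    · rcases hC.toGood.node_step hS h1 with
        ⟨y, hy, h5, -⟩ | ⟨y, t, q, hy, h5⟩ | ⟨t, q, hy, h5, h6⟩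
      · rw [h5 z h1, hy.2.1] at h2; cases h2
      · have := h5.hi_of_mid hid hC.toGood hy K h1 (by rintro rfl; rw [hy.2.1] at h2; cases h2)
          (by rw [h2]; decide) h3
        exact .term (Or.inl ⟨t, h5.loc_s', by rw [h5.mode_s]; decide, by rwa [h5.str_s]⟩)
      · have hzt : z ≠ t := by rintro rfl; rw [h5.mode_s] at h2; cases h2
        obtain ⟨m1, m2, m3⟩ := h5.move z h1 hzt
        rw [h5.stay (by decide) (by decide), travel_neg_one] at m1
        exact .term (Or.inr (Or.inr ⟨z, m1, m2, m3 ▸ h3, h4⟩))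
  · intro s hs hm
    rcases hC.toGood.node_step hS (a := s) rfl with
      ⟨y, hy, h5, -⟩ | ⟨y, t, q, hy, h5⟩ | ⟨t, q, hy, h5, h6⟩
    · rw [h5 s rfl, hy.2.1] at hs; cases hs
    · left
      intro b
      exact .term (Or.inr (Or.inl ⟨y, hC.home_next hid hdeg hS hy, h5.mode_x,
        K.mid_mono ((hy.2.2 s rfl).trans h5.str_le) hm, by omega⟩))
    · right
      obtain rfl := hC.settled_unique s t hs h5.mode_s h5.loc_s.symm
      exact ⟨h5.mode_s', h5.loc_s', h5.str_s, h5.lst_s⟩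

theorem Calm.semi (hid : Function.Injective ident) (hdeg : ∀ v, 0 < G.degree v)
    (hC : Calm P ident 0 C) (hS : Step P 0 C C') : Semi P ident C' := by
  have hG' : Good ident 1 C' := hC.good_next hid hS
  refine { hG' with home := ?_, reach := ?_ }
  · intro x hx
    exact ⟨loc C x, hC.home_next hid hdeg hS (hC.toGood.dom_of_next hS hx)⟩
  · intro s hs
    have hs1 := hC.toGood.settled_of_next hS hs
    rw [hs1]
    rcases hC.toGood.node_step hS (a := s) rfl with
      ⟨y, hy, h4, h5, h7, h6, -⟩ | ⟨y, t, q, hy, h4⟩ | ⟨t, q, hy, h4, h6⟩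
    · rw [h4 s rfl, h7] at hs; cases hs
    · have hst : s = t := hG'.settled_unique s t hs h4.mode_s (hs1.trans h4.loc_s'.symm)
      subst hst
      exact ⟨1, .term (Or.inr (Or.inl ⟨y, hC.home_next hid hdeg hS hy, h4.mode_x, h4.str_s.le,
        le_rfl⟩))⟩
    · have hst : s = t := hG'.settled_unique s t hs h4.mode_s' (hs1.trans h4.loc_s'.symm)
      subst hst
      obtain ⟨b, hb⟩ := hC.reach s h4.mode_s
      rw [h4.str_s]
      refine ⟨b + 1, Path.shift (cs := 0) (cl := 1) (K := above (str C s)) ?_⟩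
      exact hC.path_forward hid hdeg hS _
        (Path.relax (K := above (str C s)) hb)

/-- In slot `1` a leader that dominates its node either stays or returns to its home. -/
theorem Semi.dom_next (hid : Function.Injective ident) (hC : Semi P ident C)
    (hS : Step P 1 C C') {u : V} {x : A} (hx : Dom C u x) :
    mode C' x = Mode.leader ∧ str C x ≤ str C' x ∧
    ((loc C' x = u ∧ ein C' x = ein C x ∧ (∀ a, loc C a = u → loc C' a = u) ∧
        ∀ s, mode C' s = Mode.settled → loc C' s = u →
          str C' s = str C' x ∧ lst C' s = ein C' x) ∨
      (str C' x = str C x ∧ loc C' x ≠ u ∧ ∃ v s t, v = loc C' x ∧ v ≠ u ∧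
        mode C s = Mode.settled ∧ loc C s = v ∧ str C s = str C x ∧ lst C s = ein C' x ∧
        travel P u (ein C x) = (v, lst C s) ∧
        mode C t = Mode.settled ∧ loc C t = u ∧ str C t = str C x ∧ str C' t = str C t ∧
        lst C t ≠ ein C x ∧ lst C' t = lst C t ∧
        ∀ a, loc C a = u → a ≠ t → loc C' a = v)) := by
  have hG' : Good ident 2 C' := hC.toGood.next hid hS (fun h => absurd h (by decide))
  rcases hC.toGood.node_step hS hx.1 with
    ⟨y, hy, h1, h2, h3, h4, h5⟩ | ⟨y, t, q, hy, h1⟩ | ⟨t, q, hy, h1, -⟩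
  · obtain rfl := h1 x hx.1
    refine ⟨h3, h4.ge, Or.inl ⟨h2, h5, fun a ha => by rw [h1 a ha, h2], fun s hs hsv => ?_⟩⟩
    rw [h1 s ((hC.toGood.settled_of_next hS hs).symm.trans hsv), h3] at hs
    cases hs
  · obtain rfl := hx.unique hid hC.toBase hy
    have hl := h1.x_loc hx
    have he := h1.ein_x
    refine ⟨h1.mode_x, h1.str_le, ?_⟩
    have hstay : q = -1 → lst C' t = ein C x → loc C' x = u ∧ ein C' x = ein C x ∧
        (∀ a, loc C a = u → loc C' a = u) ∧ ∀ s, mode C' s = Mode.settled → loc C' s = u →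
          str C' s = str C' x ∧ lst C' s = ein C' x := by
      intro hq hlst
      rw [hq, travel_neg_one] at hl he
      refine ⟨hl, he, fun a ha => ?_, fun s hs hsv => ?_⟩
      · by_cases hat : a = t
        · rw [hat, h1.loc_s']
        · rw [h1.move a ha hat, hq, travel_neg_one]
      · obtain rfl := hG'.settled_unique s t hs h1.mode_s (hsv.trans h1.loc_s'.symm)
        exact ⟨h1.str_s, hlst.trans he.symm⟩
    rcases h1.out with ⟨hq, hlst, -⟩ | ⟨h2, h3, ⟨h4, h5, h6⟩ | ⟨-, h, -⟩ | ⟨h4, -, h5, h6⟩⟩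
    · exact Or.inl (hstay hq hlst)
    · have hun := h1.str_eq_of_minion hC.toGood hx h2 h3
      obtain ⟨v, ⟨hxv, hv⟩ | ⟨hne, s, s1, s2, s3, s4, s5⟩⟩ := hC.home x hx.2.1
      · have hvu : v = u := hxv.symm.trans hx.1
        exact absurd (hv t h2 (h1.loc_s.trans hvu.symm)).2 h4
      · have hs := s4
        rw [hx.1] at hne s4 s5
        have hport : IsPort G v (lst C s) := by
          by_contra hnp
          rw [travel_of_not_isPort P hnp, Prod.mk.injEq] at s4
          exact hne s4.1.symm
        have hp := hport.1
        rw [h5, s5] at hl he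
        dsimp only at hl he
        rw [if_neg (by omega)] at he
        refine Or.inr ⟨hun, hl ▸ hne.symm, v, s, t, hl.symm, hne.symm, s1, s2, s3, he.symm, s5, h2,
          h1.loc_s, h3.trans hun, h1.str_s.trans h3.symm, h4, h6, ?_⟩
        intro a ha hat
        rw [h1.move a ha hat, h5, s5]
    · exact absurd h (by decide)
    · exact Or.inl (hstay h5 (h6.trans h4))
  · exact absurd ⟨x, hx⟩ hy

theorem Semi.good_next (hid : Function.Injective ident) (hC : Semi P ident C)
    (hS : Step P 1 C C') : Good ident 2 C' :=
  hC.toGood.next hid hS (fun h => absurd h (by decide))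

/-- What happens in slot `1` to the label of a node: it is unchanged, or a leader stays there. -/
theorem Semi.settled_next (hid : Function.Injective ident) (hC : Semi P ident C)
    (hS : Step P 1 C C') {s : A} (hs : mode C s = Mode.settled) :
    (∃ y, loc C' y = loc C s ∧ mode C' y = Mode.leader ∧ str C s ≤ str C' y) ∨
    (mode C' s = Mode.settled ∧ loc C' s = loc C s ∧ str C' s = str C s ∧ lst C' s = lst C s) := by
  rcases hC.toGood.node_step hS (a := s) rfl with
    ⟨y, hy, h5, -⟩ | ⟨y, t, q, hy, h5⟩ | ⟨t, q, hy, h5, h6⟩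
  · rw [h5 s rfl, hy.2.1] at hs; cases hs
  · obtain ⟨h1, h2, ⟨h3, -⟩ | ⟨-, -, v, s', t', -, -, -, -, -, -, -, h6, h7, -, h8, -, h9, -⟩⟩ :=
      hC.dom_next hid hS hy
    · exact Or.inl ⟨y, h3, h1, (hy.2.2 s rfl).trans h2⟩
    · right
      obtain rfl := h5.uniq s rfl hs
      obtain rfl := hC.settled_unique s t' hs h6 h7.symm
      exact ⟨h5.mode_s, h5.loc_s', h8, h9⟩
  · right
    obtain rfl := hC.settled_unique s t hs h5.mode_s h5.loc_s.symm
    exact ⟨h5.mode_s', h5.loc_s', h5.str_s, h5.lst_s⟩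

/-- A leader that has not moved in slot `0` does not leave its node in slot `1` without
replacement. -/
theorem Semi.resident_next (hid : Function.Injective ident) (hC : Semi P ident C)
    (hS : Step P 1 C C') {v : V} {x : A} (hxm : mode C x = Mode.leader) (hxv : loc C x = v)
    (hx : ∀ s, mode C s = Mode.settled → loc C s = v → str C s = str C x ∧ lst C s = ein C x) :
    ∃ y, loc C' y = v ∧ mode C' y = Mode.leader ∧ str C x ≤ str C' y := by
  rcases hC.toGood.node_step hS hxv with
    ⟨y, hy, h5, -⟩ | ⟨y, t, q, hy, h5⟩ | ⟨t, q, hy, h5, h6⟩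
  · obtain ⟨h1, h2, ⟨h3, -⟩ | ⟨-, -, v', s', t', -, -, -, -, -, -, -, h6, h7, -⟩⟩ :=
      hC.dom_next hid hS hy
    · exact ⟨y, h3, h1, (hy.2.2 x hxv).trans h2⟩
    · rw [h5 t' h7, hy.2.1] at h6; cases h6
  · obtain ⟨h1, h2, ⟨h3, -⟩ | ⟨-, -, v', s', t', -, -, -, -, -, -, -, h6, h7, h8, -, h9, -⟩⟩ :=
      hC.dom_next hid hS hy
    · exact ⟨y, h3, h1, (hy.2.2 x hxv).trans h2⟩
    · exfalso
      obtain ⟨h10, h11⟩ := hx t' h6 h7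
      have : x = y := hC.str_ne hid (mode_ne_settled_of_leader hxm)
        (mode_ne_settled_of_leader hy.2.1) (h10.symm.trans h8)
      subst this
      exact h9 h11
  · exfalso
    have hxt : x ≠ t := by rintro rfl; rw [h5.mode_s] at hxm; cases hxm
    have := h6 x hxv hxt
    rw [(hx t h5.mode_s h5.loc_s).1] at this
    exact lt_irrefl _ this

/-- The transfer of a path in slot `1`. -/
theorem Semi.path_next (hid : Function.Injective ident) (hC : Semi P ident C)
    (hS : Step P 1 C C') (K : StrengthClass) {v : V} {b : ℕ}
    (h : Path P C K.mid (Term K C (Home P C) 0 1) v b) :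
    Path P C' K.mid (Term K C' (AtNode C') 0 0) v b := by
  have hsettled : ∀ s, mode C s = Mode.settled → K.mid (str C s) →
      (∀ b, Path P C' K.mid (Term K C' (AtNode C') 0 0) (loc C s) b) ∨
      (mode C' s = Mode.settled ∧ loc C' s = loc C s ∧ str C' s = str C s ∧
        lst C' s = lst C s) := by
    intro s hs hm
    rcases hC.settled_next hid hS hs with ⟨y, h1, h2, h3⟩ | h
    · exact Or.inl fun b => .term (Or.inr (Or.inl ⟨y, h1, h2, K.mid_mono h3 hm, by omega⟩))
    · exact Or.inr h
  refine h.map ?_ fun s hs hm => (hsettled s hs hm).imp_left fun h b => h _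
  rintro v b (⟨a, rfl, h2, h3⟩ | ⟨x, hx, h2, h3, h4⟩ | ⟨z, h1, h2, h3, h4⟩)
  · obtain ⟨a', h4, h5, h6⟩ := hC.toGood.keep hS h2
    exact .term (Or.inl ⟨a', h4, h5, K.hi_mono h6 h3⟩)
  · rcases hx with ⟨hxv, hx⟩ | ⟨hxv, s, s1, s2, s3, s4, s5⟩
    · obtain ⟨y, h5, h6, h7⟩ := hC.resident_next hid hS h2 hxv hx
      exact .term (Or.inr (Or.inl ⟨y, h5, h6, K.mid_mono h7 h3, by omega⟩))
    · subst s2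
      rcases hsettled s s1 (s3 ▸ h3) with h5 | ⟨h5, h6, h7, h8⟩
      · exact h5 b
      have hu : (travel P (loc C' s) (lst C' s)).1 = loc C x := by rw [h6, h8, s4]
      -- The leader was counted at its home but has moved on. If it does not come back, the path
      -- follows the pointer of the home node, at the price `cl = 1`.
      have hstep : Path P C' K.mid (Term K C' (AtNode C') 0 0) (loc C x) (b - 1) →
          Path P C' K.mid (Term K C' (AtNode C') 0 0) (loc C s) b := by
        intro h
        have := Path.step (P := P) (s := s) h5 (by rw [h7, s3]; exact h3) (hu ▸ h)
        rwa [h6, Nat.sub_add_cancel h4] at this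
      by_cases hd : Dom C (loc C x) x
      · obtain ⟨d1, d2, ⟨d3, -⟩ | ⟨-, -, v', s', t', d3, -, d4, d5, d6, -, d7, -⟩⟩ :=
          hC.dom_next hid hS hd
        · exact hstep (.term (Or.inr (Or.inl ⟨x, d3, d1, K.mid_mono d2 h3, by omega⟩)))
        · have : v' = loc C s := by
            rw [s5, Prod.mk.injEq] at d7
            exact d7.1.symm
          rw [← this, d3]
          exact .term (Or.inr (Or.inl ⟨x, rfl, d1, K.mid_mono d2 h3, by omega⟩))
      · rcases hC.toGood.node_step hS (a := x) rfl with
          ⟨y, hy, h9, -⟩ | ⟨y, t, q, hy, h9⟩ | ⟨t, q, hy, h9, h10⟩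
        · obtain rfl := h9 x rfl
          exact absurd hy hd
        · have := h9.hi_of_mid hid hC.toGood hy K (z := x) rfl (by rintro rfl; exact hd hy)
            (by rw [h2]; decide) h3
          exact hstep (.term (Or.inl ⟨t, h9.loc_s', by rw [h9.mode_s]; decide,
            by rwa [h9.str_s]⟩))
        · have hxt : x ≠ t := by rintro rfl; rw [h9.mode_s] at h2; cases h2
          obtain ⟨m1, m2, m3⟩ := h9.move x rfl hxt
          rw [h9.stay (by decide) (by decide), travel_neg_one] at m1
          exact hstep (.term (Or.inr (Or.inr ⟨x, m1, m2, m3 ▸ h3, by omega⟩)))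
  · rcases hC.toGood.node_step hS h1 with
      ⟨y, hy, h5, -⟩ | ⟨y, t, q, hy, h5⟩ | ⟨t, q, hy, h5, h6⟩
    · rw [h5 z h1, hy.2.1] at h2; cases h2
    · have := h5.hi_of_mid hid hC.toGood hy K h1 (by rintro rfl; rw [hy.2.1] at h2; cases h2)
        (by rw [h2]; decide) h3
      exact .term (Or.inl ⟨t, h5.loc_s', by rw [h5.mode_s]; decide, by rwa [h5.str_s]⟩)
    · have hzt : z ≠ t := by rintro rfl; rw [h5.mode_s] at h2; cases h2
      obtain ⟨m1, m2, m3⟩ := h5.move z h1 hzt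
      rw [h5.stay (by decide) (by decide), travel_neg_one] at m1
      exact .term (Or.inr (Or.inr ⟨z, m1, m2, m3 ▸ h3, h4⟩))

/-- The agents that arrive at a node in slot `1` return with a leader to the home of this
leader. -/
theorem Semi.arrival (hid : Function.Injective ident) (hC : Semi P ident C)
    (hS : Step P 1 C C') {v : V} {b : A} (hb : loc C' b = v) (hbv : loc C b ≠ v) :
    ∃ x s, Dom C (loc C b) x ∧ mode C' x = Mode.leader ∧ loc C' x = v ∧
      mode C s = Mode.settled ∧ loc C s = v ∧ str C s = str C x ∧ str C' x = str C x ∧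
      lst C s = ein C' x ∧ str C' b ≤ str C' x ∧ loc C x ≠ v := by
  rcases hC.toGood.node_step hS (a := b) rfl with
    ⟨y, hy, h9, h10, -⟩ | ⟨y, t, q, hy, h9⟩ | ⟨t, q, hy, h9, h10⟩
  · obtain rfl := h9 b rfl
    exact absurd (h10.symm.trans hb) hbv
  · obtain ⟨d1, d2, ⟨d3, -, d4, -⟩ |
        ⟨d2, -, w, s, t', d3, d4, d5, d6, d7, d8, d9, d10, d11, -, -, -, -, d12⟩⟩ :=
      hC.dom_next hid hS hy
    · exact absurd ((d4 b rfl).symm.trans hb) hbv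
    · have hbt : b ≠ t' := by
        rintro rfl
        exact hbv ((hC.toGood.settled_next hS d10).2.1.symm.trans hb)
      have hw : w = v := (d12 b rfl hbt).symm.trans hb
      subst hw
      refine ⟨y, s, hy, d1, d3.symm, d5, d6, d7, d2, d8, ?_, hy.1.trans_ne hbv⟩
      by_cases hby : b = y
      · rw [hby]
      · have : b ≠ t := fun h => hbt (h9.uniq t' d11 d10 ▸ h)
        rw [(h9.zombie b rfl this hby).2, d2]
        exact hy.2.2 b rfl
  · by_cases hbt : b = t
    · rw [hbt, h9.loc_s'] at hb
      exact absurd hb hbv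
    · obtain ⟨m1, -⟩ := h9.move b rfl hbt
      rw [h9.stay (by decide) (by decide), travel_neg_one] at m1
      exact absurd (m1.symm.trans hb) hbv

/-- In slot `2` a leader without minion at its node is alone. -/
theorem Semi.lone (hid : Function.Injective ident) (hC : Semi P ident C)
    (hS : Step P 1 C C') {a b : A} (hab : a ≠ b) (h : loc C' a = loc C' b) :
    ∃ s, mode C' s = Mode.settled ∧ loc C' s = loc C' a := by
  by_cases ha : loc C a = loc C' a
  · by_cases hb : loc C b = loc C' a
    · obtain ⟨s, h1, -, h2, -⟩ := hC.toGood.exists_settled_next hS hab (ha.trans hb.symm)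
      exact ⟨s, h1, h2.trans ha⟩
    · obtain ⟨x, s, -, -, -, h1, h2, -⟩ := hC.arrival hid hS h.symm hb
      obtain ⟨h3, h4, -⟩ := hC.toGood.settled_next hS h1
      exact ⟨s, h3, h4.trans h2⟩
  · obtain ⟨x, s, -, -, -, h1, h2, -⟩ := hC.arrival hid hS rfl ha
    obtain ⟨h3, h4, -⟩ := hC.toGood.settled_next hS h1
    exact ⟨s, h3, h4.trans h2⟩

theorem Semi.dom_of_stay (hid : Function.Injective ident) (hC : Semi P ident C)
    (hS : Step P 1 C C') {v : V} {y : A} (hy : Dom C v y) (hyv : loc C' y = v) : Dom C' v y := by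
  obtain ⟨d1, d2, -⟩ := hC.dom_next hid hS hy
  refine ⟨hyv, d1, fun b hb => ?_⟩
  by_cases hbv : loc C b = v
  · rcases hC.toGood.node_step hS hbv with
      ⟨z, hz, h9, h10, -⟩ | ⟨z, t, q, hz, h9⟩ | ⟨t, q, hz, h9, h10⟩
    · rw [h9 b hbv, ← h9 y hy.1]
    · obtain rfl := hy.unique hid hC.toBase hz
      by_cases hbt : b = t
      · rw [hbt, h9.str_s]
      by_cases hby : b = y
      · rw [hby]
      · rw [(h9.zombie b hbv hbt hby).2]
        exact (hy.2.2 b hbv).trans d2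
    · exact absurd ⟨y, hy⟩ hz
  · obtain ⟨x, s, -, -, -, -, h2, h3, h4, -, h5, -⟩ := hC.arrival hid hS hb hbv
    refine h5.trans ?_
    rw [h4, ← h3]
    exact (hy.2.2 s h2).trans d2

/-- The label of a node names the one leader that can return to it. If a dominating leader stays
there, arrivals are no stronger than the old label and hence than this leader. Otherwise the
returning leader dominates, because it has the strength of the label. -/
theorem Semi.calm (hid : Function.Injective ident) (hC : Semi P ident C)
    (hS : Step P 1 C C') : Calm P ident 2 C' := by
  have hG' := hC.good_next hid hS
  -- A leader that returns to a node where no leader stays.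
  have hret : ∀ x s v, mode C x = Mode.leader → mode C' x = Mode.leader → loc C' x = v →
      loc C x ≠ v → mode C s = Mode.settled →
      loc C s = v → str C s = str C x → str C' x = str C x →
      (¬ ∃ y, Dom C v y ∧ loc C' y = v) → Dom C' v x := by
    intro x s v hxm hxm' hxv hxv' hs hsv hsx hxx hno
    refine ⟨hxv, hxm', fun b hb => ?_⟩
    by_cases hbv : loc C b = v
    · rcases hC.toGood.node_step hS hbv with
        ⟨z, hz, h9, h10, -⟩ | ⟨z, t, q, hz, h9⟩ | ⟨t, q, hz, h9, h10⟩
      · exact absurd ⟨z, hz, h10⟩ hno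
      · obtain rfl := h9.uniq s hsv hs
        obtain ⟨d1, d2, ⟨d3, -⟩ |
          ⟨d2, d3, w, s', t', d4, d5, d6, d7, d8, d9, d10, d11, d12, d13, d14, -, -, d15⟩⟩ :=
          hC.dom_next hid hS hz
        · exact absurd ⟨z, hz, d3⟩ hno
        · obtain rfl := h9.uniq t' d12 d11
          have : x = z := hC.str_ne hid (mode_ne_settled_of_leader hxm)
            (mode_ne_settled_of_leader hz.2.1) (hsx.symm.trans d13)
          subst this
          exact absurd hz.1 hxv'
      · obtain rfl := hC.settled_unique s t hs h9.mode_s (hsv.trans h9.loc_s.symm)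
        by_cases hbs : b = s
        · rw [hbs, h9.str_s, hsx, hxx]
        · rw [(h9.move b hbv hbs).2.2, hxx, ← hsx]
          exact (h10 b hbv hbs).le
    · obtain ⟨x', s', e1, e2, e3, e4, e5, e6, e7, -, e8, -⟩ := hC.arrival hid hS hb hbv
      obtain rfl := hC.settled_unique s s' hs e4 (hsv.trans e5.symm)
      have : x = x' := hC.str_ne hid (mode_ne_settled_of_leader hxm)
        (mode_ne_settled_of_leader e1.2.1) (hsx.symm.trans e6)
      rw [this]
      exact e8
  refine { hG' with dom_of_leader := ?_, label := ?_, reach := ?_ }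
  · intro x hx
    by_cases hno : ∃ y, Dom C (loc C' x) y ∧ loc C' y = loc C' x
    · obtain ⟨y, hy, hyv⟩ := hno
      exact ⟨y, hC.dom_of_stay hid hS hy hyv⟩
    · have hd := hC.toGood.dom_of_next hS hx
      have hne : loc C x ≠ loc C' x := fun h => hno ⟨x, h ▸ hd, rfl⟩
      obtain ⟨x', s', e1, e2, e3, e4, e5, e6, e7, -, e8, e9⟩ := hC.arrival hid hS rfl hne
      obtain rfl := hd.unique hid hC.toBase e1
      exact ⟨x, hret x s' _ hd.2.1 hx rfl hne e4 e5 e6 e7 hno⟩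
  · intro v x s hx hs hsv
    have hd := hC.toGood.dom_of_next hS hx.2.1
    obtain ⟨d1, d2, ⟨d3, -, -, d4⟩ |
          ⟨d2, d3, w, s', t', d4, d5, d6, d7, d8, d9, -⟩⟩ := hC.dom_next hid hS hd
    · exact d4 s hs (hsv.trans (hx.1.symm.trans d3))
    · have hwv : w = v := d4.trans hx.1
      obtain ⟨e1, e2, e3⟩ := hC.toGood.settled_next hS d6
      obtain rfl := hG'.settled_unique s s' hs e1 (by rw [hsv, e2, d7, hwv])
      have e4 : str C' s = str C' x :=
        le_antisymm (hx.2.2 s hsv) (by rw [d2, ← d8]; exact e3)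
      refine ⟨e4, ?_⟩
      rw [← d9]
      exact hC.toGood.lst_next hS (by decide) d6 (by rw [e4, d2, d8])
  · intro s hs
    have hs1 := hC.toGood.settled_of_next hS hs
    have key : mode C s = Mode.settled → str C' s = str C s → ∃ b, Path P C'
        (above (str C' s)).mid (Term (above (str C' s)) C' (AtNode C') 1 1) (loc C' s) b := by
      intro h1 h2
      rw [h2, hs1]
      obtain ⟨b, hb⟩ := hC.reach s h1
      refine ⟨b + 1, Path.shift (cs := 0) (cl := 0) (K := above (str C s)) ?_⟩
      exact hC.path_next hid hS _
        (Path.relax (K := above (str C s)) hb)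
    rcases hC.toGood.node_step hS (a := s) rfl with
      ⟨y, hy, h4, h5, h7, h6, -⟩ | ⟨y, t, q, hy, h4⟩ | ⟨t, q, hy, h4, h6⟩
    · rw [h4 s rfl, h7] at hs; cases hs
    · have hst : s = t := hG'.settled_unique s t hs h4.mode_s (hs1.trans h4.loc_s'.symm)
      subst hst
      obtain ⟨d1, d2, ⟨d3, -⟩ |
          ⟨d2, d3, w, s', t', -, -, -, -, -, -, -, d11, d12, d13, d14, -⟩⟩ := hC.dom_next hid hS hy
      · exact ⟨1, .term (Or.inr (Or.inl ⟨y, d3.trans hs1.symm, d1, h4.str_s.le, le_rfl⟩))⟩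
      · obtain rfl := h4.uniq t' d12 d11
        exact key d11 d14
    · have hst : s = t := hG'.settled_unique s t hs h4.mode_s' (hs1.trans h4.loc_s'.symm)
      subst hst
      exact key h4.mode_s h4.str_s

end Moves

/-! ### The execution as a sequence of cycles -/

section Cycles

variable {A V : Type*} [Fintype V] {G : SimpleGraph V} [DecidableRel G.Adj]
  {P : PortLabelling G} {ident : A → ℕ} {sl : Fin 4} {C C' : Config Mem A V}

/-- Four consecutive steps, from a configuration in slot `2` to the next one; a node with two agents
has a settled agent at the beginning. -/
structure Cycle (P : PortLabelling G) (ident : A → ℕ) (C₂ C₃ C₄ C₅ C₆ : Config Mem A V) : Prop where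
  calm₂ : Calm P ident 2 C₂
  calm₃ : Calm P ident 3 C₃
  calm₄ : Calm P ident 0 C₄
  semi₅ : Semi P ident C₅
  calm₆ : Calm P ident 2 C₆
  step₂ : Step P 2 C₂ C₃
  step₃ : Step P 3 C₃ C₄
  step₄ : Step P 0 C₄ C₅
  step₅ : Step P 1 C₅ C₆
  lone₂ : ∀ a b, a ≠ b → loc C₂ a = loc C₂ b → ∃ s, mode C₂ s = Mode.settled ∧ loc C₂ s = loc C₂ a

theorem initial_calm [Finite A] (ch : ZombieChoice) (P : PortLabelling G)
    (place : A → V) : Calm P ident 0 ((algorithm ch).initial ident place) := by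
  have hm : ∀ a, mode ((algorithm ch).initial ident place) a ≠ Mode.settled := by
    intro a; simp [mode, algorithm, Algorithm.initial]
  have hz : ∀ a, mode ((algorithm ch).initial ident place) a = Mode.leader := fun a => rfl
  have hG : Good ident 0 ((algorithm ch).initial ident place) :=
    { id_eq := fun a => rfl
      settled_unique := fun a b h => absurd h (hm a)
      lid_eq := fun a _ => rfl
      slot_eq := fun a => rfl
      zombie_lt := fun z h => by rw [hz] at h; cases h
      label_le := fun s a h => absurd h (hm s) }
  refine { hG with
    dom_of_leader := ?_
    label := fun v x s _ h => absurd h (hm s)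
    reach := fun s h => absurd h (hm s) }
  intro x hx
  obtain ⟨b, hb, -, hmax⟩ := hG.exists_top x
  exact ⟨b, hb, hz b, hmax⟩

/-- The execution from the initial configuration. -/
noncomputable def run [Fintype A] (ch : ZombieChoice) (P : PortLabelling G) (ident : A → ℕ)
    (place : A → V) (t : ℕ) : Config Mem A V :=
  (algorithm ch).exec P ((algorithm ch).initial ident place) t

theorem run_succ [Fintype A] (ch : ZombieChoice) (P : PortLabelling G) (ident : A → ℕ)
    (place : A → V) (t : ℕ) :
    run ch P ident place (t + 1) = (algorithm ch).next P (run ch P ident place t) :=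
  Function.iterate_succ_apply' _ _ _

section Run

variable [Fintype A] (ch : ZombieChoice) (P) (hid : Function.Injective ident)
  (hdeg : ∀ v, 0 < G.degree v) (place : A → V)
include hid

theorem run_step (t : ℕ) (hB : Base ident sl (run ch P ident place t)) :
    Step P sl (run ch P ident place t) (run ch P ident place (t + 1)) := by
  rw [run_succ]
  exact step_next ch P hid hB

include hdeg

theorem run_semi_of_calm (t : ℕ) (h : Calm P ident 0 (run ch P ident place t)) :
    Semi P ident (run ch P ident place (t + 1)) :=
  h.semi hid hdeg (run_step P ch hid place t h.toBase)

theorem run_calm_of_semi (t : ℕ) (h : Semi P ident (run ch P ident place t)) :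
    Calm P ident 0 (run ch P ident place (t + 3)) := by
  have h2 := h.calm hid (run_step P ch hid place t h.toBase)
  have h3 := h2.next hid (run_step P ch hid place _ h2.toBase) (Or.inl rfl)
  exact h3.next hid (run_step P ch hid place _ h3.toBase) (Or.inr rfl)

theorem run_semi (i : ℕ) : Semi P ident (run ch P ident place (4 * i + 1)) := by
  induction i with
  | zero => exact run_semi_of_calm P ch hid hdeg place 0 (initial_calm ch P place)
  | succ i ih =>
    exact run_semi_of_calm P ch hid hdeg place _ (run_calm_of_semi P ch hid hdeg place _ ih)

/-- The configurations in slot `2` are linked by cycles. -/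
theorem run_cycle (i : ℕ) : Cycle P ident (run ch P ident place (4 * i + 2))
    (run ch P ident place (4 * i + 3)) (run ch P ident place (4 * i + 4))
    (run ch P ident place (4 * i + 5)) (run ch P ident place (4 * i + 6)) := by
  have h1 := run_semi P ch hid hdeg place i
  have s1 := run_step P ch hid place _ h1.toBase
  have h2 := h1.calm hid s1
  have s2 := run_step P ch hid place _ h2.toBase
  have h3 := h2.next hid s2 (Or.inl rfl)
  have s3 := run_step P ch hid place _ h3.toBase
  have h4 := h3.next hid s3 (Or.inr rfl)
  have s4 := run_step P ch hid place _ h4.toBase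
  have h5 := h4.semi hid hdeg s4
  have s5 := run_step P ch hid place _ h5.toBase
  exact ⟨h2, h3, h4, h5, h5.calm hid s5, s2, s3, s4, s5, fun a b => h1.lone hid s1⟩

end Run
end Cycles

/-! ### The traversal behind each leader -/

section Ghosts

variable {A V : Type*} [Fintype V] {G : SimpleGraph V} [DecidableRel G.Adj] [Finite A]
  {P : PortLabelling G} {ident : A → ℕ} {sl : Fin 4} {C C' : Config Mem A V} {x : A}
  {g : Traversal V}

/-- The settled agents record the last explored ports of the traversal `g` of the leader `x`, except
where they have been overwritten by a stronger leader. -/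
structure Cover (C : Config Mem A V) (x : A) (g : Traversal V) : Prop where
  covered : ∀ v ∈ g.R, v ≠ g.w → ∃ s, mode C s = Mode.settled ∧ loc C s = v ∧ str C x ≤ str C s ∧
    (str C s = str C x → lst C s = g.last G v)
  labels : ∀ s, mode C s = Mode.settled → str C s = str C x → loc C s ∈ g.R

/-- `g` is the depth-first traversal of the leader `x` since its last increase of level. -/
structure Ghost (P : PortLabelling G) (C : Config Mem A V) (x : A) (g : Traversal V) : Prop
    extends Cover (G := G) C x g where
  valid : g.Valid P
  w_eq : g.w = loc C x
  last_w : g.last G g.w = ein C x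

/-- `g` is the depth-first traversal of the leader `x`, which has just left the node `g.w`. -/
structure Moved (P : PortLabelling G) (C : Config Mem A V) (x : A) (g : Traversal V) : Prop
    extends Cover (G := G) C x g where
  valid : g.Valid P
  incomplete : g.c g.w < G.degree g.w
  ne : loc C x ≠ g.w
  minion : ∃ s, mode C s = Mode.settled ∧ loc C s = g.w ∧ str C s = str C x ∧
    lst C s = (g.last G g.w + 1) % (G.degree g.w : ℤ)
  move : travel P g.w ((g.last G g.w + 1) % (G.degree g.w : ℤ)) = (loc C x, ein C x)

/-- The identifier in a label determines the leader. So a label equal to the strength of `x` was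
either written by `x` in this step, or is old; in the latter case `label_le` leaves no room for a
raise. -/
theorem Good.label_next (hid : Function.Injective ident) (hG : Good ident sl C)
    (hG' : Good ident (sl + 1) C') (hS : Step P sl C C') (hx' : mode C' x = Mode.leader) {s : A}
    (hs : mode C' s = Mode.settled) (h : str C' s = str C' x) :
    (mode C s = Mode.settled ∧ loc C' s = loc C s ∧ str C s = str C x ∧ str C' x = str C x) ∨
      loc C' s = loc C x := by
  have hl := hG.settled_of_next hS hs
  rw [hl]
  rcases hG.node_step hS (a := s) rfl with
    ⟨y, hy, h4, h5, h7, h6, -⟩ | ⟨y, t, q, hy, h4⟩ | ⟨t, q, hy, h4, h6⟩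
  · rw [h4 s rfl, h7] at hs; cases hs
  · obtain rfl := hG'.settled_unique s t hs h4.mode_s (hl.trans h4.loc_s'.symm)
    right
    rw [← hG'.str_ne hid (mode_ne_settled_of_leader h4.mode_x) (mode_ne_settled_of_leader hx')
      (h4.str_s.symm.trans h)]
    exact hy.1.symm
  · obtain rfl := hG'.settled_unique s t hs h4.mode_s' (hl.trans h4.loc_s'.symm)
    left
    rw [h4.str_s] at h
    have hxs := mode_ne_settled_of_leader hx'
    have h1 := hG.label_le s x h4.mode_s (hG.unsettled_of_next hS hxs) (by
      rw [h]; exact hG'.lid_eq x hxs)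
    have h2 := (hG.str_le_next hS hxs).1
    have h3 : str C s = str C x := le_antisymm h1 (h ▸ h2)
    exact ⟨h4.mode_s, rfl, h3, h ▸ h3⟩

/-- The pointer of a minion of `x` changes only in a step that `x` makes at its node. -/
theorem Good.lst_next_of_ne (hid : Function.Injective ident) (hG : Good ident sl C)
    (hS : Step P sl C C') (hxm : mode C x = Mode.leader) {s : A} (hs : mode C s = Mode.settled)
    (hsx : str C s = str C x) (h : str C' s = str C s) (hne : sl ≠ 0 ∨ loc C s ≠ loc C x) :
    lst C' s = lst C s := by
  rcases hne with hsl | hne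
  · exact hG.lst_next hS hsl hs h
  rcases hG.node_step hS (a := s) rfl with
    ⟨y, hy, h4, -⟩ | ⟨y, t, q, hy, h4⟩ | ⟨t, q, hy, h4, h6⟩
  · rw [h4 s rfl, hy.2.1] at hs; cases hs
  · obtain rfl := h4.uniq s rfl hs
    have h5 := h4.str_eq_of_minion hG hy hs (h.symm.trans h4.str_s)
    have : y = x := hG.str_ne hid (mode_ne_settled_of_leader hy.2.1)
      (mode_ne_settled_of_leader hxm) (by rw [← h5, ← h4.str_s, h, hsx])
    subst this
    exact absurd hy.1.symm hne
  · obtain rfl := hG.settled_unique s t hs h4.mode_s h4.loc_s.symm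
    exact h4.lst_s

theorem Good.covered_next (hid : Function.Injective ident) (hG : Good ident sl C)
    (hS : Step P sl C C') (hxm : mode C x = Mode.leader) (hx : str C' x = str C x) {v : V} {l : ℤ}
    (hne : sl ≠ 0 ∨ v ≠ loc C x)
    (h : ∃ s, mode C s = Mode.settled ∧ loc C s = v ∧ str C x ≤ str C s ∧
      (str C s = str C x → lst C s = l)) :
    ∃ s, mode C' s = Mode.settled ∧ loc C' s = v ∧ str C' x ≤ str C' s ∧
      (str C' s = str C' x → lst C' s = l) := by
  obtain ⟨s, h1, rfl, h3, h4⟩ := h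
  obtain ⟨h5, h6, h7⟩ := hG.settled_next hS h1
  refine ⟨s, h5, h6, hx ▸ h3.trans h7, fun h8 => ?_⟩
  rw [hx] at h8
  have h9 : str C s = str C x := le_antisymm (h8 ▸ h7) h3
  rw [← h4 h9]
  exact hG.lst_next_of_ne hid hS hxm h1 h9 (h8.trans h9.symm) hne

theorem Cover.next (hid : Function.Injective ident) (hG : Good ident sl C)
    (hG' : Good ident (sl + 1) C') (hS : Step P sl C C') (h : Cover (G := G) C x g)
    (hx' : mode C' x = Mode.leader) (hx : str C' x = str C x) (hw : g.w = loc C x)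
    (hwm : g.w ∈ g.R) : Cover (G := G) C' x g where
  covered v hv hvw := hG.covered_next hid hS (hG.dom_of_next hS hx').2.1 hx (Or.inr (hw ▸ hvw))
    (h.covered v hv hvw)
  labels s hs hsx := by
    rcases hG.label_next hid hG' hS hx' hs hsx with ⟨h1, h2, h3, -⟩ | h1
    · rw [h2]; exact h.labels s h1 h3
    · rw [h1, ← hw]
      exact hwm

theorem Ghost.stay (hid : Function.Injective ident) (hG : Good ident sl C)
    (hG' : Good ident (sl + 1) C') (hS : Step P sl C C') (h : Ghost P C x g)
    (hx' : mode C' x = Mode.leader) (hx : str C' x = str C x) (hl : loc C' x = loc C x)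
    (he : ein C' x = ein C x) : Ghost P C' x g :=
  { h.toCover.next hid hG hG' hS hx' hx h.w_eq h.valid.w_mem with
    valid := h.valid
    w_eq := h.w_eq.trans hl.symm
    last_w := h.last_w.trans he.symm }

/-- A raised strength is new, so only the node of `x` can carry it as a label, and the traversal
starts afresh. -/
theorem ghost_of_raise (hid : Function.Injective ident) (hG : Good ident sl C)
    (hG' : Good ident (sl + 1) C') (hS : Step P sl C C')
    (hx' : mode C' x = Mode.leader) (hx : str C' x ≠ str C x) (hl : loc C' x = loc C x) :
    Ghost P C' x (Traversal.start (loc C' x) (ein C' x)) where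
  covered v hv hvw := absurd (Finset.mem_singleton.1 hv) hvw
  labels s hs hsx := by
    rcases hG.label_next hid hG' hS hx' hs hsx with ⟨-, -, -, h⟩ | h
    · exact absurd h hx
    · rw [h, ← hl]; exact Finset.mem_singleton_self _
  valid := Traversal.start_valid P _ _
  w_eq := rfl
  last_w := Traversal.start_last _ _

/-- Every visited node is occupied: by `x` if it is current, otherwise by a settled agent. -/
theorem Ghost.card_le [Fintype A] (h : Ghost P C x g) : g.R.card ≤ Fintype.card A := by
  classical
  refine (Finset.card_le_card (t := Finset.univ.image (loc C)) fun v hv => ?_).trans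
    Finset.card_image_le
  by_cases hvw : v = g.w
  · exact Finset.mem_image.2 ⟨x, Finset.mem_univ _, (hvw.trans h.w_eq).symm⟩
  · obtain ⟨s, -, hs, -⟩ := h.covered v hv hvw
    exact Finset.mem_image.2 ⟨s, Finset.mem_univ _, hs⟩

/-- A leader with a minion has not explored the whole graph, as there is an agent for each node. -/
theorem Ghost.incomplete [Fintype A] (hG : G.Connected) (hcard : Fintype.card A ≤ Fintype.card V)
    (h : Ghost P C x g) (hxm : mode C x = Mode.leader)
    (hs : ∃ s, mode C s = Mode.settled ∧ loc C s = loc C x) : g.c g.w < G.degree g.w := by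
  classical
  refine lt_of_le_of_ne (h.valid.c_le _ h.valid.w_mem) fun hc => ?_
  have hall := h.valid.mem_of_complete hG hc
  have hsub : (Finset.univ : Finset V) ⊆ (Finset.univ.erase x).image (loc C) := by
    intro v _
    have : ∃ s, mode C s = Mode.settled ∧ loc C s = v := by
      by_cases hvw : v = g.w
      · rw [hvw, h.w_eq]; exact hs
      · obtain ⟨s, h1, h2, -⟩ := h.covered v (hall v) hvw
        exact ⟨s, h1, h2⟩
    obtain ⟨s, h1, h2⟩ := this
    exact Finset.mem_image.2 ⟨s, Finset.mem_erase.2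
      ⟨fun h => absurd (h ▸ h1) (mode_ne_settled_of_leader hxm), Finset.mem_univ _⟩, h2⟩
  have h1 := (Finset.card_le_card hsub).trans Finset.card_image_le
  rw [Finset.card_erase_of_mem (Finset.mem_univ _), Finset.card_univ, Finset.card_univ] at h1
  have : 0 < Fintype.card A := Fintype.card_pos_iff.2 ⟨x⟩
  omega

/-- The leader `x` has explored at least `N` ports since its last increase of level. -/
def Explored (P : PortLabelling G) (C : Config Mem A V) (x : A) (N : ℕ) : Prop :=
  ∃ g, Ghost P C x g ∧ N ≤ g.total

/-- In slot `1`, the leader `x` has explored at least `N` ports since its last increase of level,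
including the port through which it has just moved. -/
def SemiExplored (P : PortLabelling G) (C : Config Mem A V) (x : A) (N : ℕ) : Prop :=
  ∃ g, (Ghost P C x g ∧ N ≤ g.total ∧
      ∀ s, mode C s = Mode.settled → loc C s = loc C x → str C s = str C x ∧ lst C s = ein C x) ∨
    (Moved P C x g ∧ N ≤ g.total + 1)

/-- A raise resets the count, so a positive count is kept only under unchanged strength; the count
`0` merely says that a ghost traversal exists. -/
theorem Calm.explored_next (hid : Function.Injective ident) (hC : Calm P ident sl C)
    (hS : Step P sl C C') (hsl : sl ≠ 0) (hx' : mode C' x = Mode.leader) :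
    (Explored P C x 0 → Explored P C' x 0) ∧
      (str C' x = str C x → ∀ N, Explored P C x N → Explored P C' x N) := by
  have hd := hC.toGood.dom_of_next hS hx'
  obtain ⟨h1, -, -, h2⟩ := hC.leader_stays hid hS hsl hd
  have hG' := hC.good_next hid hS
  by_cases h : str C' x = str C x
  · have key : ∀ N, Explored P C x N → Explored P C' x N := fun N ⟨g, hg, hN⟩ =>
      ⟨g, hg.stay hid hC.toGood hG' hS hx' h h1 h2, hN⟩
    exact ⟨key 0, fun _ => key⟩
  · exact ⟨fun _ => ⟨_, ghost_of_raise hid hC.toGood hG' hS hx' h h1, Nat.zero_le _⟩,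
      fun h' => absurd h' h⟩

theorem Calm.semiExplored_next [Fintype A] (hid : Function.Injective ident)
    (hconn : G.Connected) (hcard : Fintype.card A ≤ Fintype.card V)
    (hdeg : ∀ v, 0 < G.degree v) (hC : Calm P ident 0 C)
    (hS : Step P 0 C C') (hx' : mode C' x = Mode.leader) :
    (Explored P C x 0 → SemiExplored P C' x 0) ∧ (str C' x = str C x →
      (∃ s, mode C s = Mode.settled ∧ loc C s = loc C x) → ∀ N, Explored P C x N →
        SemiExplored P C' x (N + 1)) := by
  have hd := hC.toGood.dom_of_next hS hx'
  have hG' : Good ident 1 C' := hC.good_next hid hS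
  obtain ⟨-, -, ⟨h1, h2, h3, h4⟩ | ⟨h1, h2, s, h3, h4, h5, h6, h7, h8, h9, h10, h11, h12⟩⟩ :=
    hC.dom_next hid hdeg hS hd
  · by_cases h : str C' x = str C x
    · refine ⟨fun ⟨g, hg, hN⟩ => ⟨g, Or.inl ⟨hg.stay hid hC.toGood hG' hS hx' h h1 h2, hN,
          fun s hs hsl => h4 s hs (hsl.trans h1)⟩⟩, ?_⟩
      -- Without a raise, the settled agent is an up-to-date minion. Slot `0` then makes the leader
      -- leave through a genuine port, so it cannot have stayed.
      rintro - ⟨s, hs, hsl⟩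
      exfalso
      rcases hC.toGood.node_step hS (a := x) rfl with
        ⟨y, hy, h5, -⟩ | ⟨y, t, q, hy, h5⟩ | ⟨t, q, hy, -⟩
      · rw [h5 s hsl, ← h5 x rfl, hd.2.1] at hs; cases hs
      · obtain rfl := hd.unique hid hC.toBase hy
        obtain rfl := h5.uniq s hsl hs
        obtain ⟨h6, h7⟩ := hC.label _ _ _ hd hs hsl
        rcases h5.out with ⟨-, -, h8⟩ | ⟨-, -, ⟨h8, -⟩ | ⟨-, -, h8, h9⟩ | ⟨-, h8, -⟩⟩
        · exact h8 hs (h6.trans h.symm)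
        · exact h8 h7
        · have hp : IsPort G (loc C x) q := by rw [h8]; exact Traversal.isPort_emod (hdeg _) _
          have := (travel_spec P hp).1.ne
          rw [← h5.x_loc hd, h1] at this
          exact this rfl
        · exact h8 rfl
      · exact hy ⟨x, hd⟩
    · exact ⟨fun _ => ⟨_, Or.inl ⟨ghost_of_raise hid hC.toGood hG' hS hx' h h1, Nat.zero_le _,
        fun s hs hsl => h4 s hs (hsl.trans h1)⟩⟩, fun h' => absurd h' h⟩
  · have key : ∀ g, Ghost P C x g → Moved P C' x g := by
      intro g hg
      have hl : (g.last G g.w + 1) % (G.degree g.w : ℤ) = lst C' s := by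
        rw [h9, hg.last_w, hg.w_eq]
      exact { hg.toCover.next hid hC.toGood hG' hS hx' h1 hg.w_eq hg.valid.w_mem with
        valid := hg.valid
        incomplete := hg.incomplete hconn hcard hd.2.1 ⟨s, h3, h4⟩
        ne := by rw [hg.w_eq]; exact h2
        minion := ⟨s, h6, h7.trans hg.w_eq.symm, h8, hl.symm⟩
        move := by rw [hl, hg.w_eq]; exact h10 }
    exact ⟨fun ⟨g, hg, hN⟩ => ⟨g, Or.inr ⟨key g hg, Nat.zero_le _⟩⟩,
      fun _ _ N ⟨g, hg, hN⟩ => ⟨g, Or.inr ⟨key g hg, Nat.succ_le_succ hN⟩⟩⟩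

/-- For a leader that has moved and is not raised, the three transitions of the traversal appear:
staying at a visited node is `Valid.return`, staying at an unvisited one is `Valid.discover`, and
leaving is `Valid.backtrack`. -/
theorem Semi.explored_next (hid : Function.Injective ident) (hC : Semi P ident C)
    (hS : Step P 1 C C') (hx' : mode C' x = Mode.leader) (hx : ∃ N, SemiExplored P C x N) :
    Explored P C' x 0 ∧
      (str C' x = str C x → ∀ N, SemiExplored P C x N → Explored P C' x N) := by
  classical
  have hd := hC.toGood.dom_of_next hS hx'
  have hG' : Good ident 2 C' := hC.good_next hid hS
  suffices h : (Explored P C' x 0 ∧ str C' x ≠ str C x) ∨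
      ∀ N, SemiExplored P C x N → Explored P C' x N by
    rcases h with ⟨h1, h2⟩ | h
    · exact ⟨h1, fun h => absurd h h2⟩
    · obtain ⟨N, hN⟩ := hx
      obtain ⟨g, hg, -⟩ := h N hN
      exact ⟨⟨g, hg, Nat.zero_le _⟩, fun _ => h⟩
  have hcov : ∀ {g : Traversal V}, str C' x = str C x → Cover (G := G) C x g → ∀ v ∈ g.R,
      v ≠ g.w → ∃ s, mode C' s = Mode.settled ∧ loc C' s = v ∧ str C' x ≤ str C' s ∧
      (str C' s = str C' x → lst C' s = g.last G v) := fun h hg v hv hvw =>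
    hC.toGood.covered_next hid hS hd.2.1 h (Or.inl (by decide)) (hg.covered v hv hvw)
  have hlab : ∀ {g : Traversal V}, Cover (G := G) C x g → ∀ s, mode C' s = Mode.settled →
      str C' s = str C' x → loc C' s ∈ g.R ∨ loc C' s = loc C x := fun hg s hs hsx => by
    rcases hC.toGood.label_next hid hG' hS hx' hs hsx with ⟨e1, e2, e3, -⟩ | e1
    · exact Or.inl (e2 ▸ hg.labels s e1 e3)
    · exact Or.inr e1
  obtain ⟨-, -, ⟨h1, h2, h3, h4⟩ |
    ⟨h1, h2, v, s, t, h3, h4, h5, h6, h7, h8, h9, h10, h11, h12, h13, h14, h15, -⟩⟩ :=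
    hC.dom_next hid hS hd
  · by_cases h : str C' x = str C x
    · right
      rintro N ⟨g, ⟨hg, hN, -⟩ | ⟨hg, hN⟩⟩
      · exact ⟨g, hg.stay hid hC.toGood hG' hS hx' h h1 h2, hN⟩
      · by_cases hu : loc C x ∈ g.R
        · obtain ⟨t, e1, e2, e3, e4⟩ := hg.covered _ hu hg.ne
          -- At a visited node, `covered` bounds the label from below and dominance bounds it from
          -- above, so it is the label of `x`. As `x` stays, the pointer agrees with the incoming
          -- port.
          have e5 : str C t = str C x := le_antisymm (hd.2.2 t e2) e3
          obtain ⟨e6, e7, -⟩ := hC.toGood.settled_next hS e1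
          obtain ⟨e8, e9⟩ := h4 t e6 (e7.trans e2)
          have e10 : g.last G (loc C x) = ein C x := by
            rw [← e4 e5, ← h2, ← e9]
            exact (hC.toGood.lst_next hS (by decide) e1 (e8.trans (h.trans e5.symm))).symm
          refine ⟨g.advance (loc C x),
            { valid := hg.valid.return hg.incomplete hg.move hu e10
              w_eq := h1.symm
              last_w := ?_
              covered := ?_
              labels := fun s hs hsx => (hlab hg.toCover s hs hsx).elim (fun h => h)
                fun h => h ▸ hu }, ?_⟩
          · intro v hv hvw
            by_cases hvw' : v = g.w
            · rw [hvw', Traversal.last_advance_self]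
              obtain ⟨s, f1, f2, f3, f4⟩ := hg.minion
              exact hC.toGood.covered_next hid hS hd.2.1 h (Or.inl (by decide))
                ⟨s, f1, f2, f3.ge, fun _ => f4⟩
            · rw [Traversal.last_advance_of_ne hvw']
              exact hcov h hg.toCover v hv hvw'
          · change (g.advance (loc C x)).last G (loc C x) = _
            rw [Traversal.last_advance_of_ne hg.ne, e10, h2]
          · rw [Traversal.total_advance hg.valid.w_mem]; exact hN
        · obtain ⟨k1, k2, k3, k4, k5⟩ := hg.valid.discover hg.incomplete hg.move hu
          refine ⟨g.discover (loc C x) (ein C x),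
            { valid := k1
              w_eq := h1.symm
              last_w := k3.trans h2.symm
              covered := ?_
              labels := fun s hs hsx => ?_ }, k2 ▸ hN⟩
          · intro v hv hvw
            rcases Finset.mem_insert.1 hv with rfl | hv
            · exact absurd rfl hvw
            by_cases hvw' : v = g.w
            · rw [hvw', k4]
              obtain ⟨s, f1, f2, f3, f4⟩ := hg.minion
              exact hC.toGood.covered_next hid hS hd.2.1 h (Or.inl (by decide))
                ⟨s, f1, f2, f3.ge, fun _ => f4⟩
            · rw [k5 v hv hvw']
              exact hcov h hg.toCover v hv hvw'
          · rcases hlab hg.toCover s hs hsx with h | h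
            · exact Finset.mem_insert_of_mem h
            · rw [h]; exact Finset.mem_insert_self _ _
    · exact Or.inl ⟨⟨_, ghost_of_raise hid hC.toGood hG' hS hx' h h1, Nat.zero_le _⟩, h⟩
  · right
    rintro N ⟨g, ⟨hg, hN, hg'⟩ | ⟨hg, hN⟩⟩
    · exact absurd (hg' t h10 h11).2 h14
    -- Backtracking presupposes a label of `x` at the node, and such labels occur at visited nodes
    -- only.
    · have hu : loc C x ∈ g.R := h11 ▸ hg.labels t h10 h12
      obtain ⟨t', e1, e2, e3, e4⟩ := hg.covered _ hu hg.ne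
      obtain rfl := hC.settled_unique t t' h10 e1 (h11.trans e2.symm)
      have hport := Traversal.isPort_emod (G := G) (v := g.w)
        (lt_of_le_of_lt (Nat.zero_le _) hg.incomplete) (g.last G g.w + 1)
      have hback := (travel_back P hport hg.move).2.2
      rw [h9, Prod.mk.injEq] at hback
      obtain ⟨b1, b2⟩ := hback
      refine ⟨g.advance g.w,
        { valid := hg.valid.backtrack hg.incomplete hg.move hu (by rw [← e4 h12]; exact h14)
          w_eq := b1.symm.trans h3
          last_w := ?_
          covered := ?_
          labels := fun s hs hsx => (hlab hg.toCover s hs hsx).elim (fun h => h)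
            fun h => h ▸ hu }, ?_⟩
      · intro v hv hvw
        have hvw' : v ≠ g.w := hvw
        rw [Traversal.last_advance_of_ne hvw']
        exact hcov h1 hg.toCover v hv hvw'
      · change (g.advance g.w).last G g.w = _
        rw [Traversal.last_advance_self, ← b2, h8]
      · rw [Traversal.total_advance hg.valid.w_mem]; exact hN

variable {C₂ C₃ C₄ C₅ C₆ : Config Mem A V}

/-- The leaders at the end of a cycle are leaders during the cycle. -/
theorem Cycle.leader (hc : Cycle P ident C₂ C₃ C₄ C₅ C₆) (hx : mode C₆ x = Mode.leader) :
    mode C₂ x = Mode.leader ∧ mode C₃ x = Mode.leader ∧ mode C₄ x = Mode.leader ∧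
      mode C₅ x = Mode.leader := by
  have h5 := (hc.semi₅.toGood.dom_of_next hc.step₅ hx).2.1
  have h4 := (hc.calm₄.toGood.dom_of_next hc.step₄ h5).2.1
  have h3 := (hc.calm₃.toGood.dom_of_next hc.step₃ h4).2.1
  exact ⟨(hc.calm₂.toGood.dom_of_next hc.step₂ h3).2.1, h3, h4, h5⟩

theorem Cycle.str_le (hc : Cycle P ident C₂ C₃ C₄ C₅ C₆) (hx : mode C₆ x = Mode.leader) :
    str C₂ x ≤ str C₃ x ∧ str C₃ x ≤ str C₄ x ∧ str C₄ x ≤ str C₅ x ∧ str C₅ x ≤ str C₆ x := by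
  obtain ⟨-, h3, h4, h5⟩ := hc.leader hx
  exact ⟨(hc.calm₂.toGood.str_le_next hc.step₂ (mode_ne_settled_of_leader h3)).1,
    (hc.calm₃.toGood.str_le_next hc.step₃ (mode_ne_settled_of_leader h4)).1,
    (hc.calm₄.toGood.str_le_next hc.step₄ (mode_ne_settled_of_leader h5)).1,
    (hc.semi₅.toGood.str_le_next hc.step₅ (mode_ne_settled_of_leader hx)).1⟩

/-- In each cycle, a leader that does not raise its level and has a minion explores a port. -/
theorem Cycle.explored [Fintype A] (hid : Function.Injective ident)
    (hconn : G.Connected) (hcard : Fintype.card A ≤ Fintype.card V)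
    (hdeg : ∀ v, 0 < G.degree v) (hc : Cycle P ident C₂ C₃ C₄ C₅ C₆)
    (hx : mode C₆ x = Mode.leader) (h0 : Explored P C₂ x 0) :
    Explored P C₆ x 0 ∧ (str C₆ x = str C₂ x → ∀ N, Explored P C₂ x N →
      (∃ s, mode C₄ s = Mode.settled ∧ loc C₄ s = loc C₄ x) → Explored P C₆ x (N + 1)) := by
  obtain ⟨-, h3, h4, h5⟩ := hc.leader hx
  obtain ⟨l2, l3, l4, l5⟩ := hc.str_le hx
  have e3 := hc.calm₂.explored_next hid hc.step₂ (by decide) h3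
  have e4 := hc.calm₃.explored_next hid hc.step₃ (by decide) h4
  have e5 := hc.calm₄.semiExplored_next hid hconn hcard hdeg hc.step₄ h5
  have z5 := e5.1 (e4.1 (e3.1 h0))
  obtain ⟨z6, e6⟩ := hc.semi₅.explored_next hid hc.step₅ hx ⟨0, z5⟩
  refine ⟨z6, fun hstr N hN hs => ?_⟩
  have h₂₃ := le_antisymm ((l3.trans (l4.trans l5)).trans hstr.le) l2
  have h₃₄ := le_antisymm (((l4.trans l5).trans hstr.le).trans l2) l3
  have h₄₅ := le_antisymm ((l5.trans hstr.le).trans (l2.trans l3)) l4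
  have h₅₆ := le_antisymm (hstr.le.trans (l2.trans (l3.trans l4))) l5
  exact e6 h₅₆ _ (e5.2 h₄₅ hs N (e4.2 h₃₄ N (e3.2 h₂₃ N hN)))

end Ghosts

/-! ### The weight argument bounding the levels -/

section Levels

variable {A V : Type*} [Fintype V] {G : SimpleGraph V} [DecidableRel G.Adj] [Fintype A]
  {P : PortLabelling G} {ident : A → ℕ} {sl sl' : Fin 4} {C C' C'' : Config Mem A V}

/-- The agents that are not settled leave their node together. -/
theorem Good.move_together (hG : Good ident sl C) (hS : Step P sl C C') {a b : A}
    (h : loc C a = loc C b) (ha : mode C' a ≠ Mode.settled) (hb : mode C' b ≠ Mode.settled) :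
    loc C' a = loc C' b := by
  rcases hG.node_step hS (a := b) rfl with
    ⟨y, hy, h1, -⟩ | ⟨y, t, q, hy, h1⟩ | ⟨t, q, hy, h1, h2⟩
  · rw [h1 a h, h1 b rfl]
  · rw [h1.move a h (by rintro rfl; exact ha h1.mode_s),
      h1.move b rfl (by rintro rfl; exact hb h1.mode_s)]
  · rw [(h1.move a h (by rintro rfl; exact ha h1.mode_s')).1,
      (h1.move b rfl (by rintro rfl; exact hb h1.mode_s')).1]

/-- The level of a leader exceeds the levels of the zombies that move with it. -/
theorem Good.lvl_lt_leader (hid : Function.Injective ident) (hG : Good ident sl C)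
    (hS : Step P sl C C') {x z : A} (hx : mode C' x = Mode.leader) (hzx : z ≠ x)
    (h : loc C z = loc C x) (hz : mode C' z ≠ Mode.settled) : lvl C' z < lvl C' x := by
  have hd := hG.dom_of_next hS hx
  rcases hG.node_step hS (a := x) rfl with
    ⟨y, hy, h1, -⟩ | ⟨y, t, q, hy, h1⟩ | ⟨t, q, hy, -⟩
  · exact absurd ((h1 z h).trans (h1 x rfl).symm) hzx
  · obtain rfl := hd.unique hid hG.toBase hy
    have hzt : z ≠ t := by rintro rfl; exact hz h1.mode_s
    rw [lvl, lvl, (h1.zombie z h hzt hzx).2]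
    have hle := level_le_of_le (hd.2.2 z h)
    rcases h1.raise with ⟨h2, -⟩ | ⟨h2, h3⟩
    · rw [h2]; exact Nat.lt_succ_of_le hle
    · rw [h2]
      exact lt_of_le_of_ne hle (h3 z h hzx (hG.unsettled_of_next hS hz))
  · exact absurd ⟨x, hd⟩ hy

/-- If the level of an agent increases, there is another agent of the same level at its node. -/
theorem Good.lvl_next (hG : Good ident sl C) (hS : Step P sl C C') {a : A}
    (ha : mode C' a ≠ Mode.settled) : lvl C' a = lvl C a ∨
      (mode C a = Mode.leader ∧ lvl C' a = lvl C a + 1 ∧ ∃ z, loc C z = loc C a ∧ z ≠ a ∧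
        mode C z ≠ Mode.settled ∧ lvl C z = lvl C a) := by
  rcases hG.node_step hS (a := a) rfl with
    ⟨y, hy, h1, -, -, h2, -⟩ | ⟨y, t, q, hy, h1⟩ | ⟨t, q, hy, h1, h2⟩
  · left; rw [h1 a rfl, lvl, h2]; rfl
  · have hat : a ≠ t := by rintro rfl; exact ha h1.mode_s
    by_cases hay : a = y
    · subst hay
      rcases h1.raise with ⟨h2, h3⟩ | ⟨h2, -⟩
      · exact Or.inr ⟨hy.2.1, by rw [lvl, h2]; rfl, h3⟩
      · left; rw [lvl, h2]; rfl
    · left; rw [lvl, (h1.zombie a rfl hat hay).2]; rfl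
  · have hat : a ≠ t := by rintro rfl; exact ha h1.mode_s'
    left; rw [lvl, (h1.move a rfl hat).2.2]; rfl

open Classical in
/-- The weight of the group of agents that are at `v` and not settled after the actions in `v`. -/
noncomputable def weight (C C' : Config Mem A V) (v : V) : ℕ :=
  (Finset.univ.filter fun a => loc C a = v ∧ mode C' a ≠ Mode.settled).sup fun a => 2 ^ lvl C' a

theorem le_weight {a : A} (ha : mode C' a ≠ Mode.settled) :
    2 ^ lvl C' a ≤ weight C C' (loc C a) := by
  classical
  exact Finset.le_sup (f := fun a => 2 ^ lvl C' a) (by simp [ha])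

theorem weight_le {v : V} {n : ℕ}
    (h : ∀ a, loc C a = v → mode C' a ≠ Mode.settled → 2 ^ lvl C' a ≤ n) :
    weight C C' v ≤ n := by
  classical
  refine Finset.sup_le fun a ha => ?_
  simp only [Finset.mem_filter, Finset.mem_univ, true_and] at ha
  exact h a ha.1 ha.2

/-- The total weight of the groups does not increase: when two groups merge and a level is raised,
it is raised by one, and both groups have a member of this level. -/
theorem Good.sum_weight_le (hid : Function.Injective ident) (hG : Good ident sl C)
    (hG' : Good ident sl' C') (hS : Step P sl C C') (hS' : Step P sl' C' C'') :
    ∑ v, weight C' C'' v ≤ ∑ v, weight C C' v := by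
  classical
  -- Each group has a single destination `f u`, so the new groups are compared with the fibres of
  -- `f`.
  have hf : ∀ u, ∃ v, ∀ a, loc C a = u → mode C' a ≠ Mode.settled → loc C' a = v := by
    intro u
    by_cases h : ∃ a, loc C a = u ∧ mode C' a ≠ Mode.settled
    · obtain ⟨a, ha, hs⟩ := h
      exact ⟨loc C' a, fun b hb hbs => hG.move_together hS (hb.trans ha.symm) hbs hs⟩
    · push Not at h
      exact ⟨u, fun a ha hs => absurd (h a ha) hs⟩
  choose f hf using hf
  rw [← Finset.sum_fiberwise (s := Finset.univ) f (fun v => weight C C' v)]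
  refine Finset.sum_le_sum fun v _ => weight_le fun a ha hs => ?_
  have hmem : ∀ b, loc C' b = v → mode C' b ≠ Mode.settled →
      loc C b ∈ Finset.univ.filter fun u => f u = v := by
    intro b hb hbs
    simp only [Finset.mem_filter, Finset.mem_univ, true_and]
    rw [← hf _ b rfl hbs, hb]
  have hs' := hG'.unsettled_of_next hS' hs
  rcases hG'.lvl_next hS' hs with h | ⟨h1, h2, z, h3, h4, h5, h6⟩
  · rw [h]
    exact (le_weight hs').trans (Finset.single_le_sum (f := fun v => weight C C' v)
      (fun _ _ => Nat.zero_le _) (hmem a ha hs'))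
  -- Within one group the level of the leader is strictly highest, so `z` comes from a different
  -- group.
  · have hne : loc C a ≠ loc C z := by
      intro h
      have := hG.lvl_lt_leader hid hS h1 h4 h.symm h5
      omega
    rw [h2, pow_succ, mul_two]
    calc 2 ^ lvl C' a + 2 ^ lvl C' a
        ≤ weight C C' (loc C a) + weight C C' (loc C z) :=
          Nat.add_le_add (le_weight hs') (h6 ▸ le_weight h5)
      _ = ∑ u ∈ {loc C a, loc C z}, weight C C' u := (Finset.sum_pair hne).symm
      _ ≤ _ := Finset.sum_le_sum_of_subset (by
          intro u hu
          rw [Finset.mem_insert, Finset.mem_singleton] at hu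
          rcases hu with rfl | rfl
          · exact hmem a ha hs'
          · exact hmem z (h3.trans ha) h5)

/-- Labels are copied from leaders, so level bounds for unsettled agents pass to settled ones. -/
theorem Good.lvl_settled_next (hG : Good ident sl C) (hS : Step P sl C C') {s : A}
    (hs : mode C' s = Mode.settled) :
    (∃ x, mode C' x ≠ Mode.settled ∧ lvl C' s = lvl C' x) ∨ lvl C' s = lvl C s := by
  rcases hG.node_step hS (a := s) rfl with
    ⟨y, hy, h4, h5, h7, h6, -⟩ | ⟨y, t, q, hy, h4⟩ | ⟨t, q, hy, h4, h6⟩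
  · rw [h4 s rfl, h7] at hs; cases hs
  · left
    refine ⟨y, mode_ne_settled_of_leader h4.mode_x, ?_⟩
    by_cases hst : s = t
    · rw [hst, lvl, h4.str_s]; rfl
    by_cases hsy : s = y
    · rw [hsy]
    · rw [(h4.zombie s rfl hst hsy).1] at hs; cases hs
  · right
    by_cases hst : s = t
    · rw [hst, lvl, h4.str_s]; rfl
    · rw [lvl, (h4.move s rfl hst).2.2]; rfl

variable (ch : ZombieChoice) (P) (hid : Function.Injective ident)
  (hdeg : ∀ v, 0 < G.degree v) (place : A → V)

include hid hdeg in
theorem run_good (t : ℕ) : ∃ sl, Good ident sl (run ch P ident place t) := by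
  rcases Nat.lt_or_ge t 2 with h | h
  · interval_cases t
    · exact ⟨0, (initial_calm ch P place).toGood⟩
    · exact ⟨1, (run_semi P ch hid hdeg place 0).toGood⟩
  · obtain ⟨i, r, hr, rfl⟩ : ∃ i r, r < 4 ∧ t = 4 * i + 2 + r :=
      ⟨(t - 2) / 4, (t - 2) % 4, Nat.mod_lt _ (by norm_num), by omega⟩
    have hc := run_cycle P ch hid hdeg place i
    interval_cases r
    · exact ⟨_, hc.calm₂.toGood⟩
    · exact ⟨_, hc.calm₃.toGood⟩
    · exact ⟨_, hc.calm₄.toGood⟩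
    · exact ⟨_, hc.semi₅.toGood⟩

include hid hdeg in
-- At first there is at most one group per occupied node, and the first step raises levels to at
-- most `1`; hence the factor `2`.
theorem run_sum_weight_le (t : ℕ) :
    ∑ v, weight (run ch P ident place t) (run ch P ident place (t + 1)) v ≤
      2 * occupied place := by
  classical
  induction t with
  | zero =>
    have hG := (initial_calm ch P place (ident := ident)).toGood
    have hS := run_step P ch hid place 0 hG.toBase
    calc ∑ v, weight (run ch P ident place 0) (run ch P ident place 1) v
        ≤ ∑ v, if v ∈ Set.range place then 2 else 0 := by
          refine Finset.sum_le_sum fun v _ => weight_le fun a ha hs => ?_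
          rw [if_pos ⟨a, ha⟩]
          have h0 : lvl (run ch P ident place 0) a = 0 := rfl
          have : lvl (run ch P ident place 1) a ≤ 1 := by
            rcases hG.lvl_next hS hs with h | ⟨-, h, -⟩
            · exact h.trans_le (h0.trans_le zero_le_one)
            · exact h.trans_le (Nat.succ_le_succ h0.le)
          exact (Nat.pow_le_pow_right (by norm_num) this).trans (by norm_num)
      _ = 2 * occupied place := by
          rw [← Finset.sum_filter, Finset.sum_const, smul_eq_mul, mul_comm, occupied,
            Set.ncard_eq_toFinset_card']
          congr 2
          ext v
          simp
  | succ t ih =>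
    obtain ⟨sl, hG⟩ := run_good P ch hid hdeg place t
    obtain ⟨sl', hG'⟩ := run_good P ch hid hdeg place (t + 1)
    exact (hG.sum_weight_le hid hG' (run_step P ch hid place t hG.toBase)
      (run_step P ch hid place (t + 1) hG'.toBase)).trans ih

include hid hdeg in
/-- The levels are at most logarithmic in the number of nodes that are occupied initially. -/
theorem two_pow_lvl_le (t : ℕ) (a : A) :
    2 ^ lvl (run ch P ident place t) a ≤ 2 * occupied place := by
  have hns : ∀ t a, mode (run ch P ident place (t + 1)) a ≠ Mode.settled →
      2 ^ lvl (run ch P ident place (t + 1)) a ≤ 2 * occupied place := fun t a ha =>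
    (le_weight ha).trans ((Finset.single_le_sum
      (f := fun v => weight (run ch P ident place t) (run ch P ident place (t + 1)) v)
      (fun _ _ => Nat.zero_le _) (Finset.mem_univ _)).trans
      (run_sum_weight_le P ch hid hdeg place t))
  induction t generalizing a with
  | zero =>
    have : 0 < occupied place := (Set.ncard_pos (Set.toFinite _)).2 ⟨place a, a, rfl⟩
    change 1 ≤ _
    omega
  | succ t ih =>
    by_cases ha : mode (run ch P ident place (t + 1)) a = Mode.settled
    · obtain ⟨sl, hG⟩ := run_good P ch hid hdeg place t
      rcases hG.lvl_settled_next (run_step P ch hid place t hG.toBase) ha with ⟨x, h1, h2⟩ | h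
      · rw [h2]; exact hns t x h1
      · rw [h]; exact ih a
    · exact hns t a ha

end Levels

/-! ### Paths to a sink and their length -/

section PathLength

variable {A V : Type*} [Fintype V] {G : SimpleGraph V} [DecidableRel G.Adj]
  {P : PortLabelling G} {C C' : Config Mem A V}

/-- Along a shortest path the remaining distance strictly decreases, so its settled agents are
distinct. `S` collects them. -/
theorem Path.exists_card {mid : ℕ ×ₗ ℕ → Prop} {T : V → Prop} {v : V} {b : ℕ}
    (h : Path P C mid (fun v _ => T v) v b)
    (hmin : ∀ b' < b, ¬ Path P C mid (fun v _ => T v) v b') :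
    ∃ S : Finset A, S.card = b ∧ ∀ s ∈ S, ∃ b' ≤ b, Path P C mid (fun v _ => T v) (loc C s) b' ∧
      ∀ b'' < b', ¬ Path P C mid (fun v _ => T v) (loc C s) b'' := by
  classical
  induction h with
  | @term v b h =>
    have : b = 0 := by
      by_contra hb
      exact hmin 0 (Nat.pos_of_ne_zero hb) (.term h)
    exact ⟨∅, by simp [this], by simp⟩
  | @step s b hs hm h ih =>
    obtain ⟨S, hS, hS'⟩ := ih fun b' hb' h' => hmin (b' + 1) (by omega) (.step hs hm h')
    refine ⟨insert s S, ?_, ?_⟩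
    · rw [Finset.card_insert_of_notMem, hS]
      intro hsS
      obtain ⟨b', hb', h', -⟩ := hS' s hsS
      exact hmin b' (by omega) h'
    · intro t ht
      rcases Finset.mem_insert.1 ht with rfl | ht
      · exact ⟨b + 1, le_rfl, .step hs hm h, hmin⟩
      · obtain ⟨b', hb', h'⟩ := hS' t ht
        exact ⟨b', by omega, h'⟩

/-- A path to a node that satisfies `T` can be shortened such that it passes each agent once. -/
theorem Path.exists_le [Fintype A] {mid : ℕ ×ₗ ℕ → Prop} {T : V → Prop} {v : V} {b : ℕ}
    (h : Path P C mid (fun v _ => T v) v b) :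
    ∃ b' ≤ Fintype.card A, Path P C mid (fun v _ => T v) v b' := by
  classical
  have hex : ∃ b, Path P C mid (fun v _ => T v) v b := ⟨b, h⟩
  obtain ⟨S, hS, -⟩ := (Nat.find_spec hex).exists_card fun b' hb' => Nat.find_min hex hb'
  exact ⟨Nat.find hex, hS ▸ Finset.card_le_univ S, Nat.find_spec hex⟩

/-- A node with a label of level above `j` or a leader of level at least `j`. -/
def Sink (j : ℕ) (C : Config Mem A V) (v : V) : Prop :=
  (∃ a, loc C a = v ∧ mode C a ≠ Mode.zombie ∧ (atLevel j).hi (str C a)) ∨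
  ∃ x, loc C x = v ∧ mode C x = Mode.leader ∧ (atLevel j).mid (str C x)

/-- Concatenate the paths of `Calm.reach`: each ends at a leader or beside a strictly stronger
non-zombie, so the number of agents stronger than the current label decreases. -/
theorem Calm.exists_path [Finite A] {ident : A → ℕ} {sl : Fin 4} (hC : Calm P ident sl C) {j : ℕ}
    {s : A} (hs : mode C s = Mode.settled) (hj : j ≤ lvl C s) :
    ∃ b, Path P C (atLevel j).mid (fun v _ => Sink j C v) (loc C s) b := by
  induction hn : {a | str C s < str C a}.ncard using Nat.strong_induction_on generalizing s with
  | _ n ih =>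
    have hstep : ∀ a, mode C a ≠ Mode.zombie → str C s < str C a →
        ∃ b, Path P C (atLevel j).mid (fun v _ => Sink j C v) (loc C a) b := by
      intro a ha hlt
      have hja : j ≤ lvl C a := hj.trans (level_le_of_le hlt.le)
      rcases hm : mode C a with _ | _ | _
      · exact ⟨0, .term (Or.inr ⟨a, rfl, hm, hja⟩)⟩
      · exact absurd hm ha
      · refine ih _ ?_ hm hja rfl
        rw [← hn]
        refine Set.ncard_lt_ncard ⟨fun c hc => hlt.trans hc, fun h => ?_⟩ (Set.toFinite _)
        exact lt_irrefl (str C a) (h hlt)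
    obtain ⟨b, hp⟩ := hC.reach s hs
    generalize loc C s = v at hp ⊢
    induction hp with
    | @term v b h =>
      rcases h with ⟨a, rfl, h2, h3⟩ | ⟨x, rfl, h2, h3, -⟩ | ⟨z, rfl, h2, h3, -⟩
      · exact hstep a h2 h3
      · exact ⟨0, .term (Or.inr ⟨x, rfl, h2, hj.trans (level_le_of_le h3)⟩)⟩
      · obtain ⟨a, h4, h5, h6⟩ := hC.zombie_lt z h2
        rw [← h4]
        exact hstep a h5 (lt_of_le_of_lt h3 h6)
    | @step t b ht hm h ih' =>
      obtain ⟨b', hb'⟩ := ih'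
      exact ⟨b' + 1, .step ht (hj.trans (level_le_of_le hm)) hb'⟩

end PathLength

/-! ### Passing from one level to the next: the effect of single steps -/

section Phases

variable {A V : Type*} [Fintype V] {G : SimpleGraph V} [DecidableRel G.Adj] [Finite A]
  {P : PortLabelling G} {ident : A → ℕ} {sl sl' : Fin 4} {C C' : Config Mem A V} {j : ℕ}

/-- A step between configurations that satisfy the invariants. -/
structure Link (P : PortLabelling G) (ident : A → ℕ) (sl : Fin 4) (C C' : Config Mem A V) :
    Prop where
  good : Good ident sl C
  good' : Good ident (sl + 1) C'
  step : Step P sl C C'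
  chase : sl = 2 ∨ sl = 3 → ∀ v s, loc C s = v → mode C s = Mode.settled →
    (¬ ∃ x, Dom C v x) → ∃ b, loc C b = (travel P v (lst C s)).1 ∧ mode C b ≠ Mode.zombie ∧
      str C s ≤ str C b

theorem Calm.link (hid : Function.Injective ident) (hC : Calm P ident sl C)
    (hS : Step P sl C C') : Link P ident sl C C' :=
  ⟨hC.toGood, hC.good_next hid hS, hS, fun _ _ _ h1 h2 h3 => hC.target h1 h2 h3⟩

theorem Semi.link (hid : Function.Injective ident) (hC : Semi P ident C)
    (hS : Step P 1 C C') : Link P ident 1 C C' :=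
  ⟨hC.toGood, hC.good_next hid hS, hS, fun h => absurd h (by decide)⟩

/-- Zombies that follow a pointer find an agent that is at least as strong as the label of the node
that they have left. -/
theorem Link.target (hL : Link P ident sl C C') {v : V} {s : A} {q : ℤ} (hx : ¬ ∃ x, Dom C v x)
    (h : SetStep P sl C C' v s q) :
    ∃ b, loc C' b = (travel P v q).1 ∧ mode C' b ≠ Mode.zombie ∧ str C s ≤ str C' b := by
  rcases h.q_cases with hq | hq
  · rw [hq, travel_neg_one]
    exact ⟨s, h.loc_s', by rw [h.mode_s']; decide, h.str_s.ge⟩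
  · by_cases hsl : sl = 2 ∨ sl = 3
    · obtain ⟨b, h1, h2, h3⟩ := hL.chase hsl v s h.loc_s h.mode_s hx
      obtain ⟨b', h4, h5, h6⟩ := hL.good.keep hL.step h2
      exact ⟨b', by rw [h4, h1, hq], h5, h3.trans h6⟩
    · push Not at hsl
      rw [h.stay hsl.1 hsl.2, travel_neg_one]
      exact ⟨s, h.loc_s', by rw [h.mode_s']; decide, h.str_s.ge⟩

/-- Each node with at least two agents has an agent of level at least `j`. -/
def Reached (j : ℕ) (C : Config Mem A V) : Prop :=
  ∀ a b, a ≠ b → loc C a = loc C b → ∃ c, loc C c = loc C a ∧ j ≤ lvl C c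

theorem Reached.dom (hR : Reached j C) {v : V} {x b : A} (hx : Dom C v x) (hb : loc C b = v)
    (hbx : b ≠ x) : j ≤ lvl C x := by
  obtain ⟨c, h1, h2⟩ := hR b x hbx (hb.trans hx.1.symm)
  exact h2.trans (level_le_of_le (hx.2.2 c (h1.trans hb)))

theorem Reached.settled (hR : Reached j C) {v : V} {s b : A} (hs : loc C s = v) (hb : loc C b = v)
    (hbs : b ≠ s) (h : ∀ c, loc C c = v → c ≠ s → str C c < str C s) : j ≤ lvl C s := by
  obtain ⟨c, h1, h2⟩ := hR b s hbs (hb.trans hs.symm)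
  by_cases hcs : c = s
  · exact hcs ▸ h2
  · exact h2.trans (level_le_of_le (h c (h1.trans hb) hcs).le)

/-- Agents with company travel with a leader of level at least `j`, or go to a place with an agent
at least as strong as the label they leave. Two agents that were both alone cannot meet, as neither
moves. -/
theorem Reached.next (hR : Reached j C) (hL : Link P ident sl C C') : Reached j C' := by
  intro a b hab h
  have key : ∀ a, (∃ b, b ≠ a ∧ loc C b = loc C a) → ∃ c, loc C' c = loc C' a ∧ j ≤ lvl C' c := by
    rintro a ⟨b, hba, hb⟩
    rcases hL.good.node_step hL.step (a := a) rfl with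
      ⟨y, hy, h1, -⟩ | ⟨y, t, q, hy, h1⟩ | ⟨t, q, hy, h1, h2⟩
    · exact absurd ((h1 b hb).trans (h1 a rfl).symm) hba
    · have hj := (hR.dom hy h1.loc_s h1.ne).trans (level_le_of_le h1.str_le)
      by_cases hat : a = t
      · exact ⟨t, by rw [hat], by rw [lvl, h1.str_s]; exact hj⟩
      · exact ⟨y, by rw [h1.x_loc hy, h1.move a rfl hat], hj⟩
    · by_cases hat : a = t
      · subst hat
        exact ⟨a, rfl, by rw [lvl, h1.str_s]; exact hR.settled rfl hb hba h2⟩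
      · obtain ⟨c, h3, -, h4⟩ := hL.target hy h1
        exact ⟨c, by rw [h3, (h1.move a rfl hat).1],
          (hR.settled h1.loc_s rfl hat h2).trans (level_le_of_le h4)⟩
  by_cases ha : ∃ c, c ≠ a ∧ loc C c = loc C a
  · exact key a ha
  by_cases hb : ∃ c, c ≠ b ∧ loc C c = loc C b
  · rw [h]; exact key b hb
  · push Not at ha hb
    have ha' := (hL.step.alone a fun c hc => by_contra fun hca => ha c hca hc).1
    have hb' := (hL.step.alone b fun c hc => by_contra fun hcb => hb c hcb hc).1
    exact absurd (ha'.symm.trans (h.trans hb')) (hb a hab)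

/-- The node `v` has a label of level `j`, and there are other agents, all of lower level. -/
def Weak (j : ℕ) (C : Config Mem A V) (v : V) : Prop :=
  ∃ s z, mode C s = Mode.settled ∧ loc C s = v ∧ z ≠ s ∧ loc C z = v ∧ lvl C s = j ∧
    ∀ a, loc C a = v → mode C a ≠ Mode.settled → lvl C a < j

/-- The agents at a weak node come from a weak node; in the slots `2` and `3`, they have followed
its pointer. -/
theorem Weak.origin (hR : Reached j C) (hL : Link P ident sl C C') {v : V} (h : Weak j C' v) :
    ∃ s q, mode C s = Mode.settled ∧ Weak j C (loc C s) ∧ v = (travel P (loc C s) q).1 ∧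
      (sl = 2 ∨ sl = 3 → q = lst C s) ∧ (sl ≠ 2 → sl ≠ 3 → q = -1) := by
  obtain ⟨s', z, hs, hsv, hzs, hzv, hsj, hlt⟩ := h
  rcases hL.good.node_step hL.step (a := z) rfl with
    ⟨y, hy, h1, h2, -⟩ | ⟨y, t, q, hy, h1⟩ | ⟨t, q, hy, h1, h2⟩
  · have := h1 z rfl
    subst this
    rw [h1 s' ((hL.good.settled_of_next hL.step hs).symm.trans (hsv.trans (hzv.symm.trans h2)))]
      at hzs
    exact absurd rfl hzs
  · have hzt : z ≠ t := by
      rintro rfl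
      exact hzs (hL.good'.settled_unique _ _ h1.mode_s hs (hzv.trans hsv.symm))
    have hj := (hR.dom hy h1.loc_s h1.ne).trans (level_le_of_le h1.str_le)
    exact absurd hj (not_le.2 (hlt y (by rw [h1.x_loc hy, ← h1.move z rfl hzt, hzv])
      (mode_ne_settled_of_leader h1.mode_x)))
  · have hzt : z ≠ t := by
      rintro rfl
      exact hzs (hL.good'.settled_unique _ _ h1.mode_s' hs (hzv.trans hsv.symm))
    have hv : v = (travel P (loc C z) q).1 := hzv.symm.trans (h1.move z rfl hzt).1
    have hj := hR.settled h1.loc_s rfl hzt h2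
    have hlow : ∀ a, loc C a = loc C z → a ≠ t → lvl C a < j := by
      intro a ha hat
      obtain ⟨m1, m2, m3⟩ := h1.move a ha hat
      have := hlt a (m1.trans hv.symm) (by rw [m2]; decide)
      rwa [lvl, m3] at this
    refine ⟨t, q, h1.mode_s, ⟨t, z, h1.mode_s, rfl, hzt, h1.loc_s.symm, le_antisymm ?_ hj, ?_⟩, ?_,
      ?_, ?_⟩
    -- The old label is of level at most `j`, because the pointer leads to a non-zombie at least as
    -- strong, and at a weak node none exceeds level `j`.
    · obtain ⟨b, h3, h4, h5⟩ := hL.target hy h1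
      refine (level_le_of_le h5).trans ?_
      rcases hm : mode C' b with _ | _ | _
      · exact (hlt b (h3.trans hv.symm) (by rw [hm]; decide)).le
      · exact absurd hm h4
      · rw [hL.good'.settled_unique _ _ hm hs (h3.trans (hv.symm.trans hsv.symm))]
        exact hsj.le
    · intro a ha has
      exact hlow a (ha.trans h1.loc_s) (by rintro rfl; exact has h1.mode_s)
    · rw [h1.loc_s]; exact hv
    · rintro (hsl | hsl)
      · refine h1.chase_two hsl (fun a ha => ?_) ⟨z, rfl, hzt⟩
        by_cases hat : a = t
        · rw [hat]
        · exact level_le_of_le (h2 a ha hat).le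
      · exact h1.chase_three hsl (fun a ha hat => (hlow a ha hat).trans_le hj) ⟨z, rfl, hzt⟩
    · exact h1.stay

/-- A weak node is no end of a path: its unsettled agents are below `mid`, and its label is not in
`hi`. -/
theorem Weak.path_step (hB : Base ident sl C) {cs cl : ℕ} {s : A} (h : Weak j C (loc C s))
    (hs : mode C s = Mode.settled) {b : ℕ}
    (hp : Path P C (atLevel j).mid (Term (atLevel j) C (AtNode C) cs cl) (loc C s) b) :
    ∃ b', b = b' + 1 ∧ Path P C (atLevel j).mid (Term (atLevel j) C (AtNode C) cs cl)
      (travel P (loc C s) (lst C s)).1 b' := by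
  obtain ⟨s', z, hs', hsv, hzs, hzv, hsj, hlt⟩ := h
  generalize hv : loc C s = v at *
  cases hp with
  | term h =>
    exfalso
    rcases h with ⟨a, h1, h2, h3⟩ | ⟨x, h1, h2, h3, -⟩ | ⟨z, h1, h2, h3, -⟩
    · have h3' : j + 1 ≤ lvl C a := h3
      by_cases hm : mode C a = Mode.settled
      · rw [hB.settled_unique a s' hm hs' (h1.trans hsv.symm)] at h3'
        omega
      · have := hlt a h1 hm
        omega
    · exact absurd (hlt x h1 (by rw [h2]; decide)) (not_lt.2 h3)
    · exact absurd (hlt z h1 (by rw [h2]; decide)) (not_lt.2 h3)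
  | @step t b h1 h2 h3 =>
    obtain rfl := hB.settled_unique s t hs h1 hv
    exact ⟨b, rfl, h3⟩

/-- The leader `x` has a level above `j`, or it is alone at its node, or it is at a node without
settled agent together with another agent of level at least `j`. -/
def Status (j : ℕ) (C : Config Mem A V) (x : A) : Prop :=
  j < lvl C x ∨ (∀ b, loc C b = loc C x → b = x) ∨
    ((∀ s, loc C s = loc C x → mode C s ≠ Mode.settled) ∧
      ∃ z, loc C z = loc C x ∧ z ≠ x ∧ j ≤ lvl C z)

/-- A leader that does not act alone has a level above `j` after the step. -/
theorem Status.lt_next (hid : Function.Injective ident) (hG : Good ident sl C) {v : V} {x s : A}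
    {q : ℤ} (hx : Dom C v x) (h : DomStep P sl C C' v x s q) (hst : Status j C x) :
    (atLevel j).hi (str C' x) := by
  rcases hst with h1 | h1 | ⟨h1, z, h2, h3, h4⟩
  · exact (Nat.succ_le_of_lt h1).trans (level_le_of_le h.str_le)
  · exact absurd (h1 s (h.loc_s.trans hx.1.symm)) h.ne
  · exact h.hi_of_mid hid hG hx (atLevel j) (h2.trans hx.1) h3 (h1 z h2) h4

/-- A leader with company acts and rises above `j`. A lone leader stays without a settled agent, so
it suffices that any newcomers include an agent of level at least `j`. -/
theorem Status.next (hid : Function.Injective ident) (hR : Reached j C)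
    (hL : Link P ident sl C C') (hW : ∀ v, ¬ Weak j C v) {x : A} (hx' : mode C' x = Mode.leader)
    (hst : Status j C x) : Status j C' x := by
  have hd := hL.good.dom_of_next hL.step hx'
  by_cases hlone : ∀ b, loc C b = loc C x → b = x
  swap
  · rcases hL.good.node_step hL.step (a := x) rfl with
      ⟨y, hy, h1, -⟩ | ⟨y, t, q, hy, h1⟩ | ⟨t, q, hy, -⟩
    · have := h1 x rfl
      subst this
      exact absurd h1 hlone
    · obtain rfl := hd.unique hid hL.good.toBase hy
      exact Or.inl (hst.lt_next hid hL.good hd h1)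
    · exact absurd ⟨x, hd⟩ hy
  obtain ⟨hl, -, hstr, -⟩ := hL.step.alone x hlone
  by_cases hj : j < lvl C x
  · exact Or.inl (by rw [lvl, hstr]; exact hj)
  by_cases hlone' : ∀ b, loc C' b = loc C' x → b = x
  · exact Or.inr (Or.inl hlone')
  push Not at hlone'
  obtain ⟨b, hb, hbx⟩ := hlone'
  refine Or.inr (Or.inr ⟨fun s hs hm => ?_, ?_⟩)
  · rw [hl, hL.good.settled_of_next hL.step hm] at hs
    rw [hlone s hs, hx'] at hm
    cases hm
  have hbx' : loc C b ≠ loc C x := fun h => hbx (hlone b h)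
  have hx_of : ∀ z, loc C z = loc C b → z ≠ x := by rintro z hz rfl; exact hbx' hz.symm
  have hne : loc C' b ≠ loc C b := fun h => hbx' (h ▸ hb.trans hl)
  rcases hL.good.node_step hL.step (a := b) rfl with
    ⟨y, hy, h1, h2, -⟩ | ⟨y, t, q, hy, h1⟩ | ⟨t, q, hy, h1, h2⟩
  · rw [← h1 b rfl] at h2
    exact absurd h2 hne
  · have hbt : b ≠ t := by rintro rfl; exact hne h1.loc_s'
    exact ⟨y, by rw [h1.x_loc hy, ← h1.move b rfl hbt, hb], hx_of y hy.1,
      (hR.dom hy h1.loc_s h1.ne).trans (level_le_of_le h1.str_le)⟩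
  · have hbt : b ≠ t := by rintro rfl; exact hne h1.loc_s'
    have hjt := hR.settled h1.loc_s rfl hbt h2
    have hbl := (h1.move b rfl hbt).1
    have hq : q ≠ -1 := by
      rintro rfl
      rw [travel_neg_one] at hbl
      exact hne hbl
    have hsl : sl = 2 ∨ sl = 3 := by
      by_contra h
      push Not at h
      exact hq (h1.stay h.1 h.2)
    have hql := h1.q_cases.resolve_left hq
    obtain ⟨c, h3, h4, h5⟩ := hL.chase hsl _ t h1.loc_s h1.mode_s hy
    have hcx : c = x := hlone c (by rw [h3, ← hql, ← hbl, hb, hl])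
    have htj : lvl C t = j :=
      le_antisymm ((level_le_of_le (hcx ▸ h5)).trans (not_lt.1 hj)) hjt
    -- The zombies come from a label of level exactly `j`. Their node is not weak, so one of them
    -- has level at least `j`.
    have hw := hW (loc C b)
    simp only [Weak, not_exists, not_and, not_forall, not_lt] at hw
    obtain ⟨a, h6, h7, h8⟩ := hw t b h1.mode_s h1.loc_s hbt rfl htj
    have hat : a ≠ t := by rintro rfl; exact h7 h1.mode_s
    obtain ⟨m1, -, m3⟩ := h1.move a h6 hat
    exact ⟨a, by rw [m1, ← hbl, hb], hx_of a h6, by rw [lvl, m3]; exact h8⟩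

/-- Under `Status`, a leader acting on company leaves a label above `j`, so its node becomes a sink.
Hence paths do not lengthen, and no reserves are needed. -/
theorem Path.sink_next (hid : Function.Injective ident) (hG : Good ident sl C)
    (hS : Step P sl C C') (hst : ∀ x, mode C x = Mode.leader → Status j C x)
    {v : V} {b : ℕ} (h : Path P C (atLevel j).mid (fun v _ => Sink j C v) v b) :
    Path P C' (atLevel j).mid (fun v _ => Sink j C' v) v b := by
  have hdom : ∀ {v y t q}, Dom C v y → DomStep P sl C C' v y t q → Sink j C' v :=
    fun {v y t q} hy h => Or.inl ⟨t, h.loc_s', by rw [h.mode_s]; decide, by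
      rw [h.str_s]; exact (hst y hy.2.1).lt_next hid hG hy h⟩
  have hhi : ∀ {v a}, loc C a = v → mode C a ≠ Mode.zombie → (atLevel j).hi (str C a) →
      Sink j C' v := by
    rintro v a rfl h2 h3
    obtain ⟨a', h4, h5, h6⟩ := hG.keep hS h2
    exact Or.inl ⟨a', h4, h5, (atLevel j).hi_mono h6 h3⟩
  refine h.map ?_ ?_
  · rintro v b (⟨a, h1, h2, h3⟩ | ⟨x, h1, h2, h3⟩)
    · exact .term (hhi h1 h2 h3)
    · refine .term ?_
      rcases hG.node_step hS h1 with
        ⟨y, hy, h4, h5, h6, h7, -⟩ | ⟨y, t, q, hy, h4⟩ | ⟨t, q, hy, h4, h5⟩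
      · rw [h4 x h1] at h3
        exact Or.inr ⟨y, h5, h6, h7 ▸ h3⟩
      · exact hdom hy h4
      · have hxt : x ≠ t := by rintro rfl; rw [h4.mode_s] at h2; cases h2
        rcases hst x h2 with h6 | h6 | ⟨h6, -⟩
        · exact hhi h1 (by rw [h2]; decide) h6
        · exact absurd (h6 t (h4.loc_s.trans h1.symm)).symm hxt
        · exact absurd h4.mode_s (h6 t (h4.loc_s.trans h1.symm))
  · intro s hs hm
    rcases hG.node_step hS (a := s) rfl with
      ⟨y, hy, h4, -⟩ | ⟨y, t, q, hy, h4⟩ | ⟨t, q, hy, h4, -⟩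
    · rw [h4 s rfl, hy.2.1] at hs; cases hs
    · exact Or.inl fun b => .term (hdom hy h4)
    · right
      obtain rfl := hG.settled_unique s t hs h4.mode_s h4.loc_s.symm
      exact ⟨h4.mode_s', h4.loc_s', h4.str_s, h4.lst_s⟩

/-- The node `v` has a label of level `j`, and there are other agents, but no leader of higher
level. -/
def Stuck (j : ℕ) (C : Config Mem A V) (v : V) : Prop :=
  ∃ s z, mode C s = Mode.settled ∧ loc C s = v ∧ z ≠ s ∧ loc C z = v ∧ lvl C s = j ∧
    ∀ x, loc C x = v → mode C x = Mode.leader → lvl C x ≤ j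

/-- A group with a leader would now be above `j`, so the other agents at a stuck node were under a
settled agent before. The target of their move bounds the label they left by `j`. -/
theorem Stuck.origin (hid : Function.Injective ident) (hR : Reached j C)
    (hL : Link P ident sl C C') (hst : ∀ x, mode C x = Mode.leader → Status j C x) {v : V}
    (h : Stuck j C' v) : ∃ s q, mode C s = Mode.settled ∧ Stuck j C (loc C s) ∧
      v = (travel P (loc C s) q).1 ∧ (q = -1 ∨ q = lst C s) ∧ (sl = 2 → q = lst C s) := by
  obtain ⟨s', z, hs, hsv, hzs, hzv, hsj, hle⟩ := h
  rcases hL.good.node_step hL.step (a := z) rfl with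
    ⟨y, hy, h1, h2, -⟩ | ⟨y, t, q, hy, h1⟩ | ⟨t, q, hy, h1, h2⟩
  · have := h1 z rfl
    subst this
    rw [h1 s' ((hL.good.settled_of_next hL.step hs).symm.trans (hsv.trans (hzv.symm.trans h2)))]
      at hzs
    exact absurd rfl hzs
  · have hzt : z ≠ t := by
      rintro rfl
      exact hzs (hL.good'.settled_unique _ _ h1.mode_s hs (hzv.trans hsv.symm))
    have hj : j + 1 ≤ lvl C' y := (hst y hy.2.1).lt_next hid hL.good hy h1
    have := hle y (by rw [h1.x_loc hy, ← h1.move z rfl hzt, hzv]) h1.mode_x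
    omega
  · have hzt : z ≠ t := by
      rintro rfl
      exact hzs (hL.good'.settled_unique _ _ h1.mode_s' hs (hzv.trans hsv.symm))
    have hv : v = (travel P (loc C z) q).1 := hzv.symm.trans (h1.move z rfl hzt).1
    have htj : lvl C t = j := by
      refine le_antisymm ?_ (hR.settled h1.loc_s rfl hzt h2)
      obtain ⟨b, h3, h4, h5⟩ := hL.target hy h1
      refine (level_le_of_le h5).trans ?_
      rcases hm : mode C' b with _ | _ | _
      · exact hle b (h3.trans hv.symm) hm
      · exact absurd hm h4
      · rw [hL.good'.settled_unique _ _ hm hs (h3.trans (hv.symm.trans hsv.symm))]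
        exact hsj.le
    refine ⟨t, q, h1.mode_s, ⟨t, z, h1.mode_s, rfl, hzt, h1.loc_s.symm, htj, ?_⟩, ?_, h1.q_cases,
      ?_⟩
    · intro x hx hxm
      rw [← htj]
      exact level_le_of_le (h2 x (hx.trans h1.loc_s) (by
        rintro rfl; rw [h1.mode_s] at hxm; cases hxm)).le
    · rw [h1.loc_s]; exact hv
    · intro hsl
      refine h1.chase_two hsl (fun a ha => ?_) ⟨z, rfl, hzt⟩
      by_cases hat : a = t
      · rw [hat]
      · exact level_le_of_le (h2 a ha hat).le

/-- By `Status`, a stuck node has no leader: its level is at most `j`, it is not alone, and a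
settled agent is present. So the node is not a sink. -/
theorem Stuck.path_step (hB : Base ident sl C)
    (hst : ∀ x, mode C x = Mode.leader → Status j C x) {s : A} (h : Stuck j C (loc C s))
    (hs : mode C s = Mode.settled) {b : ℕ}
    (hp : Path P C (atLevel j).mid (fun v _ => Sink j C v) (loc C s) b) :
    ∃ b', b = b' + 1 ∧ Path P C (atLevel j).mid (fun v _ => Sink j C v)
      (travel P (loc C s) (lst C s)).1 b' := by
  obtain ⟨s', z, hs', hsv, hzs, hzv, hsj, hle⟩ := h
  generalize hv : loc C s = v at *
  have hno : ∀ x, loc C x = v → mode C x ≠ Mode.leader := by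
    intro x hx hxm
    rcases hst x hxm with h | h | ⟨h, -⟩
    · exact absurd (hle x hx hxm) (not_le.2 h)
    · rw [h s' (hsv.trans hx.symm), hxm] at hs'; cases hs'
    · exact h s' (hsv.trans hx.symm) hs'
  cases hp with
  | term h =>
    exfalso
    rcases h with ⟨a, h1, h2, h3⟩ | ⟨x, h1, h2, -⟩
    · have h3' : j + 1 ≤ lvl C a := h3
      rcases hm : mode C a with _ | _ | _
      · exact hno a h1 hm
      · exact h2 hm
      · rw [hB.settled_unique a s' hm hs' (h1.trans hsv.symm)] at h3'
        omega
    · exact hno x h1 h2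
  | @step t b h1 h2 h3 =>
    obtain rfl := hB.settled_unique s t hs h1 hv
    exact ⟨b, rfl, h3⟩

end Phases

/-! ### Progress in one cycle -/

section CyclePhases

variable {A V : Type*} [Fintype V] {G : SimpleGraph V} [DecidableRel G.Adj] [Fintype A]
  {P : PortLabelling G} {ident : A → ℕ} {C₂ C₃ C₄ C₅ C₆ : Config Mem A V} {j : ℕ}

theorem Cycle.links (hid : Function.Injective ident) (hc : Cycle P ident C₂ C₃ C₄ C₅ C₆) :
    Link P ident 2 C₂ C₃ ∧ Link P ident 3 C₃ C₄ ∧ Link P ident 0 C₄ C₅ ∧ Link P ident 1 C₅ C₆ :=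
  ⟨hc.calm₂.link hid hc.step₂, hc.calm₃.link hid hc.step₃, hc.calm₄.link hid hc.step₄,
    hc.semi₅.link hid hc.step₅⟩

theorem Cycle.reached (hid : Function.Injective ident) (hc : Cycle P ident C₂ C₃ C₄ C₅ C₆)
    (hR : Reached j C₂) : Reached j C₃ ∧ Reached j C₄ ∧ Reached j C₅ ∧ Reached j C₆ := by
  obtain ⟨l2, l3, l4, l5⟩ := hc.links hid
  have h3 := hR.next l2
  have h4 := h3.next l3
  have h5 := h4.next l4
  exact ⟨h3, h4, h5, h5.next l5⟩

theorem Cycle.not_weak (hid : Function.Injective ident) (hc : Cycle P ident C₂ C₃ C₄ C₅ C₆)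
    (hR : Reached j C₂) (hW : ∀ v, ¬ Weak j C₂ v) : (∀ v, ¬ Weak j C₃ v) ∧ (∀ v, ¬ Weak j C₄ v) ∧
      (∀ v, ¬ Weak j C₅ v) ∧ ∀ v, ¬ Weak j C₆ v := by
  obtain ⟨l2, l3, l4, l5⟩ := hc.links hid
  obtain ⟨r3, r4, r5, -⟩ := hc.reached hid hR
  have key : ∀ {sl : Fin 4} {C C' : Config Mem A V}, Reached j C → Link P ident sl C C' →
      (∀ v, ¬ Weak j C v) → ∀ v, ¬ Weak j C' v := fun hR hL hW v h => by
    obtain ⟨s, -, -, h, -⟩ := h.origin hR hL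
    exact hW _ h
  have h3 := key hR l2 hW
  have h4 := key r3 l3 h3
  have h5 := key r4 l4 h4
  exact ⟨h3, h4, h5, key r5 l5 h5⟩

/-- In each cycle, the distance of the weak nodes from the ends of the paths decreases. -/
theorem Cycle.weak_next (hid : Function.Injective ident) (hdeg : ∀ v, 0 < G.degree v)
    (hc : Cycle P ident C₂ C₃ C₄ C₅ C₆) (hR : Reached j C₂) {v : V} (hv : Weak j C₆ v) :
    ∃ u, Weak j C₂ u ∧
      ∀ b, Path P C₂ (atLevel j).mid (Term (atLevel j) C₂ (AtNode C₂) 1 1) u b → ∃ b',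
        b = b' + 1 ∧ Path P C₆ (atLevel j).mid (Term (atLevel j) C₆ (AtNode C₆) 1 1) v b' := by
  obtain ⟨l2, l3, l4, l5⟩ := hc.links hid
  obtain ⟨r3, r4, r5, -⟩ := hc.reached hid hR
  obtain ⟨s5, q, -, w5, e5, -, k5⟩ := hv.origin r5 l5
  rw [k5 (by decide) (by decide), travel_neg_one] at e5
  obtain ⟨s4, q, -, w4, e4, -, k4⟩ := w5.origin r4 l4
  rw [k4 (by decide) (by decide), travel_neg_one] at e4
  obtain ⟨s3, q3, m3, w3, e3, k3, -⟩ := w4.origin r3 l3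
  obtain ⟨s2, q2, m2, w2, e2, k2, -⟩ := w3.origin hR l2
  rw [k3 (Or.inr rfl)] at e3
  rw [k2 (Or.inl rfl)] at e2
  -- Two pointer steps are gained in the slots `2` and `3`, and one unit is paid back by
  -- `Path.shift`.
  refine ⟨_, w2, fun b hb => ?_⟩
  obtain ⟨b', rfl, hb'⟩ := w2.path_step hc.calm₂.toBase m2 hb
  rw [← e2] at hb'
  have h3 := hc.calm₂.path_chase hid hc.step₂ (Or.inl ⟨rfl, rfl⟩) _ hb'
  obtain ⟨b'', rfl, hb''⟩ := w3.path_step hc.calm₃.toBase m3 h3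
  rw [← e3] at hb''
  have h4 := hc.calm₃.path_chase hid hc.step₃ (Or.inr ⟨rfl, rfl⟩) _ hb''
  have h5 := hc.calm₄.path_forward hid hdeg hc.step₄ _ h4
  have h6 := hc.semi₅.path_next hid hc.step₅ _ h5
  refine ⟨b'' + 1, rfl, ?_⟩
  rw [e5, e4]
  exact Path.shift (K := atLevel j) h6

theorem Cycle.status_next (hid : Function.Injective ident) (hc : Cycle P ident C₂ C₃ C₄ C₅ C₆)
    (hR : Reached j C₂) (hW : ∀ v, ¬ Weak j C₂ v) {x : A} (hx : mode C₆ x = Mode.leader)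
    (hst : Status j C₂ x) :
    Status j C₃ x ∧ Status j C₄ x ∧ Status j C₅ x ∧ Status j C₆ x := by
  obtain ⟨l2, l3, l4, l5⟩ := hc.links hid
  obtain ⟨r3, r4, r5, -⟩ := hc.reached hid hR
  obtain ⟨w3, w4, w5, -⟩ := hc.not_weak hid hR hW
  obtain ⟨-, m3, m4, m5⟩ := hc.leader hx
  have h3 := hst.next hid hR l2 hW m3
  have h4 := h3.next hid r3 l3 w3 m4
  have h5 := h4.next hid r4 l4 w4 m5
  exact ⟨h3, h4, h5, h5.next hid r5 l5 w5 hx⟩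

/-- A leader that violates `Status` has explored one more port at the end of the cycle, if it still
violates it. -/
theorem Cycle.explored_of_not_status (hid : Function.Injective ident)
    (hconn : G.Connected) (hcard : Fintype.card A ≤ Fintype.card V)
    (hdeg : ∀ v, 0 < G.degree v) (hc : Cycle P ident C₂ C₃ C₄ C₅ C₆) (hR : Reached j C₂)
    {x : A} (hx : mode C₆ x = Mode.leader) (h2 : ¬ Status j C₂ x) (h6 : ¬ Status j C₆ x)
    (h0 : Explored P C₂ x 0) {N : ℕ} (hN : Explored P C₂ x N) : Explored P C₆ x (N + 1) := by
  obtain ⟨m2, m3, m4, m5⟩ := hc.leader hx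
  simp only [Status, not_or] at h2 h6
  obtain ⟨-, h2, -⟩ := h2
  push Not at h2
  obtain ⟨b, hb, hbx⟩ := h2
  have hd := hc.calm₂.toGood.dom_of_next hc.step₂ m3
  have hj := hR.dom hd hb hbx
  obtain ⟨l2, l3, l4, l5⟩ := hc.str_le hx
  -- With company, `Reached j` gives level at least `j` at the start; violating `Status` gives level
  -- at most `j` at the end. So no raise resets the traversal.
  have hlvl : lvl C₆ x = lvl C₂ x := le_antisymm ((not_lt.1 h6.1).trans hj)
    (level_le_of_le (l2.trans (l3.trans (l4.trans l5))))
  have hstr : str C₆ x = str C₂ x := by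
    have e2 := hc.calm₂.lid_eq x (mode_ne_settled_of_leader m2)
    have e6 := hc.calm₆.lid_eq x (mode_ne_settled_of_leader hx)
    exact congrArg toLex (Prod.ext hlvl (e6.trans e2.symm))
  refine (hc.explored hid hconn hcard hdeg hx h0).2 hstr N hN ?_
  obtain ⟨s, hs, hsl⟩ := hc.lone₂ b x hbx hb
  obtain ⟨s3, sl3, -⟩ := hc.calm₂.toGood.settled_next hc.step₂ hs
  obtain ⟨s4, sl4, -⟩ := hc.calm₃.toGood.settled_next hc.step₃ s3
  refine ⟨s, s4, ?_⟩
  rw [sl4, sl3, hsl, hb, (hc.calm₃.leader_stays hid hc.step₃ (by decide)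
    (hc.calm₃.toGood.dom_of_next hc.step₃ m4)).1, (hc.calm₂.leader_stays hid hc.step₂ (by decide)
    hd).1]

/-- Only the step in slot `2` is guaranteed, since strong zombies rest in slot `3`. It is a net gain
because paths to sinks no longer lengthen. -/
theorem Cycle.stuck_next (hid : Function.Injective ident)
    (hc : Cycle P ident C₂ C₃ C₄ C₅ C₆) (hR : Reached j C₂) (hW : ∀ v, ¬ Weak j C₂ v)
    (hst : ∀ x, mode C₂ x = Mode.leader → Status j C₂ x) {v : V} (hv : Stuck j C₆ v) :
    ∃ u, Stuck j C₂ u ∧ ∀ b, Path P C₂ (atLevel j).mid (fun v _ => Sink j C₂ v) u b → ∃ b',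
        b' + 1 ≤ b ∧ Path P C₆ (atLevel j).mid (fun v _ => Sink j C₆ v) v b' := by
  obtain ⟨l2, l3, l4, l5⟩ := hc.links hid
  obtain ⟨r3, r4, r5, -⟩ := hc.reached hid hR
  obtain ⟨w3, w4, -, -⟩ := hc.not_weak hid hR hW
  have st : ∀ {sl : Fin 4} {C C' : Config Mem A V}, Reached j C → Link P ident sl C C' →
      (∀ v, ¬ Weak j C v) → (∀ x, mode C x = Mode.leader → Status j C x) →
      ∀ x, mode C' x = Mode.leader → Status j C' x := fun hR hL hW hst x hx =>
    (hst x (hL.good.dom_of_next hL.step hx).2.1).next hid hR hL hW hx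
  have st3 := st hR l2 hW hst
  have st4 := st r3 l3 w3 st3
  have st5 := st r4 l4 w4 st4
  have key : ∀ {sl : Fin 4} {C C' : Config Mem A V}, Reached j C → Link P ident sl C C' →
      (∀ x, mode C x = Mode.leader → Status j C x) → ∀ {v}, Stuck j C' v → ∃ u, Stuck j C u ∧
      ∀ b, Path P C (atLevel j).mid (fun v _ => Sink j C v) u b → ∃ b',
        b' ≤ b ∧ (sl = 2 → b' + 1 ≤ b) ∧
        Path P C' (atLevel j).mid (fun v _ => Sink j C' v) v b' := by
    intro sl C C' hR hL hst v hv
    obtain ⟨s, q, m, w, e, k, k2⟩ := hv.origin hid hR hL hst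
    refine ⟨_, w, fun b hb => ?_⟩
    by_cases hq : q = lst C s
    · obtain ⟨b', rfl, hb'⟩ := w.path_step hL.good.toBase hst m hb
      rw [← hq, ← e] at hb'
      exact ⟨b', by omega, fun _ => le_rfl, hb'.sink_next hid hL.good hL.step hst⟩
    · rw [k.resolve_right hq, travel_neg_one] at e
      refine ⟨b, le_rfl, fun h => absurd (k2 h) hq, ?_⟩
      rw [e]
      exact hb.sink_next hid hL.good hL.step hst
  obtain ⟨u5, c5, p5⟩ := key r5 l5 st5 hv
  obtain ⟨u4, c4, p4⟩ := key r4 l4 st4 c5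
  obtain ⟨u3, c3, p3⟩ := key r3 l3 st3 c4
  obtain ⟨u2, c2, p2⟩ := key hR l2 hst c3
  refine ⟨u2, c2, fun b hb => ?_⟩
  obtain ⟨b2, -, i2, hb⟩ := p2 b hb
  obtain ⟨b3, i3, -, hb⟩ := p3 b2 hb
  obtain ⟨b4, i4, -, hb⟩ := p4 b3 hb
  obtain ⟨b5, i5, -, hb⟩ := p5 b4 hb
  have := i2 rfl
  exact ⟨b5, by omega, hb⟩

/-- When no node is stuck, the next level is reached. -/
theorem Cycle.reached_succ (hc : Cycle P ident C₂ C₃ C₄ C₅ C₆)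
    (hR : Reached j C₂) (hst : ∀ x, mode C₂ x = Mode.leader → Status j C₂ x)
    (hS : ∀ v, ¬ Stuck j C₂ v) : Reached (j + 1) C₂ := by
  intro a b hab h
  obtain ⟨s, hs, hsl⟩ := hc.lone₂ a b hab h
  have hlead : ∀ x, loc C₂ x = loc C₂ a → mode C₂ x = Mode.leader → j + 1 ≤ lvl C₂ x := by
    intro x hx hm
    have hsx : loc C₂ s = loc C₂ x := hsl.trans hx.symm
    rcases hst x hm with h | h | ⟨h, -⟩
    · exact h
    · rw [h s hsx, hm] at hs; cases hs
    · exact absurd hs (h s hsx)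
  obtain ⟨c, hc1, hc2⟩ := hR a b hab h
  obtain ⟨t, ht1, ht2, ht3⟩ := hc.calm₂.toGood.exists_top a
  have htj : j ≤ lvl C₂ t := hc2.trans (level_le_of_le (ht3 c hc1))
  rcases hm : mode C₂ t with _ | _ | _
  · exact ⟨t, ht1, hlead t ht1 hm⟩
  · exact absurd hm ht2
  · obtain rfl := hc.calm₂.settled_unique s t hs hm (hsl.trans ht1.symm)
    rcases htj.lt_or_eq with h' | h'
    · exact ⟨s, hsl, h'⟩
    · exfalso
      obtain ⟨z, hz, hzs⟩ : ∃ z, loc C₂ z = loc C₂ a ∧ z ≠ s := by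
        by_cases has : a = s
        · exact ⟨b, h.symm, by rintro rfl; exact hab has⟩
        · exact ⟨a, rfl, has⟩
      refine hS (loc C₂ a) ⟨s, z, hs, hsl, hzs, hz, h'.symm, fun x hx hxm => ?_⟩
      rw [h']
      exact level_le_of_le (ht3 x hx)

end CyclePhases

/-! ### Duration of the three stages -/

section Sequence

variable {A V : Type*} [Fintype V] {G : SimpleGraph V} [DecidableRel G.Adj] [Fintype A]
  {P : PortLabelling G} {ident : A → ℕ} {D : ℕ → Config Mem A V} {i j : ℕ}

/-- The maximum number of ports that a leader explores without raising its level. -/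
noncomputable def portBound (G : SimpleGraph V) [DecidableRel G.Adj] (k : ℕ) : ℕ :=
  min (2 * G.edgeSet.ncard) (min (k * G.maxDegree) (k * (k - 1)))

theorem Explored.le_portBound {C : Config Mem A V} {x : A} {N : ℕ} (h : Explored P C x N) :
    N ≤ portBound G (Fintype.card A) := by
  obtain ⟨g, hg, hN⟩ := h
  exact hN.trans (hg.valid.total_le hg.card_le)

variable (hid : Function.Injective ident)
  (hD : ∀ i, ∃ C₃ C₄ C₅, Cycle P ident (D i) C₃ C₄ C₅ (D (i + 1)))

include hid hD

theorem reached_of_le (hR : Reached j (D i)) (r : ℕ) : Reached j (D (i + r)) := by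
  induction r with
  | zero => exact hR
  | succ r ih =>
    obtain ⟨C₃, C₄, C₅, hc⟩ := hD (i + r)
    exact (hc.reached hid ih).2.2.2

theorem not_weak_of_le (hR : Reached j (D i)) (hW : ∀ v, ¬ Weak j (D i) v) (r : ℕ) :
    ∀ v, ¬ Weak j (D (i + r)) v := by
  induction r with
  | zero => exact hW
  | succ r ih =>
    obtain ⟨C₃, C₄, C₅, hc⟩ := hD (i + r)
    exact (hc.not_weak hid (reached_of_le hid hD hR r) ih).2.2.2

/-- The starting budget is the number of agents, for a shortest path, plus `1` for the reserve of a
leader at its end; each cycle uses up one unit. -/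
theorem not_weak (hdeg : ∀ v, 0 < G.degree v) (hR : Reached j (D i)) :
    ∀ v, ¬ Weak j (D (i + (Fintype.card A + 2))) v := by
  have key : ∀ r v, Weak j (D (i + r)) v → ∃ b, b + r ≤ Fintype.card A + 1 ∧
      Path P (D (i + r)) (atLevel j).mid
        (Term (atLevel j) (D (i + r)) (AtNode (D (i + r))) 1 1) v b := by
    intro r
    induction r with
    | zero =>
      rintro v ⟨s, z, hs, rfl, -, -, hj, -⟩
      obtain ⟨C₃, C₄, C₅, hc⟩ := hD i
      obtain ⟨b, hb⟩ := hc.calm₂.exists_path hs hj.ge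
      obtain ⟨b', hb', hp⟩ := hb.exists_le
      refine ⟨b' + 1, by omega, hp.add (n := 1) ?_⟩
      rintro v b (h | ⟨x, h1, h2, h3⟩)
      · exact Or.inl h
      · exact Or.inr (Or.inl ⟨x, h1, h2, h3, by omega⟩)
    | succ r ih =>
      intro v hv
      obtain ⟨C₃, C₄, C₅, hc⟩ := hD (i + r)
      obtain ⟨u, hu, h⟩ := hc.weak_next hid hdeg (reached_of_le hid hD hR r) hv
      obtain ⟨b, hb, hp⟩ := ih u hu
      obtain ⟨b', rfl, hp'⟩ := h b hp
      exact ⟨b', by omega, hp'⟩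
  intro v hv
  obtain ⟨b, hb, -⟩ := key _ v hv
  omega

/-- `Status` persists, so a late violator has violated it from the start and has explored a port in
every cycle. -/
theorem status (hconn : G.Connected) (hcard : Fintype.card A ≤ Fintype.card V)
    (hdeg : ∀ v, 0 < G.degree v)
    (h0 : ∀ i x, mode (D i) x = Mode.leader → Explored P (D i) x 0)
    (hR : Reached j (D i)) (hW : ∀ v, ¬ Weak j (D i) v) :
    ∀ x, mode (D (i + (portBound G (Fintype.card A) + 1))) x = Mode.leader →
      Status j (D (i + (portBound G (Fintype.card A) + 1))) x := by
  have key : ∀ r x, mode (D (i + r)) x = Mode.leader → ¬ Status j (D (i + r)) x →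
      Explored P (D (i + r)) x r := by
    intro r
    induction r with
    | zero => exact fun x hx _ => h0 i x hx
    | succ r ih =>
      intro x hx hst
      obtain ⟨C₃, C₄, C₅, hc⟩ := hD (i + r)
      have hR' := reached_of_le hid hD hR r
      have hx' := (hc.leader hx).1
      have hst' : ¬ Status j (D (i + r)) x := fun h =>
        hst (hc.status_next hid hR' (not_weak_of_le hid hD hR hW r) hx h).2.2.2
      exact hc.explored_of_not_status hid hconn hcard hdeg hR' hx hst' hst (h0 _ x hx')
        (ih x hx' hst')
  intro x hx
  by_contra hst
  have := (key _ x hx hst).le_portBound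
  omega

theorem reached_succ (hR : Reached j (D i)) (hW : ∀ v, ¬ Weak j (D i) v)
    (hst : ∀ x, mode (D i) x = Mode.leader → Status j (D i) x) :
    Reached (j + 1) (D (i + (Fintype.card A + 1))) := by
  have hst' : ∀ r x, mode (D (i + r)) x = Mode.leader → Status j (D (i + r)) x := by
    intro r
    induction r with
    | zero => exact hst
    | succ r ih =>
      intro x hx
      obtain ⟨C₃, C₄, C₅, hc⟩ := hD (i + r)
      exact (hc.status_next hid (reached_of_le hid hD hR r) (not_weak_of_le hid hD hR hW r) hx
        (ih x (hc.leader hx).1)).2.2.2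
  have key : ∀ r v, Stuck j (D (i + r)) v → ∃ b, b + r ≤ Fintype.card A ∧
      Path P (D (i + r)) (atLevel j).mid (fun v _ => Sink j (D (i + r)) v) v b := by
    intro r
    induction r with
    | zero =>
      rintro v ⟨s, z, hs, rfl, -, -, hj, -⟩
      obtain ⟨C₃, C₄, C₅, hc⟩ := hD i
      obtain ⟨b, hb⟩ := hc.calm₂.exists_path hs hj.ge
      exact hb.exists_le
    | succ r ih =>
      intro v hv
      obtain ⟨C₃, C₄, C₅, hc⟩ := hD (i + r)
      obtain ⟨u, hu, h⟩ := hc.stuck_next hid (reached_of_le hid hD hR r)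
        (not_weak_of_le hid hD hR hW r) (hst' r) hv
      obtain ⟨b, hb, hp⟩ := ih u hu
      obtain ⟨b', hb', hp'⟩ := h b hp
      exact ⟨b', by omega, hp'⟩
  obtain ⟨C₃, C₄, C₅, hc⟩ := hD (i + (Fintype.card A + 1))
  refine hc.reached_succ (reached_of_le hid hD hR _) (hst' _) fun v hv => ?_
  obtain ⟨b, hb, -⟩ := key _ v hv
  omega

/-- The number of cycles after which the next level is reached. -/
noncomputable def phaseLength (G : SimpleGraph V) [DecidableRel G.Adj] (k : ℕ) : ℕ :=
  (k + 2) + ((portBound G k + 1) + (k + 1))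

/-- The three summands of `phaseLength` are the durations of `not_weak`, `status` and
`reached_succ`. -/
theorem reached (hconn : G.Connected) (hcard : Fintype.card A ≤ Fintype.card V)
    (hdeg : ∀ v, 0 < G.degree v)
    (h0 : ∀ i x, mode (D i) x = Mode.leader → Explored P (D i) x 0) (j : ℕ) :
    Reached j (D (j * phaseLength G (Fintype.card A))) := by
  induction j with
  | zero => exact fun a b _ _ => ⟨a, rfl, Nat.zero_le _⟩
  | succ j ih =>
    have r1 := reached_of_le hid hD ih (Fintype.card A + 2)
    have w1 := not_weak hid hD hdeg ih
    have s2 := status hid hD hconn hcard hdeg h0 r1 w1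
    have := reached_succ hid hD (reached_of_le hid hD r1 _) (not_weak_of_le hid hD r1 w1 _) s2
    rwa [add_assoc, add_assoc, ← phaseLength, ← Nat.succ_mul] at this

end Sequence

/-! ### Termination of the execution -/

section Time

variable {A V : Type*} [Fintype V] {G : SimpleGraph V} [DecidableRel G.Adj] [Fintype A]
  (P : PortLabelling G) {ident : A → ℕ} (ch : ZombieChoice) (hid : Function.Injective ident)
  (hdeg : ∀ v, 0 < G.degree v) (place : A → V)

include hid hdeg

theorem run_explored (hconn : G.Connected) (hcard : Fintype.card A ≤ Fintype.card V) (i : ℕ)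
    (x : A) (hx : mode (run ch P ident place (4 * i + 2)) x = Mode.leader) :
    Explored P (run ch P ident place (4 * i + 2)) x 0 := by
  induction i with
  | zero =>
    have hC := initial_calm ch P place (ident := ident)
    have hS := run_step P ch hid place 0 hC.toBase
    have hC1 := run_semi P ch hid hdeg place 0
    have hS1 := run_step P ch hid place 1 hC1.toBase
    have hm : ∀ a, mode (run ch P ident place 0) a = Mode.leader := fun _ => rfl
    have h0 : Explored P (run ch P ident place 0) x 0 :=
      ⟨Traversal.start (loc (run ch P ident place 0) x) (ein (run ch P ident place 0) x),
        { covered := fun v hv hvw => absurd (Finset.mem_singleton.1 hv) hvw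
          labels := fun s hs => by rw [hm] at hs; cases hs
          valid := Traversal.start_valid P _ _
          w_eq := rfl
          last_w := Traversal.start_last _ _ }, Nat.zero_le _⟩
    have h1 := (hC.semiExplored_next hid hconn hcard hdeg hS
      (hC1.toGood.dom_of_next hS1 hx).2.1).1 h0
    exact (hC1.explored_next hid hS1 hx ⟨0, h1⟩).1
  | succ i ih =>
    have hc := run_cycle P ch hid hdeg place i
    exact (hc.explored hid hconn hcard hdeg hx (ih (hc.leader hx).1)).1

/-- The level that has been reached is one more than the weight bound allows, so no two agents share
a node. -/
theorem run_injective (hconn : G.Connected) (hcard : Fintype.card A ≤ Fintype.card V) :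
    Function.Injective (loc (run ch P ident place
      (4 * ((Nat.log 2 (2 * occupied place) + 1) * phaseLength G (Fintype.card A)) + 2))) := by
  have hR := reached (D := fun i => run ch P ident place (4 * i + 2)) hid
    (fun i => ⟨_, _, _, run_cycle P ch hid hdeg place i⟩) hconn hcard hdeg
    (fun i x => run_explored P ch hid hdeg place hconn hcard i x)
    (Nat.log 2 (2 * occupied place) + 1)
  intro a b hab
  by_contra hne
  obtain ⟨c, -, hc⟩ := hR a b hne hab
  have h := two_pow_lvl_le P ch hid hdeg place
    (4 * ((Nat.log 2 (2 * occupied place) + 1) * phaseLength G (Fintype.card A)) + 2) c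
  have := Nat.le_log_of_pow_le (by norm_num) h
  omega

theorem run_legitimate {t : ℕ} (h : Function.Injective (loc (run ch P ident place t))) :
    (algorithm ch).Legitimate P (run ch P ident place t) := by
  have key : ∀ r, loc (run ch P ident place (t + r)) = loc (run ch P ident place t) := by
    intro r
    induction r with
    | zero => rfl
    | succ r ih =>
      obtain ⟨sl, hG⟩ := run_good P ch hid hdeg place (t + r)
      rw [← ih] at h ⊢
      funext a
      exact ((run_step P ch hid place (t + r) hG.toBase).alone a fun b hb => h hb).1
  refine ⟨h, fun r a => ?_⟩
  have : (algorithm ch).exec P (run ch P ident place t) r = run ch P ident place (t + r) := by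
    rw [run, run, Algorithm.exec, Algorithm.exec, Algorithm.exec, ← Function.iterate_add_apply,
      add_comm]
  rw [this]
  exact congrFun (key r) a

end Time

/-! ### The explicit time bound -/

section Bounds

variable {A V : Type*} [Fintype V] {G : SimpleGraph V} [DecidableRel G.Adj] [Fintype A]
  {ident : A → ℕ}

theorem degree_pos_of_two_le (hconn : G.Connected) (h : 2 ≤ Fintype.card V) (v : V) :
    0 < G.degree v := by
  have : Nontrivial V := Fintype.one_lt_card_iff_nontrivial.1 h
  exact hconn.preconnected.degree_pos_of_nontrivial v

theorem run_of_subsingleton [Subsingleton A] (ch : ZombieChoice) (P : PortLabelling G)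
    (place : A → V) (t : ℕ) :
    (∃ sl, Base ident sl (run ch P ident place t)) ∧ ∀ a,
      loc (run ch P ident place t) a = place a ∧ mode (run ch P ident place t) a = Mode.leader ∧
      lvl (run ch P ident place t) a = 0 := by
  have hid : Function.Injective ident := Function.injective_of_subsingleton ident
  induction t with
  | zero => exact ⟨⟨0, (initial_calm ch P place).toBase⟩, fun a => ⟨rfl, rfl, rfl⟩⟩
  | succ t ih =>
    obtain ⟨⟨sl, hB⟩, h⟩ := ih
    have hS := run_step P ch hid place t hB
    have key : ∀ a, loc (run ch P ident place (t + 1)) a = place a ∧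
        mode (run ch P ident place (t + 1)) a = Mode.leader ∧
        str (run ch P ident place (t + 1)) a = str (run ch P ident place t) a := fun a => by
      obtain ⟨h1, h2, h3, -⟩ := hS.alone a fun b _ => Subsingleton.elim b a
      exact ⟨h1.trans (h a).1, h2.trans (h a).2.1, h3⟩
    refine ⟨⟨sl + 1, fun a => (hS.id_eq a).trans (hB.id_eq a),
      fun a b _ _ _ => Subsingleton.elim a b, fun a _ => ?_,
      fun a => by rw [hS.slot_eq, hB.slot_eq]⟩, fun a => ⟨(key a).1, (key a).2.1, ?_⟩⟩
    · exact (congrArg (fun p : ℕ ×ₗ ℕ => (ofLex p).2) (key a).2.2).trans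
        (hB.lid_eq a (mode_ne_settled_of_leader (h a).2.1))
    · rw [lvl, (key a).2.2]; exact (h a).2.2

theorem portBound_le_two_mul_mPrime (k : ℕ) : (portBound G k : ℝ) ≤ 2 * mPrime G k := by
  rw [portBound, mPrime, mul_min_of_nonneg _ _ zero_le_two, mul_min_of_nonneg _ _ zero_le_two,
    Nat.cast_min, Nat.cast_min]
  refine min_le_min (by push_cast; rfl) (min_le_min ?_ ?_)
  · push_cast; linarith
  · rw [Nat.cast_choose_two]
    rcases k with _ | k
    · simp
    · push_cast [Nat.add_sub_cancel]; linarith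

/-- This lets the terms of order `k` in a phase be absorbed. A connected graph on `n` nodes has at
least `n - 1` edges, and all degrees are positive since `n ≥ 2`. -/
theorem le_portBound (hconn : G.Connected) {k : ℕ} (hk : 2 ≤ k) (hkn : k ≤ Fintype.card V) :
    k ≤ portBound G k := by
  refine le_min ?_ (le_min ?_ ?_)
  · have := hconn.card_vert_le_card_edgeSet_add_one
    rw [Nat.card_eq_fintype_card, Nat.card_coe_set_eq] at this
    omega
  · obtain ⟨v⟩ := hconn.nonempty
    exact Nat.le_mul_of_pos_right _
      ((degree_pos_of_two_le hconn (hk.trans hkn) v).trans_le (G.degree_le_maxDegree v))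
  · exact Nat.le_mul_of_pos_right _ (by omega)

theorem mPrime_nonneg (k : ℕ) : 0 ≤ mPrime G k := by
  unfold mPrime; positivity

theorem exists_legitimate (ch : ZombieChoice) (P : PortLabelling G) (place : A → V)
    (hconn : G.Connected) (hcard : Fintype.card A ≤ Fintype.card V)
    (hid : Function.Injective ident) : ∃ t : ℕ,
      (t : ℝ) ≤ 82 * mPrime G (Fintype.card A) * (1 + Real.logb 2 (occupied place)) ∧
      (algorithm ch).Legitimate P
        ((algorithm ch).exec P ((algorithm ch).initial ident place) t) := by
  have hm := mPrime_nonneg (G := G) (Fintype.card A)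
  have hlog : 0 ≤ Real.logb 2 (occupied place) := by
    rcases Nat.eq_zero_or_pos (occupied place) with h | h
    · simp [h]
    · exact Real.logb_nonneg one_lt_two (by exact_mod_cast h)
  rcases Nat.lt_or_ge (Fintype.card A) 2 with hk | hk
  · have : Subsingleton A := Fintype.card_le_one_iff_subsingleton.1 (by omega)
    refine ⟨0, by push_cast; positivity, Function.injective_of_subsingleton _, fun t a => ?_⟩
    exact ((run_of_subsingleton ch P place t).2 a).1
  have hdeg := degree_pos_of_two_le hconn (hk.trans hcard)
  refine ⟨_, ?_, run_legitimate P ch hid hdeg place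
    (run_injective P ch hid hdeg place hconn hcard)⟩
  obtain ⟨a⟩ : Nonempty A := Fintype.card_pos_iff.1 (by omega)
  have hocc : 0 < occupied place := (Set.ncard_pos (Set.toFinite _)).2 ⟨place a, a, rfl⟩
  have h1 := portBound_le_two_mul_mPrime (G := G) (Fintype.card A)
  have h2 : (Nat.log 2 (2 * occupied place) : ℝ) ≤ 1 + Real.logb 2 (occupied place) := by
    have h : ((2 * occupied place : ℕ) : ℝ) = 2 * (occupied place : ℝ) := by push_cast; rfl
    have h3 := Real.natLog_le_logb (2 * occupied place) 2
    rw [h] at h3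
    refine h3.trans_eq ?_
    rw [Nat.cast_ofNat, Real.logb_mul two_ne_zero (by positivity),
      Real.logb_self_eq_one one_lt_two]
  -- The length is `portBound + 2k + 4`, and `2k + 4 ≤ 4k` for `k ≥ 2`.
  have h3 : phaseLength G (Fintype.card A) ≤ 5 * portBound G (Fintype.card A) := by
    have := le_portBound hconn hk hcard
    rw [phaseLength]; omega
  have h4 : (2 : ℕ) ≤ portBound G (Fintype.card A) := hk.trans (le_portBound hconn hk hcard)
  set N := portBound G (Fintype.card A)
  set l := Real.logb 2 (occupied place)
  calc ((4 * ((Nat.log 2 (2 * occupied place) + 1) * phaseLength G (Fintype.card A)) + 2 : ℕ) : ℝ)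
      ≤ 4 * ((1 + l + 1) * (5 * N)) + N := by
        push_cast
        have h3' : (phaseLength G (Fintype.card A) : ℝ) ≤ 5 * N := by exact_mod_cast h3
        have h4' : (2 : ℝ) ≤ N := by exact_mod_cast h4
        gcongr
    _ ≤ 41 * N * (1 + l) := by
        have : 0 ≤ (N : ℝ) * l := by positivity
        linarith
    _ ≤ 41 * (2 * mPrime G (Fintype.card A)) * (1 + l) := by gcongr
    _ = 82 * mPrime G (Fintype.card A) * (1 + l) := by ring

end Bounds

/-! ### The memory bound -/

section Memory

/-- The ports in the state `a` are at most `D` and the identifiers are at most `B`. -/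
structure Bounded (D : ℤ) (B : ℕ) (a : Agent) : Prop where
  pout : -1 ≤ a.pout ∧ a.pout ≤ D
  pin : -1 ≤ a.pin ∧ a.pin ≤ D
  last : -1 ≤ a.mem.last ∧ a.mem.last ≤ D
  inport : -1 ≤ a.mem.inport ∧ a.mem.inport ≤ D
  id : a.id ≤ B
  leaderId : a.mem.leaderId ≤ B

variable {D : ℤ} {B : ℕ}

theorem Bounded.killAndRecord {m a : Agent} (hD : 0 ≤ D) (h : Bounded D B a) :
    Bounded D B (killAndRecord m a) where
  pout := ⟨le_rfl, by simp only [Dispersion.killAndRecord]; omega⟩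
  pin := h.pin
  last := h.last
  inport := by
    simp only [Dispersion.killAndRecord]
    split_ifs
    · exact h.pin
    · exact h.inport
  id := h.id
  leaderId := h.leaderId

theorem Bounded.raiseLevel {S : Finset Agent} {m a : Agent} (h : Bounded D B a) :
    Bounded D B (raiseLevel S m a) := by
  unfold Dispersion.raiseLevel
  split_ifs
  · exact ⟨h.pout, h.pin, h.last, h.inport, h.id, h.leaderId⟩
  · exact h

theorem Bounded.makeMinion {m a : Agent} (hm : Bounded D B m) (h : Bounded D B a) :
    Bounded D B (makeMinion m a) :=
  ⟨h.pout, h.pin, hm.inport, h.inport, h.id, hm.leaderId⟩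

/-- Positivity of `δ` matters: reduction modulo `0` would leave the incremented port unbounded. -/
theorem Bounded.leaderAction {ch : ZombieChoice} {δ : ℕ} {S₀ S : Finset Agent} {m a : Agent}
    (hδ : 0 < δ) (hδD : (δ : ℤ) ≤ D) (hm : Bounded D B m) (h : Bounded D B a) :
    Bounded D B (leaderAction ch δ S₀ S m a) := by
  have h1 : -1 ≤ (m.mem.inport + 1) % (δ : ℤ) ∧ (m.mem.inport + 1) % (δ : ℤ) ≤ D := by
    have := Int.emod_nonneg (m.mem.inport + 1) (b := δ) (by omega)
    have := Int.emod_lt_of_pos (m.mem.inport + 1) (b := δ) (by omega)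
    omega
  unfold Dispersion.leaderAction
  split
  · split_ifs
    · exact hm.makeMinion ⟨h.pout, h.pin, h.last, h.inport, h.id, h.leaderId⟩
    · exact h
  · split_ifs
    · exact h
    · exact ⟨hm.inport, h.pin, h.last, h.inport, h.id, h.leaderId⟩
    · exact ⟨h.pout, h.pin, h1, h.inport, h.id, h.leaderId⟩
    · exact ⟨h1, h.pin, h.last, h.inport, h.id, h.leaderId⟩
    · exact h
    · exact hm.makeMinion h
    · exact h

theorem Bounded.chaseAction {S : Finset Agent} {s a : Agent}
    (hs : Bounded D B s) (h : Bounded D B a) : Bounded D B (chaseAction S s a) := by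
  simp only [Dispersion.chaseAction]
  split_ifs
  · exact h
  · exact ⟨hs.last, h.pin, h.last, h.inport, h.id, h.leaderId⟩
  · exact h

theorem aMax_mem {S : Finset Agent} {m : Agent} (h : aMax S = some m) : m ∈ S := by
  classical
  rw [aMax] at h
  split_ifs at h with h1
  · cases h
    exact (Finset.mem_filter.1 h1.choose_spec.1).1
  · rw [settledAgent] at h
    split_ifs at h with h2
    cases h
    exact h2.choose_spec.1

theorem Bounded.localAction {ch : ZombieChoice} {δ : ℕ} {S : Finset Agent} {a : Agent}
    (hδ : 0 < δ ∨ S.card < 2) (hδD : (δ : ℤ) ≤ D) (hS : ∀ s ∈ S, Bounded D B s)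
    (h : Bounded D B a) : Bounded D B (localAction ch δ S a) := by
  have hD : 0 ≤ D := le_trans (by positivity) hδD
  unfold Dispersion.localAction
  split
  · exact ⟨⟨le_rfl, by dsimp only; omega⟩, h.pin, h.last, h.inport, h.id, h.leaderId⟩
  · rename_i m hm
    have hm' := hS m (aMax_mem hm)
    dsimp only
    split_ifs with h1 h2
    · exact (hm'.killAndRecord hD).raiseLevel.leaderAction (hδ.resolve_right (by omega)) hδD
        (h.killAndRecord hD).raiseLevel
    · exact (hm'.killAndRecord hD).chaseAction (h.killAndRecord hD)
    · exact h.killAndRecord hD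

variable {A V : Type*} [Fintype V] {G : SimpleGraph V} [DecidableRel G.Adj] [Fintype A]
  {ident : A → ℕ}

theorem travel_port_le (P : PortLabelling G) (v : V) (q : ℤ) :
    -1 ≤ (travel P v q).2 ∧ (travel P v q).2 ≤ G.maxDegree := by
  by_cases h : IsPort G v q
  · obtain ⟨-, ⟨h1, h2⟩, -⟩ := travel_spec P h
    have := G.degree_le_maxDegree (travel P v q).1
    omega
  · rw [travel_of_not_isPort P h]
    exact ⟨le_rfl, by dsimp only; omega⟩

theorem run_bounded (ch : ZombieChoice) (P : PortLabelling G) (place : A → V)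
    (hconn : G.Connected) (hcard : Fintype.card A ≤ Fintype.card V) (hB : ∀ a, ident a ≤ B)
    (t : ℕ) (a : A) : Bounded G.maxDegree B (run ch P ident place t a).1 := by
  induction t generalizing a with
  | zero => exact ⟨⟨le_rfl, by change (-1 : ℤ) ≤ _; omega⟩, ⟨le_rfl, by change (-1 : ℤ) ≤ _; omega⟩,
      ⟨by change (-1 : ℤ) ≤ 0; omega, by change (0 : ℤ) ≤ _; omega⟩,
      ⟨le_rfl, by change (-1 : ℤ) ≤ _; omega⟩, hB a, hB a⟩
  | succ t ih =>
    rw [run_succ, next_eq]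
    set C := run ch P ident place t
    have hδ : 0 < G.degree (loc C a) ∨ (localView C (loc C a)).card < 2 := by
      rcases Nat.lt_or_ge (Fintype.card V) 2 with hn | hn
      · right
        have : Subsingleton A := Fintype.card_le_one_iff_subsingleton.1 (by omega)
        exact not_le.1 (card_localView_le_one fun b _ => Subsingleton.elim b a)
      · exact Or.inl (degree_pos_of_two_le hconn hn _)
    have h := Bounded.localAction (ch := ch) hδ
      (by exact_mod_cast G.degree_le_maxDegree (loc C a)) (fun s hs => by
        obtain ⟨b, -, rfl⟩ := mem_localView.1 hs
        exact ih b) (ih a)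
    exact ⟨h.pout, travel_port_le P _ _, h.last, h.inport, (ih a).id, h.leaderId⟩

theorem size_le_one_add_logb {x y : ℕ} (hxy : x ≤ y) :
    (Nat.size x : ℝ) ≤ 1 + Real.logb 2 y := by
  have h1 : Nat.size x ≤ Nat.log 2 y + 1 :=
    Nat.size_le.2 (hxy.trans_lt (Nat.lt_pow_succ_log_self one_lt_two y))
  have h2 := Real.natLog_le_logb y 2
  have h3 : (Nat.size x : ℝ) ≤ Nat.log 2 y + 1 := by exact_mod_cast h1
  rw [Nat.cast_ofNat] at h2
  linarith

theorem intBits_le {D : ℕ} {k : ℕ} (hk : 0 < k) {z : ℤ} (h : -1 ≤ z ∧ z ≤ D) :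
    (intBits z : ℝ) ≤ 2 + Real.logb 2 ((k : ℝ) + D) := by
  have := size_le_one_add_logb (x := z.natAbs) (y := k + D) (by omega)
  push_cast at this
  rw [intBits]
  push_cast
  linarith

theorem eval_le_eval_one_mul_pow (p : Polynomial ℕ) {k : ℕ} (hk : 0 < k) :
    p.eval k ≤ p.eval 1 * k ^ p.natDegree := by
  rw [Polynomial.eval_eq_sum_range, Polynomial.eval_eq_sum_range, Finset.sum_mul]
  refine Finset.sum_le_sum fun i hi => ?_
  rw [one_pow, mul_one]
  exact Nat.mul_le_mul_left _ (Nat.pow_le_pow_right hk (by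
    have := Finset.mem_range.1 hi; omega))

theorem size_eval_le (p : Polynomial ℕ) {k : ℕ} (hk : 0 < k) :
    Nat.size (p.eval k) ≤ Nat.size (p.eval 1) + p.natDegree * Nat.size k := by
  rw [Nat.size_le, pow_add, mul_comm p.natDegree, pow_mul]
  exact (eval_le_eval_one_mul_pow p hk).trans_lt
    (Nat.mul_lt_mul_of_lt_of_le (Nat.lt_size_self _)
      (Nat.pow_le_pow_left (Nat.lt_size_self k).le _) (by positivity))

theorem two_pow_lvl_le_two_mul_card (ch : ZombieChoice) (P : PortLabelling G) (place : A → V)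
    (hconn : G.Connected) (hcard : Fintype.card A ≤ Fintype.card V)
    (hid : Function.Injective ident) (t : ℕ) (a : A) :
    2 ^ lvl (run ch P ident place t) a ≤ 2 * Fintype.card A := by
  have hpos : 0 < Fintype.card A := Fintype.card_pos_iff.2 ⟨a⟩
  rcases Nat.lt_or_ge (Fintype.card V) 2 with hn | hn
  · have : Subsingleton A := Fintype.card_le_one_iff_subsingleton.1 (by omega)
    rw [((run_of_subsingleton ch P place t).2 a).2.2]
    omega
  · refine (two_pow_lvl_le P ch hid (degree_pos_of_two_le hconn hn) place t a).trans
      (Nat.mul_le_mul_left 2 ?_)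
    rw [occupied, ← Set.image_univ, ← Nat.card_eq_fintype_card, ← Set.ncard_univ]
    exact Set.ncard_image_le (Set.toFinite _)

/-- The two identifiers give the first summand of the constant. The rest is at most `13 + 5L`: four
port values of `2 + L` bits, four bits for `mode` and `slot`, and `1 + L` bits for the level. -/
theorem memoryBits_le (p : Polynomial ℕ) (ch : ZombieChoice) (P : PortLabelling G) (place : A → V)
    (hconn : G.Connected) (hcard : Fintype.card A ≤ Fintype.card V)
    (hid : Function.Injective ident) (hp : ∀ a, ident a ≤ p.eval (Fintype.card A)) (t : ℕ)
    (a : A) :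
    (memoryBits (run ch P ident place t a).1 : ℝ) ≤
      (2 * (Nat.size (p.eval 1) + p.natDegree) + 13 : ℕ) *
        (1 + Real.logb 2 ((Fintype.card A : ℝ) + (G.maxDegree : ℝ))) := by
  have hpos : 0 < Fintype.card A := Fintype.card_pos_iff.2 ⟨a⟩
  have hb := run_bounded ch P place hconn hcard hp t a
  have hl := two_pow_lvl_le_two_mul_card ch P place hconn hcard hid t a
  set k := Fintype.card A
  set L := Real.logb 2 ((k : ℝ) + (G.maxDegree : ℝ)) with hL
  have hL0 : 0 ≤ L := Real.logb_nonneg one_lt_two (by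
    have : (1 : ℝ) ≤ k := by exact_mod_cast hpos
    have : (0 : ℝ) ≤ G.maxDegree := by positivity
    linarith)
  have hk : (Nat.size k : ℝ) ≤ 1 + L := by
    have := size_le_one_add_logb (x := k) (y := k + G.maxDegree) (by omega)
    rwa [Nat.cast_add] at this
  have hid' : ∀ x ≤ p.eval k, (Nat.size x : ℝ) ≤
      ((Nat.size (p.eval 1) + p.natDegree : ℕ) : ℝ) * (1 + L) := by
    intro x hx
    have h1 : (Nat.size x : ℝ) ≤ Nat.size (p.eval 1) + p.natDegree * Nat.size k := by
      exact_mod_cast (Nat.size_le_size hx).trans (size_eval_le p hpos)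
    refine h1.trans ?_
    push_cast
    rw [add_mul]
    gcongr
    exact le_mul_of_one_le_right (by positivity) (by linarith)
  have hlev : (Nat.size (run ch P ident place t a).1.mem.level : ℝ) ≤ 1 + L := by
    -- The level is already logarithmic, so its size may be bounded by the level itself.
    have h1 : Nat.size (run ch P ident place t a).1.mem.level ≤ lvl (run ch P ident place t) a :=
      Nat.size_le.2 Nat.lt_two_pow_self
    have h2 : lvl (run ch P ident place t) a ≤ Nat.size k := by
      have h3 : 2 ^ lvl (run ch P ident place t) a < 2 ^ (Nat.size k + 1) := by
        have := Nat.lt_size_self k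
        rw [pow_succ]; omega
      have := (Nat.pow_lt_pow_iff_right (by norm_num : 1 < 2)).1 h3
      omega
    exact (Nat.cast_le.2 (h1.trans h2)).trans hk
  have h1 := hid' _ hb.id
  have h2 := hid' _ hb.leaderId
  have h3 := intBits_le hpos hb.pin
  have h4 := intBits_le hpos hb.pout
  have h5 := intBits_le hpos hb.last
  have h6 := intBits_le hpos hb.inport
  rw [← hL] at h3 h4 h5 h6
  rw [memoryBits]
  push_cast at h1 h2 ⊢
  linarith

end Memory

end Dispersion

theorem mainTheorem1 :
    (∃ c : ℝ, ∀ (ch : Dispersion.ZombieChoice)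
      (V : Type*) [Fintype V] (G : SimpleGraph V) [DecidableRel G.Adj]
      (P : Dispersion.PortLabelling G) (A : Type*) [Fintype A]
      (ident : A → ℕ) (place : A → V),
      G.Connected → Fintype.card A ≤ Fintype.card V →
      Function.Injective ident → (∀ a, 0 < ident a) →
      ∃ t : ℕ,
        (t : ℝ) ≤ c * Dispersion.mPrime G (Fintype.card A) *
          (1 + Real.logb 2 (Dispersion.occupied place)) ∧
        (Dispersion.algorithm ch).Legitimate P
          ((Dispersion.algorithm ch).exec P
            ((Dispersion.algorithm ch).initial ident place) t)) ∧
    (∀ p : Polynomial ℕ, ∃ c : ℝ, ∀ (ch : Dispersion.ZombieChoice)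
      (V : Type*) [Fintype V] (G : SimpleGraph V) [DecidableRel G.Adj]
      (P : Dispersion.PortLabelling G) (A : Type*) [Fintype A]
      (ident : A → ℕ) (place : A → V),
      G.Connected → Fintype.card A ≤ Fintype.card V →
      Function.Injective ident → (∀ a, 0 < ident a) →
      (∀ a, ident a ≤ p.eval (Fintype.card A)) →
      ∀ (t : ℕ) (a : A),
        (Dispersion.memoryBits ((Dispersion.algorithm ch).exec P
            ((Dispersion.algorithm ch).initial ident place) t a).1 : ℝ) ≤
          c * (1 + Real.logb 2 ((Fintype.card A : ℝ) + (G.maxDegree : ℝ)))) :=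
  ⟨⟨82, fun ch _ _ _ _ P _ _ _ place hconn hcard hid _ =>
      Dispersion.exists_legitimate ch P place hconn hcard hid⟩,
    fun p => ⟨_, fun ch _ _ _ _ P _ _ _ place hconn hcard hid _ hp =>
      Dispersion.memoryBits_le p ch P place hconn hcard hid hp⟩⟩
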